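/- Let $\mathcal G$ be a finite connected plane bipartite simple graph, with sets $B$ and $W$ of black and white vertices and positive edge weights $\chi$, whose outer face is bounded by a 4-cycle with distinct vertices $w_0,b_0,w_1,b_1$ listed counterclockwise (the boundary vertices). Assume that $\mathcal G$ is nondegenerate: every nonempty set $S$ of non-boundary vertices of one colour has at least $|S|+2$ neighbours. Let $K=(K(b,w))_{b\in B,w\in W}$ be a real Kasteleyn matrix of $(\mathcal G,\chi)$: $K(b,w)=\pm\chi_{bw}$ if $bw$ is an edge, $K(b,w)=0$ otherwise, and the alternating product of the signs around each bounded face of degree $2d$ is $(-1)^{d+1}$. Then $K$ is invertible and $$a=\sqrt{-\frac{K^{-1}(w_0,b_0)\,K^{-1}(w_1,b_1)}{K^{-1}(w_0,b_1)\,K^{-1}(w_1,b_0)}}$$ is a well-defined positive real number. After a gauge transformation $K(b,w)\mapsto g(b)K(b,w)h(w)$ with nonzero real factors $g,h$ that are equal to $1$ off the boundary vertices, one has $$K^{-1}(w_0,b_0)=K^{-1}(w_1,b_1)=a,\qquad K^{-1}(w_0,b_1)=-K^{-1}(w_1,b_0)=1.\qquad(*)$$ Let now $K$ be replaced by any matrix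 gauge equivalent to it (with nonzero real factors) that satisfies $(*)$, and define, with principal square roots, $$\mathcal F^\bullet(b)=-\sqrt{-a-i}\,K^{-1}(w_0,b)-\sqrt{a+i}\,K^{-1}(w_1,b),\qquad \mathcal F^\circ(w)=-\sqrt{-a+i}\,K^{-1}(w,b_0)+\sqrt{a-i}\,K^{-1}(w,b_1).$$ Then $\mathcal F^\bullet,\mathcal F^\circ$ are Coulomb gauge functions: $K^{\top}\mathcal F^\bullet=0$ on $W\setminus\{w_0,w_1\}$ and $K\mathcal F^\circ=0$ on $B\setminus\{b_0,b_1\}$. The augmented dual $\mathcal G^*$ is the dual of the graph obtained by joining the boundary vertices to infinity: its inner vertices are the bounded faces of $\mathcal G$, and it has one outer vertex $v_{ij}$ for each boundary edge $w_ib_j$. The outer vertices form a 4-cycle in $\mathcal G^*$, in the counterclockwise order $v_{00},v_{10},v_{11},v_{01}$. There are maps $\mathcal T,\mathcal O$ from the vertices of $\mathcal G^*$ to $\mathbb C$ with $\mathcal T(v_{00})=\mathcal O(v_{00})=0$ and $$d\mathcal T(bw^*)=\mathcal F^\bullet(b)K(b,w)\mathcal F^\circ(w),\qquad d\mathcal O(bw^*)=\mathcal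 F^\bullet(b)K(b,w)\overline{\mathcal F^\circ(w)}$$ for every edge $bw$, where the dual edge $bw^*$ is oriented so that $b$ is on its right. For all such $\mathcal T$ and $\mathcal O$ the following holds. 1. $\mathcal T$ is a perfect t-embedding of $\mathcal G^*$. That is: drawing all edges of $\mathcal G^*$ (the outer ones included) as line segments gives a proper embedding that respects the plane structure; the edge lengths $|d\mathcal T(bw^*)|$ are gauge equivalent to $\chi$ (with positive factors); at each inner vertex the angles of the black faces sum to $\pi$, and so do those of the white faces; the boundary polygon with vertices $\mathcal T(v_{00}),\mathcal T(v_{10}),\mathcal T(v_{11}),\mathcal T(v_{01})$ is tangential; and for each outer vertex $v$ with inner neighbour $v_{\rm in}$, the point $\mathcal T(v_{\rm in})$ lies on the bisector of the angle of the polygon at $\mathcal T(v)$, and the open segment from $\mathcal T(v)$ to $\mathcal T(v_{\rm in})$ meets the interior of the polygon. 2. The boundary polygon is the rhombus with $$\mathcal T(v_{00})=0,\quad \mathcal T(v_{01})=(a+i)\sqrt{a^2+1},\quad \mathcal T(v_{11})=2a\sqrt{a^2+1},\quad \mathcal T(v_{10})=(a-i)\sqrt{a^2+1}.$$ 3. $\mathcal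 O(v_{00})=0$, $\mathcal O(v_{01})=-(a^2+1)$, $\mathcal O(v_{11})=0$, $\mathcal O(v_{10})=-(a^2+1)$. -/

import Mathlib

open scoped ComplexConjugate

/-- A finite connected plane bipartite graph (when `B` and `W` are finite), with black vertices `B`
and white vertices `W`, given as a combinatorial map of genus zero: a connected simple graph all of
whose edges join a black to a white vertex, together with, for every vertex, the counterclockwise
cyclic order of the edges at that vertex.
`rotB e` is the edge that follows `e` counterclockwise around the black end of `e`, and `rotW e` the
edge that follows `e` counterclockwise around the white end of `e`.
The face to the left of `e`, oriented from black to white, is the orbit of `e` under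
`rotB⁻¹ * rotW⁻¹` (walk along `e` to the white end, take the next edge clockwise there, walk along
it to its black end, take the next edge clockwise there); planarity is Euler's formula. -/
structure PlaneBipartiteGraph (B W : Type*) where
  graph : SimpleGraph (B ⊕ W)
  bipartite : graph ≤ completeBipartiteGraph B W
  connected : graph.Connected
  rotB : Equiv.Perm {e : B × W // graph.Adj (Sum.inl e.1) (Sum.inr e.2)}
  rotW : Equiv.Perm {e : B × W // graph.Adj (Sum.inl e.1) (Sum.inr e.2)}
  rotB_cycle : ∀ e e', rotB.SameCycle e e' ↔ e.1.1 = e'.1.1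
  rotW_cycle : ∀ e e', rotW.SameCycle e e' ↔ e.1.2 = e'.1.2
  euler : Nat.card B + Nat.card W
      + Nat.card (Quotient (Equiv.Perm.SameCycle.setoid (rotB⁻¹ * rotW⁻¹)))
    = Nat.card {e : B × W // graph.Adj (Sum.inl e.1) (Sum.inr e.2)} + 2

/-- A plane bipartite graph with outer face of degree four: `w0, b0, w1, b1` are the boundary
vertices listed counterclockwise.  The four `rot` conditions say that the outer face (which lies to
the left of `b0 → w0 → b1 → w1 → b0`) is bounded by exactly these four edges. -/
structure QuadGraph (B W : Type*) extends PlaneBipartiteGraph B W where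
  b0 : B
  b1 : B
  w0 : W
  w1 : W
  b_ne : b0 ≠ b1
  w_ne : w0 ≠ w1
  adj00 : graph.Adj (Sum.inl b0) (Sum.inr w0)
  adj01 : graph.Adj (Sum.inl b0) (Sum.inr w1)
  adj10 : graph.Adj (Sum.inl b1) (Sum.inr w0)
  adj11 : graph.Adj (Sum.inl b1) (Sum.inr w1)
  rot_w0 : rotW ⟨(b1, w0), adj10⟩ = ⟨(b0, w0), adj00⟩
  rot_b1 : rotB ⟨(b1, w1), adj11⟩ = ⟨(b1, w0), adj10⟩
  rot_w1 : rotW ⟨(b0, w1), adj01⟩ = ⟨(b1, w1), adj11⟩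
  rot_b0 : rotB ⟨(b0, w0), adj00⟩ = ⟨(b0, w1), adj01⟩

namespace QuadGraph

variable {B W : Type*} (G : QuadGraph B W)

/-- The edges, as pairs (black end, white end). -/
abbrev Edge : Type _ := {e : B × W // G.graph.Adj (Sum.inl e.1) (Sum.inr e.2)}

noncomputable instance instFintypeEdge [Finite B] [Finite W] : Fintype G.Edge := Fintype.ofFinite _

/-- The faces of `G`, including the outer one. -/
abbrev Face : Type _ := Quotient (Equiv.Perm.SameCycle.setoid (G.rotB⁻¹ * G.rotW⁻¹))

/-- The face to the left of the edge `e`, oriented from its black to its white end. -/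
def leftFace (e : G.Edge) : G.Face := Quotient.mk _ e

/-- The face to the right of the edge `e`, oriented from its black to its white end. -/
def rightFace (e : G.Edge) : G.Face := G.leftFace (G.rotB⁻¹ e)

/-- The boundary edge `b0 w0`. -/
def e00 : G.Edge := ⟨(G.b0, G.w0), G.adj00⟩

/-- The boundary edge `b0 w1`. -/
def e01 : G.Edge := ⟨(G.b0, G.w1), G.adj01⟩

/-- The boundary edge `b1 w0`. -/
def e10 : G.Edge := ⟨(G.b1, G.w0), G.adj10⟩

/-- The boundary edge `b1 w1`. -/
def e11 : G.Edge := ⟨(G.b1, G.w1), G.adj11⟩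

/-- The outer face. -/
def outer : G.Face := G.leftFace G.e00

/-- The vertices of the augmented dual `G*`: the bounded faces of `G` (inner vertices), and four
outer vertices `v 0, v 1, v 2, v 3`, counterclockwise, one for each piece of the outer face after
all boundary vertices have been connected to infinity: `v 0` is the piece at the edge `b0 w0`,
`v 1` at `b0 w1`, `v 2` at `b1 w1`, `v 3` at `b1 w0`. -/
abbrev DualVertex : Type _ := {f : G.Face // f ≠ G.outer} ⊕ Fin 4

/-- The outer vertices of the augmented dual. -/
abbrev v (k : Fin 4) : G.DualVertex := Sum.inr k

open Classical in
/-- The vertex of `G*` to the left of `e`, oriented from black to white. -/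
noncomputable def leftV (e : G.Edge) : G.DualVertex :=
  if h : G.leftFace e = G.outer then G.v (if e = G.e00 then 0 else 2)
  else Sum.inl ⟨G.leftFace e, h⟩

open Classical in
/-- The vertex of `G*` to the right of `e`, oriented from black to white. -/
noncomputable def rightV (e : G.Edge) : G.DualVertex :=
  if h : G.rightFace e = G.outer then G.v (if e = G.e01 then 1 else 3)
  else Sum.inl ⟨G.rightFace e, h⟩

/-- The edges of the augmented dual: the duals of the edges of `G`, and the four outer edges
`v k, v (k+1)`, which are dual to the edges from the boundary vertices to infinity. -/
abbrev DualEdge : Type _ := G.Edge ⊕ Fin 4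

/-- One end of an edge of the augmented dual. -/
noncomputable def fst : G.DualEdge → G.DualVertex
  | Sum.inl e => G.leftV e
  | Sum.inr k => G.v k

/-- The other end of an edge of the augmented dual. -/
noncomputable def snd : G.DualEdge → G.DualVertex
  | Sum.inl e => G.rightV e
  | Sum.inr k => G.v (k + 1)

/-- The inner vertex of `G*` that is adjacent to the outer vertex `v k`. -/
noncomputable def innerNbr : Fin 4 → G.DualVertex :=
  ![G.rightV G.e00, G.leftV G.e01, G.rightV G.e11, G.leftV G.e10]

/-- Nondegeneracy: every nonempty set `S` of non-boundary vertices of one colour has at least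
`|S| + 2` neighbours. -/
def Nondegenerate : Prop :=
  (∀ S : Set B, S.Nonempty → G.b0 ∉ S → G.b1 ∉ S →
    S.ncard + 2 ≤ {w | ∃ b ∈ S, G.graph.Adj (Sum.inl b) (Sum.inr w)}.ncard) ∧
  (∀ S : Set W, S.Nonempty → G.w0 ∉ S → G.w1 ∉ S →
    S.ncard + 2 ≤ {b | ∃ w ∈ S, G.graph.Adj (Sum.inl b) (Sum.inr w)}.ncard)

/-! ### Kasteleyn matrices and gauge transformations -/

section Kasteleyn

variable [Fintype B] [Fintype W]

open Classical in
/-- `K` is a real Kasteleyn matrix of `(G, χ)`: `K b w = ± χ (bw)` on edges, `0` elsewhere, and the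
alternating product of the signs around each bounded face of degree `2d` is `(-1)^(d+1)`.  A face of
degree `2d` lies to the left of `d` of its edges and to the right of the `d` others, and these two
kinds of edges alternate along it. -/
structure IsKasteleyn (χ : G.Edge → ℝ) (K : Matrix B W ℝ) : Prop where
  on_edge : ∀ e : G.Edge, K e.1.1 e.1.2 = χ e ∨ K e.1.1 e.1.2 = -χ e
  off_edge : ∀ b w, ¬ G.graph.Adj (Sum.inl b) (Sum.inr w) → K b w = 0
  sign : ∀ f : G.Face, f ≠ G.outer →
    (∏ e : G.Edge with G.leftFace e = f, Real.sign (K e.1.1 e.1.2)) /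
        (∏ e : G.Edge with G.rightFace e = f, Real.sign (K e.1.1 e.1.2))
      = (-1) ^ ((Finset.univ.filter fun e : G.Edge => G.leftFace e = f).card + 1)

end Kasteleyn

/-- `K'` arises from `K` by a gauge transformation (with real nonzero factors). -/
def GaugeEquiv {B W : Type*} (K K' : Matrix B W ℝ) : Prop :=
  ∃ (g : B → ℝ) (h : W → ℝ), (∀ b, g b ≠ 0) ∧ (∀ w, h w ≠ 0) ∧ ∀ b w, K' b w = g b * K b w * h w

/-- `K'` arises from `K` by a gauge transformation at the four boundary vertices. -/
def BoundaryGaugeEquiv (K K' : Matrix B W ℝ) : Prop :=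
  ∃ (g : B → ℝ) (h : W → ℝ), (∀ b, g b ≠ 0) ∧ (∀ w, h w ≠ 0) ∧
    (∀ b, b ≠ G.b0 → b ≠ G.b1 → g b = 1) ∧ (∀ w, w ≠ G.w0 → w ≠ G.w1 → h w = 1) ∧
    ∀ b w, K' b w = g b * K b w * h w

/-- `Kinv` is the (two-sided) inverse of `K`. -/
def IsInverse {B W : Type*} [Fintype B] [DecidableEq B] [Fintype W] [DecidableEq W]
    (K : Matrix B W ℝ) (Kinv : Matrix W B ℝ) : Prop :=
  K * Kinv = 1 ∧ Kinv * K = 1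

/-- The parameter `a_G`, in terms of the inverse Kasteleyn matrix. -/
noncomputable def aParam (Kinv : Matrix W B ℝ) : ℝ :=
  √(-((Kinv G.w0 G.b0 * Kinv G.w1 G.b1) / (Kinv G.w0 G.b1 * Kinv G.w1 G.b0)))

/-- The normalization of the boundary values of the inverse Kasteleyn matrix. -/
def IsNormalized (a : ℝ) (Kinv : Matrix W B ℝ) : Prop :=
  Kinv G.w0 G.b0 = a ∧ Kinv G.w1 G.b1 = a ∧ Kinv G.w0 G.b1 = 1 ∧ -Kinv G.w1 G.b0 = 1

/-- The function `F^•` on black vertices (`Complex.sqrt` is the principal branch). -/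
noncomputable def FB (a : ℝ) (Kinv : Matrix W B ℝ) (b : B) : ℂ :=
  -Complex.sqrt (-a - Complex.I) * Kinv G.w0 b - Complex.sqrt (a + Complex.I) * Kinv G.w1 b

/-- The function `F^∘` on white vertices. -/
noncomputable def FW (a : ℝ) (Kinv : Matrix W B ℝ) (w : W) : ℂ :=
  -Complex.sqrt (-a + Complex.I) * Kinv w G.b0 + Complex.sqrt (a - Complex.I) * Kinv w G.b1

/-- Coulomb gauge functions for `K`. -/
def IsCoulombGauge [Fintype B] [Fintype W] (K : Matrix B W ℝ) (F : B → ℂ) (F' : W → ℂ) : Prop :=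
  (∀ w, w ≠ G.w0 → w ≠ G.w1 → ∑ b, (K b w : ℂ) * F b = 0) ∧
  (∀ b, b ≠ G.b0 → b ≠ G.b1 → ∑ w, (K b w : ℂ) * F' w = 0)

/-- `T` is a t-realisation of `G*` for `(F, F')`: `dT(bw*) = F(b) K(b,w) F'(w)`, where the dual edge
`bw*` is oriented so that it has the black vertex `b` on its right, that is, it leads from the
left to the right of the edge `b → w`. -/
def IsTRealisation (K : Matrix B W ℝ) (F : B → ℂ) (F' : W → ℂ) (T : G.DualVertex → ℂ) : Prop :=
  ∀ e : G.Edge, T (G.rightV e) - T (G.leftV e) = F e.1.1 * K e.1.1 e.1.2 * F' e.1.2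

/-- `O` is the origami map for `(F, F')`: `dO(bw*) = F(b) K(b,w) conj F'(w)`. -/
def IsOrigami (K : Matrix B W ℝ) (F : B → ℂ) (F' : W → ℂ) (O : G.DualVertex → ℂ) : Prop :=
  ∀ e : G.Edge, O (G.rightV e) - O (G.leftV e) = F e.1.1 * K e.1.1 e.1.2 * conj (F' e.1.2)

/-! ### Perfect t-embeddings -/

/-- All edges of `G*` are drawn as line segments, distinct vertices have distinct images, and two
distinct edges meet only at the image of a common end. -/
def IsStraightEmbedding (T : G.DualVertex → ℂ) : Prop :=
  Function.Injective T ∧ (∀ ε, G.fst ε ≠ G.snd ε) ∧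
  ∀ ε ε' : G.DualEdge, ε ≠ ε' →
    ∀ z ∈ segment ℝ (T (G.fst ε)) (T (G.snd ε)) ∩ segment ℝ (T (G.fst ε')) (T (G.snd ε')),
      ∃ x, (x = G.fst ε ∨ x = G.snd ε) ∧ (x = G.fst ε' ∨ x = G.snd ε') ∧ z = T x

/-- The angle at `T f`, in `(-π, π]` and measured counterclockwise, of the face of `T(G*)`
corresponding to the black end of `e`, where `f` is the vertex of `G*` to the left of `e`.  The sides
of this angle are the duals of `rotB e` and of `e`, in counterclockwise order around `f`. -/
noncomputable def blackAngle (T : G.DualVertex → ℂ) (e : G.Edge) : ℝ :=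
  Complex.arg ((T (G.rightV e) - T (G.leftV e)) / (T (G.leftV (G.rotB e)) - T (G.leftV e)))

/-- The angle at `T f`, in `(-π, π]` and measured counterclockwise, of the face of `T(G*)`
corresponding to the white end of `e`, where `f` is the vertex of `G*` to the right of `e`.  The
sides of this angle are the duals of `rotW e` and of `e`, in counterclockwise order around `f`. -/
noncomputable def whiteAngle (T : G.DualVertex → ℂ) (e : G.Edge) : ℝ :=
  Complex.arg ((T (G.leftV e) - T (G.rightV e)) / (T (G.rightV (G.rotW e)) - T (G.rightV e)))

open Classical in
/-- The angle condition at every inner vertex `f`: the cyclic order of the edges at `f` is that of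
the plane graph `G*` (the angles of the faces at `f` are positive), and the angles of the black faces
at `f` sum to `π`, and so do those of the white ones. -/
def AngleCondition [Finite B] [Finite W] (T : G.DualVertex → ℂ) : Prop :=
  ∀ f : {f : G.Face // f ≠ G.outer},
    (∀ e, G.leftV e = Sum.inl f → 0 < G.blackAngle T e) ∧
    (∀ e, G.rightV e = Sum.inl f → 0 < G.whiteAngle T e) ∧
    (∑ e : G.Edge with G.leftV e = Sum.inl f, G.blackAngle T e = Real.pi) ∧
    (∑ e : G.Edge with G.rightV e = Sum.inl f, G.whiteAngle T e = Real.pi)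

/-- The lengths of the dual edges are gauge equivalent to the weights `χ`. -/
def LengthsGaugeEquiv (χ : G.Edge → ℝ) (T : G.DualVertex → ℂ) : Prop :=
  ∃ (g : B → ℝ) (h : W → ℝ), (∀ b, 0 < g b) ∧ (∀ w, 0 < h w) ∧
    ∀ e : G.Edge, ‖T (G.rightV e) - T (G.leftV e)‖ = g e.1.1 * χ e * h e.1.2

/-- The closed polygonal line with vertices `P 0, P 1, P 2, P 3`. -/
def polygonLine (P : Fin 4 → ℂ) : Set ℂ := ⋃ k, segment ℝ (P k) (P (k + 1))

/-- The interior of a polygon: the points off the boundary line that lie in a bounded component of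
its complement. -/
def polygonInterior (P : Fin 4 → ℂ) : Set ℂ :=
  {z | z ∉ polygonLine P ∧ Bornology.IsBounded (connectedComponentIn (polygonLine P)ᶜ z)}

/-- A (counterclockwise, not necessarily convex) polygon is tangential: the lines through its sides
are all tangent to one circle, and its centre `c` lies to the left of all (oriented) sides. The
left-hand side is the signed distance from `c` to the line, times the length of the side. -/
def IsTangential (P : Fin 4 → ℂ) : Prop :=
  ∃ (c : ℂ) (r : ℝ), 0 < r ∧
    ∀ k, (conj (P (k + 1) - P k) * (c - P k)).im = r * ‖P (k + 1) - P k‖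

/-- `T` is a perfect t-embedding of the augmented dual of `(G, χ)`. -/
structure IsPerfectTEmbedding [Finite B] [Finite W] (χ : G.Edge → ℝ) (T : G.DualVertex → ℂ) :
    Prop where
  embedding : G.IsStraightEmbedding T
  lengths : G.LengthsGaugeEquiv χ T
  angles : G.AngleCondition T
  tangential : IsTangential fun k => T (G.v k)
  bisector : ∀ k : Fin 4,
    EuclideanGeometry.angle (T (G.v (k + 1))) (T (G.v k)) (T (G.innerNbr k)) =
      EuclideanGeometry.angle (T (G.innerNbr k)) (T (G.v k)) (T (G.v (k - 1)))
  inward : ∀ k : Fin 4,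
    (openSegment ℝ (T (G.v k)) (T (G.innerNbr k)) ∩ polygonInterior fun k => T (G.v k)).Nonempty

end QuadGraph

/-! ### Permutations and signs -/

section PermSigns

variable {X : Type*}

theorem Equiv.Perm.cycle_induct [Finite X] (ρ : Equiv.Perm X) (x : X) (p : X → Prop)
    (h0 : p (ρ x)) (h : ∀ y, ρ.SameCycle x y → y ≠ x → p y → p (ρ y)) :
    ∀ y, ρ.SameCycle x y → p y := by
  have step : ∀ y, ρ.SameCycle x y → p y → p (ρ y) := fun y hy hp => by
    by_cases hyx : y = x
    · rw [hyx]; exact h0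
    · exact h y hy hyx hp
  have key : ∀ n : ℕ, p ((ρ ^ (n + 1)) x) := by
    intro n
    induction n with
    | zero => simpa using h0
    | succ n ih =>
      rw [pow_succ', Equiv.Perm.mul_apply]
      exact step _ ⟨((n + 1 : ℕ) : ℤ), by rw [zpow_natCast]⟩ ih
  intro y hy
  obtain ⟨i, hi, -, rfl⟩ := hy.exists_pow_eq'' 
  obtain ⟨j, rfl⟩ : ∃ j, i = j + 1 := ⟨i - 1, by omega⟩
  exact key j

theorem Equiv.Perm.cycle_induct_of_mem [Finite X] (ρ : Equiv.Perm X) (x : X) (p : X → Prop)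
    (h0 : p x) (h : ∀ y, ρ.SameCycle x y → p y → p (ρ y)) :
    ∀ y, ρ.SameCycle x y → p y :=
  ρ.cycle_induct x p (h x (Equiv.Perm.SameCycle.refl _ _) h0) fun y hy _ => h y hy

/-- A property that is invariant along a cycle except possibly at one step is invariant there. -/
theorem Equiv.Perm.cycle_gap [Finite X] (ρ : Equiv.Perm X) (x : X) (p : X → Prop)
    (h : ∀ y, ρ.SameCycle x y → y ≠ x → (p y ↔ p (ρ y))) : p x ↔ p (ρ x) := by
  by_cases h0 : p (ρ x)
  · exact iff_of_true (ρ.cycle_induct x p h0 (fun y hy hne => (h y hy hne).1) x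
      (Equiv.Perm.SameCycle.refl _ _)) h0
  · exact iff_of_false (ρ.cycle_induct x (fun y => ¬ p y) h0
      (fun y hy hne => (not_congr (h y hy hne)).1) x (Equiv.Perm.SameCycle.refl _ _)) h0

@[to_additive]
theorem Equiv.Perm.prod_comp_of_invariant {M : Type*} [CommMonoid M] (ρ : Equiv.Perm X)
    (S : Finset X) (hS : ∀ y, ρ y ∈ S ↔ y ∈ S) (g : X → M) :
    ∏ y ∈ S, g (ρ y) = ∏ y ∈ S, g y :=
  Finset.prod_equiv ρ (fun y => (hS y).symm) (fun _ _ => rfl)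

theorem Int.units_ne_iff {a b : ℤˣ} : a ≠ b ↔ a = -b := by
  rcases Int.units_eq_one_or a with rfl | rfl <;> rcases Int.units_eq_one_or b with rfl | rfl <;>
    decide

theorem Int.units_mul_eq_ite (a b : ℤˣ) : a * b = if a = b then 1 else -1 := by
  rcases Int.units_eq_one_or a with rfl | rfl <;> rcases Int.units_eq_one_or b with rfl | rfl <;>
    decide

/-- Along a cyclic sequence of signs, the number of sign changes is twice the number of rises. -/
theorem Equiv.Perm.card_changes (ρ : Equiv.Perm X) (S : Finset X) (hS : ∀ y, ρ y ∈ S ↔ y ∈ S)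
    (τ : X → ℤˣ) :
    (S.filter fun y => τ y ≠ τ (ρ y)).card = 2 * (S.filter fun y => τ y = -1 ∧ τ (ρ y) = 1).card := by
  have h := ρ.sum_comp_of_invariant S hS (fun y => if τ y = 1 then (1 : ℤ) else 0)
  have h2 : ∑ y ∈ S, (if τ y ≠ τ (ρ y) then (1 : ℤ) else 0)
      - 2 * ∑ y ∈ S, (if τ y = -1 ∧ τ (ρ y) = 1 then (1 : ℤ) else 0)
      = ∑ y ∈ S, (if τ y = 1 then (1 : ℤ) else 0)
        - ∑ y ∈ S, (if τ (ρ y) = 1 then (1 : ℤ) else 0) := by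
    rw [Finset.mul_sum, ← Finset.sum_sub_distrib, ← Finset.sum_sub_distrib]
    refine Finset.sum_congr rfl fun y _ => ?_
    rcases Int.units_eq_one_or (τ y) with h1 | h1 <;>
      rcases Int.units_eq_one_or (τ (ρ y)) with h2 | h2 <;> rw [h1, h2] <;> decide
  simp only [Finset.sum_boole] at h h2
  have h3 : ((S.filter fun y => τ y ≠ τ (ρ y)).card : ℤ)
    = 2 * (S.filter fun y => τ y = -1 ∧ τ (ρ y) = 1).card := by
    linarith
  exact_mod_cast h3

theorem Equiv.Perm.const_of_no_change [Finite X] (ρ : Equiv.Perm X) {Y : Type*} (τ : X → Y) (x : X)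
    (h : ∀ y, ρ.SameCycle x y → τ y = τ (ρ y)) : ∀ y, ρ.SameCycle x y → τ y = τ x :=
  ρ.cycle_induct_of_mem x (fun y => τ y = τ x) rfl fun y hy h1 => (h y hy).symm.trans h1

/-- The sign of a nonzero real number, as a unit of `ℤ`. -/
noncomputable def sgn (x : ℝ) : ℤˣ := if 0 < x then 1 else -1

theorem sgn_of_pos {x : ℝ} (h : 0 < x) : sgn x = 1 := if_pos h

theorem sgn_of_neg {x : ℝ} (h : x < 0) : sgn x = -1 := if_neg h.not_gt

theorem sgn_mul {x y : ℝ} (hx : x ≠ 0) (hy : y ≠ 0) : sgn (x * y) = sgn x * sgn y := by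
  rcases lt_or_gt_of_ne hx with h1 | h1 <;> rcases lt_or_gt_of_ne hy with h2 | h2
  · rw [sgn_of_neg h1, sgn_of_neg h2, sgn_of_pos (mul_pos_of_neg_of_neg h1 h2)]; decide
  · rw [sgn_of_neg h1, sgn_of_pos h2, sgn_of_neg (mul_neg_of_neg_of_pos h1 h2)]; decide
  · rw [sgn_of_pos h1, sgn_of_neg h2, sgn_of_neg (mul_neg_of_pos_of_neg h1 h2)]; decide
  · rw [sgn_of_pos h1, sgn_of_pos h2, sgn_of_pos (mul_pos h1 h2)]; decide

theorem sgn_eq_one_iff {x : ℝ} : sgn x = 1 ↔ 0 < x := by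
  unfold sgn; split_ifs with h <;> simp [h]; try decide

theorem sgn_eq_sgn_iff {x y : ℝ} (hx : x ≠ 0) (hy : y ≠ 0) : sgn x = sgn y ↔ 0 < x * y := by
  rw [← sgn_eq_one_iff, sgn_mul hx hy, Int.units_mul_eq_ite]
  split_ifs with h <;> simp [h]; try decide

end PermSigns

/-! ### Combinatorial quadrangle maps -/

/-- The combinatorial data of a nondegenerate plane bipartite graph with outer face of degree four,
in a form that is symmetric under the exchange of the two colours. -/
structure QMap (B W E : Type*) where
  bl : E → B
  wh : E → W
  inj : ∀ e e', bl e = bl e' → wh e = wh e' → e = e'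
  rB : Equiv.Perm E
  rW : Equiv.Perm E
  rB_cycle : ∀ e e', rB.SameCycle e e' ↔ bl e = bl e'
  rW_cycle : ∀ e e', rW.SameCycle e e' ↔ wh e = wh e'
  trans : ∀ p : E → Prop, (∀ e, p e → p (rB e)) → (∀ e, p e → p (rW e)) → ∀ e e', p e → p e'
  bl_surj : Function.Surjective bl
  wh_surj : Function.Surjective wh
  euler : Nat.card B + Nat.card W + Nat.card (Quotient (Equiv.Perm.SameCycle.setoid (rB⁻¹ * rW⁻¹)))
    = Nat.card E + 2
  e00 : E
  e01 : E
  e10 : E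
  e11 : E
  bl_e00 : bl e00 = bl e01
  bl_e10 : bl e10 = bl e11
  wh_e00 : wh e00 = wh e10
  wh_e01 : wh e01 = wh e11
  b_ne : bl e00 ≠ bl e10
  w_ne : wh e00 ≠ wh e01
  rW_e10 : rW e10 = e00
  rB_e11 : rB e11 = e10
  rW_e01 : rW e01 = e11
  rB_e00 : rB e00 = e01
  nondegB : ∀ (S : Finset B) (U : Finset W), S.Nonempty → bl e00 ∉ S → bl e10 ∉ S →
    (∀ e, bl e ∈ S → wh e ∈ U) → S.card + 2 ≤ U.card
  nondegW : ∀ (S : Finset W) (U : Finset B), S.Nonempty → wh e00 ∉ S → wh e01 ∉ S →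
    (∀ e, wh e ∈ S → bl e ∈ U) → S.card + 2 ≤ U.card

namespace QMap

variable {B W E : Type*} (M : QMap B W E)

/-- The face permutation: the cycles are the faces to the left of the edges. -/
def φ : Equiv.Perm E := M.rB⁻¹ * M.rW⁻¹

theorem φ_apply (e : E) : M.φ e = M.rB⁻¹ (M.rW⁻¹ e) := rfl

theorem rB_φ (e : E) : M.rB (M.φ e) = M.rW⁻¹ e := by simp [φ]

theorem rW_rB_φ (e : E) : M.rW (M.rB (M.φ e)) = e := by simp [φ]

theorem bl_rB (e : E) : M.bl (M.rB e) = M.bl e :=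
  ((M.rB_cycle _ _).1 (Equiv.Perm.SameCycle.symm ⟨1, by simp⟩))

theorem wh_rW (e : E) : M.wh (M.rW e) = M.wh e :=
  ((M.rW_cycle _ _).1 (Equiv.Perm.SameCycle.symm ⟨1, by simp⟩))

theorem wh_rW_inv (e : E) : M.wh (M.rW⁻¹ e) = M.wh e := by
  rw [← M.wh_rW (M.rW⁻¹ e)]; simp

theorem wh_rB_φ (e : E) : M.wh (M.rB (M.φ e)) = M.wh e := by rw [rB_φ, wh_rW_inv]

theorem φ_e00 : M.φ M.e00 = M.e11 := by
  rw [φ_apply, ← M.rW_e10, ← M.rB_e11]; simp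

theorem φ_e11 : M.φ M.e11 = M.e00 := by
  rw [φ_apply, ← M.rW_e01, ← M.rB_e00]; simp

/-- The black corner between `e` and `rB e` does not lie in the outer face. -/
def Bdd (e : E) : Prop := e ≠ M.e00 ∧ e ≠ M.e11

theorem bdd_φ {e : E} : M.Bdd (M.φ e) ↔ M.Bdd e := by
  unfold Bdd
  have h0 : M.φ e ≠ M.e11 ↔ e ≠ M.e00 := by rw [← M.φ_e00, M.φ.injective.ne_iff]
  have h1 : M.φ e ≠ M.e00 ↔ e ≠ M.e11 := by rw [← M.φ_e11, M.φ.injective.ne_iff]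
  rw [h0, h1]
  exact and_comm

/-- Exchange of the two colours. -/
def swap : QMap W B E where
  bl := M.wh
  wh := M.bl
  inj e e' h h' := M.inj e e' h' h
  rB := M.rW
  rW := M.rB
  rB_cycle := M.rW_cycle
  rW_cycle := M.rB_cycle
  trans p h h' := M.trans p h' h
  bl_surj := M.wh_surj
  wh_surj := M.bl_surj
  euler := by
    rw [← M.euler, add_comm (Nat.card W)]
    congr 1
    refine Nat.card_congr (Quotient.congr M.rB ?_).symm
    intro x y
    change (M.rB⁻¹ * M.rW⁻¹).SameCycle x y ↔ (M.rW⁻¹ * M.rB⁻¹).SameCycle (M.rB x) (M.rB y)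
    have : M.rW⁻¹ * M.rB⁻¹ = M.rB * (M.rB⁻¹ * M.rW⁻¹) * M.rB⁻¹ := by group
    rw [this, Equiv.Perm.sameCycle_conj]
    simp
  e00 := M.e01
  e01 := M.e11
  e10 := M.e00
  e11 := M.e10
  bl_e00 := M.wh_e01
  bl_e10 := M.wh_e00
  wh_e00 := M.bl_e00.symm
  wh_e01 := M.bl_e10.symm
  b_ne := M.w_ne.symm
  w_ne := by rw [← M.bl_e00, ← M.bl_e10]; exact M.b_ne
  rW_e10 := M.rB_e00
  rB_e11 := M.rW_e10
  rW_e01 := M.rB_e11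
  rB_e00 := M.rW_e01
  nondegB S U h h1 h2 := M.nondegW S U h h2 h1
  nondegW S U h h1 h2 := M.nondegB S U h (by rwa [M.bl_e00]) (by rwa [M.bl_e10])

section Counting

set_option linter.unusedSectionVars false

variable [Fintype B] [Fintype W] [Fintype E]

open scoped Classical

theorem card_le (M : QMap B W E) : Fintype.card B ≤ Fintype.card W := by
  by_cases h : (Finset.univ \ {M.bl M.e00, M.bl M.e10} : Finset B).Nonempty
  · have := M.nondegB _ Finset.univ h (by simp) (by simp) (by simp)
    have h2 : (Finset.univ \ {M.bl M.e00, M.bl M.e10} : Finset B).card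
      = Fintype.card B - 2 := by
      rw [Finset.card_sdiff_of_subset (Finset.subset_univ _), Finset.card_pair M.b_ne,
        Finset.card_univ]
    rw [h2, Finset.card_univ] at this
    omega
  · rw [Finset.not_nonempty_iff_eq_empty, Finset.sdiff_eq_empty_iff_subset] at h
    have h1 := Finset.card_le_card h
    have h2 := Finset.card_le_univ ({M.wh M.e00, M.wh M.e01} : Finset W)
    rw [Finset.card_pair M.b_ne, Finset.card_univ] at h1
    rw [Finset.card_pair M.w_ne] at h2
    omega

theorem card_eq (M : QMap B W E) : Fintype.card B = Fintype.card W := le_antisymm M.card_le M.swap.card_le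

/-- A nowhere vanishing real weight on the edges that satisfies the Kasteleyn sign condition around
every bounded face. -/
structure Kast (k : E → ℝ) : Prop where
  ne : ∀ e, k e ≠ 0
  sign : ∀ e, M.Bdd e →
    ∏ e' with M.φ.SameCycle e e', (sgn (k e') * sgn (k (M.rB e')))
      = (-1) ^ ((Finset.univ.filter fun e' => M.φ.SameCycle e e').card + 1)

variable {M} in
theorem Kast.swap {k : E → ℝ} (hk : M.Kast k) : M.swap.Kast k where
  ne := hk.ne
  sign e he := by
    have hφ : M.swap.φ = M.rB * M.φ * M.rB⁻¹ := by
      change M.rW⁻¹ * M.rB⁻¹ = M.rB * (M.rB⁻¹ * M.rW⁻¹) * M.rB⁻¹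
      group
    obtain ⟨e, rfl⟩ := M.rB.surjective e
    have hb : M.Bdd e := by
      refine ⟨fun h => he.1 ?_, fun h => he.2 ?_⟩
      · rw [h, M.rB_e00]; rfl
      · rw [h, M.rB_e11]; rfl
    have hc : ∀ x, M.φ.SameCycle e x ↔ M.swap.φ.SameCycle (M.rB e) (M.rB x) := by
      intro x
      rw [hφ, Equiv.Perm.sameCycle_conj]; simp
    have hcard : (Finset.univ.filter fun e' => M.swap.φ.SameCycle (M.rB e) e').card
        = (Finset.univ.filter fun e' => M.φ.SameCycle e e').card := by
      symm
      refine Finset.card_equiv M.rB fun x => ?_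
      simp [hc]
    rw [hcard, ← hk.sign e hb]
    have h1 : ∏ e' with M.swap.φ.SameCycle (M.rB e) e', (sgn (k e') * sgn (k (M.swap.rB e')))
        = ∏ e' with M.φ.SameCycle e e', (sgn (k (M.rB e')) * sgn (k (M.rW (M.rB e')))) := by
      symm
      refine Finset.prod_equiv M.rB (fun x => by simp [hc]) fun x _ => rfl
    rw [h1, Finset.prod_mul_distrib, Finset.prod_mul_distrib, mul_comm]
    congr 1
    have := M.φ.prod_comp_of_invariant (Finset.univ.filter fun e' => M.φ.SameCycle e e')
      (fun y => by simp [Equiv.Perm.sameCycle_apply_right])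
      (fun x => sgn (k (M.rW (M.rB x))))
    rw [← this]
    simp only [rW_rB_φ]

/-- The sign of `k(e) η(w)`, where `w` is the white end of `e`. -/
noncomputable def τ (k : E → ℝ) (η : W → ℤˣ) (e : E) : ℤˣ := sgn (k e) * η (M.wh e)

theorem mem_fiber_rB (b : B) (y : E) :
    M.rB y ∈ Finset.univ.filter (fun e => M.bl e = b) ↔
      y ∈ Finset.univ.filter (fun e => M.bl e = b) := by simp [bl_rB]

theorem exists_change {k : E → ℝ} {η : W → ℤˣ} {b : B}
    (h : ∃ e e', M.bl e = b ∧ M.bl e' = b ∧ M.τ k η e ≠ M.τ k η e') :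
    ∃ e, M.bl e = b ∧ M.τ k η e ≠ M.τ k η (M.rB e) := by
  by_contra! hc
  obtain ⟨e, e', he, he', hne⟩ := h
  refine hne ((M.rB.const_of_no_change (M.τ k η) e (fun y hy => hc y ?_) e' ?_).symm)
  · rw [← (M.rB_cycle _ _).1 hy, he]
  · rw [M.rB_cycle, he, he']

/-- The index theorem for sign patterns on the white vertices. -/
theorem index {k : E → ℝ} (hk : M.Kast k) (η : W → ℤˣ)
    (hη : ∀ b, b ≠ M.bl M.e00 → b ≠ M.bl M.e10 →
      ∃ e e', M.bl e = b ∧ M.bl e' = b ∧ M.τ k η e ≠ M.τ k η e') :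
    (∀ b, b ≠ M.bl M.e00 → b ≠ M.bl M.e10 →
      (Finset.univ.filter fun e => M.bl e = b ∧ M.τ k η e ≠ M.τ k η (M.rB e)).card = 2) ∧
    (∀ e, M.Bdd e → (Finset.univ.filter fun e' => M.φ.SameCycle e e' ∧
      M.τ k η e' = M.τ k η (M.rB e')).card = 1) ∧
    (Finset.univ.filter fun e => M.bl e = M.bl M.e00 ∧ M.Bdd e ∧
        M.τ k η e ≠ M.τ k η (M.rB e)).card +
      (Finset.univ.filter fun e => M.bl e = M.bl M.e10 ∧ M.Bdd e ∧
        M.τ k η e ≠ M.τ k η (M.rB e)).card = 1 := by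
  set t := M.τ k η with ht
  let Q := Quotient (Equiv.Perm.SameCycle.setoid (M.rB⁻¹ * M.rW⁻¹))
  let mk : E → Q := Quotient.mk _
  have hmk : ∀ e e', mk e = mk e' ↔ M.φ.SameCycle e e' := fun e e' => Quotient.eq
  have hout : ∀ e, mk e = mk M.e00 ↔ ¬ M.Bdd e := by
    intro e
    rw [eq_comm, hmk]
    constructor
    · intro h
      have := M.φ.cycle_induct_of_mem M.e00 (fun e => ¬ M.Bdd e) (by simp [Bdd])
        (fun y _ hy => by rwa [M.bdd_φ]) e h
      exact this
    · intro h
      unfold Bdd at h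
      rw [not_and_or, not_not, not_not] at h
      rcases h with rfl | rfl
      · exact Equiv.Perm.SameCycle.refl _ _
      · rw [← M.φ_e00]; exact ⟨1, by simp⟩
  let n : B → ℕ := fun b =>
    (Finset.univ.filter fun e => M.bl e = b ∧ M.Bdd e ∧ t e ≠ t (M.rB e)).card
  let N : Q → ℕ := fun q =>
    (Finset.univ.filter fun e => mk e = q ∧ M.Bdd e ∧ t e = t (M.rB e)).card
  -- interior black vertices
  have hn' : ∀ b, b ≠ M.bl M.e00 → b ≠ M.bl M.e10 →
      n b = (Finset.univ.filter fun e => M.bl e = b ∧ t e ≠ t (M.rB e)).card := by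
    intro b h0 h1
    refine congrArg Finset.card (Finset.filter_congr fun e _ => ?_)
    constructor
    · rintro ⟨h, -, h2⟩; exact ⟨h, h2⟩
    · rintro ⟨h, h2⟩
      refine ⟨h, ⟨?_, ?_⟩, h2⟩
      · rintro rfl; exact h0 h.symm
      · rintro rfl; exact h1 (h.symm.trans M.bl_e10.symm)
  have hn : ∀ b, b ≠ M.bl M.e00 → b ≠ M.bl M.e10 → ∃ r, n b = 2 + 2 * r := by
    intro b h0 h1
    rw [hn' b h0 h1]
    have h2 := M.rB.card_changes (Finset.univ.filter fun e => M.bl e = b) (M.mem_fiber_rB b) t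
    rw [Finset.filter_filter] at h2
    obtain ⟨e, he, hc⟩ := M.exists_change (hη b h0 h1)
    have h3 : 0 < (Finset.univ.filter fun e => M.bl e = b ∧ t e ≠ t (M.rB e)).card :=
      Finset.card_pos.2 ⟨e, by simp [he, hc, ht]⟩
    rw [h2] at h3 ⊢
    exact ⟨(Finset.filter (fun y => t y = -1 ∧ t (M.rB y) = 1)
      (Finset.univ.filter fun e => M.bl e = b)).card - 1, by omega⟩
  -- bounded faces
  have hN' : ∀ e, M.Bdd e → N (mk e) = (Finset.univ.filter fun e' => M.φ.SameCycle e e' ∧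
      t e' = t (M.rB e')).card := by
    intro e he
    refine congrArg Finset.card (Finset.filter_congr fun e' _ => ?_)
    rw [eq_comm, hmk]
    constructor
    · rintro ⟨h, -, h2⟩; exact ⟨h, h2⟩
    · rintro ⟨h, h2⟩
      refine ⟨h, ?_, h2⟩
      by_contra hb
      rw [← hmk, (hout e').2 hb, hout] at h
      exact h he
  have hN : ∀ q, q ≠ mk M.e00 → ∃ s, N q = 1 + 2 * s := by
    intro q
    induction q using Quotient.inductionOn with | h e => ?_
    intro hq
    have he : M.Bdd e := by
      by_contra hb; exact hq ((hout e).2 hb)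
    change ∃ s, N (mk e) = _
    rw [hN' e he]
    have hs := hk.sign e he
    have h1 : ∏ e' with M.φ.SameCycle e e', (t e' * t (M.rB e'))
        = ∏ e' with M.φ.SameCycle e e', (sgn (k e') * sgn (k (M.rB e'))) := by
      have h2 := M.φ.prod_comp_of_invariant (Finset.univ.filter fun e' => M.φ.SameCycle e e')
        (fun y => by simp [Equiv.Perm.sameCycle_apply_right])
        (fun x => η (M.wh (M.rB x)))
      simp only [wh_rB_φ] at h2
      simp only [ht, τ]
      have : ∀ e', sgn (k e') * η (M.wh e') * (sgn (k (M.rB e')) * η (M.wh (M.rB e')))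
        = (sgn (k e') * sgn (k (M.rB e'))) * (η (M.wh e') * η (M.wh (M.rB e'))) := fun e' => by
          ac_rfl
      simp only [this]
      rw [Finset.prod_mul_distrib, Finset.prod_mul_distrib (f := fun e' => η (M.wh e')), ← h2,
        Int.units_mul_self, mul_one]
    rw [hs] at h1
    simp only [Int.units_mul_eq_ite] at h1
    rw [Finset.prod_ite, Finset.prod_const_one, one_mul, Finset.prod_const,
      Finset.filter_filter] at h1
    have h3 := Finset.card_filter_add_card_filter_not
      (s := Finset.univ.filter fun e' => M.φ.SameCycle e e') (fun e' => t e' = t (M.rB e'))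
    rw [Finset.filter_filter, Finset.filter_filter] at h3
    rw [← h3] at h1
    set x := (Finset.univ.filter fun e' => M.φ.SameCycle e e' ∧ t e' = t (M.rB e')).card
    set y := (Finset.univ.filter fun e' => M.φ.SameCycle e e' ∧ ¬ t e' = t (M.rB e')).card
    rcases Nat.even_or_odd x with hx | hx
    · exfalso
      rw [add_assoc, pow_add, hx.neg_one_pow, one_mul, pow_succ] at h1
      rcases Nat.even_or_odd y with hy | hy
      · rw [hy.neg_one_pow] at h1; exact absurd h1 (by decide)
      · rw [hy.neg_one_pow] at h1; exact absurd h1 (by decide)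
    · obtain ⟨s, hs⟩ := hx; exact ⟨s, by omega⟩
  -- double counting
  have hE : (Finset.univ.filter fun e => M.Bdd e).card + 2 = Fintype.card E := by
    have : (Finset.univ.filter fun e => M.Bdd e) = Finset.univ \ {M.e00, M.e11} := by
      ext e; rw [Finset.mem_filter]; simp [Bdd]
    have hne : M.e00 ≠ M.e11 := fun h => M.b_ne (by rw [M.bl_e10, h])
    have h2 := Finset.card_le_univ ({M.e00, M.e11} : Finset E)
    rw [this, Finset.card_sdiff_of_subset (Finset.subset_univ _), Finset.card_univ]
    rw [Finset.card_pair hne] at h2 ⊢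
    omega
  have hsum : ∑ b, n b + ∑ q, N q = (Finset.univ.filter fun e => M.Bdd e).card := by
    have h1 : ∑ b, n b = (Finset.univ.filter fun e => M.Bdd e ∧ t e ≠ t (M.rB e)).card := by
      rw [Finset.card_eq_sum_card_fiberwise (f := M.bl) (t := Finset.univ) (by simp)]
      refine Finset.sum_congr rfl fun b _ => ?_
      rw [Finset.filter_filter]
      exact congrArg Finset.card (Finset.filter_congr fun e _ => by tauto)
    have h2 : ∑ q, N q = (Finset.univ.filter fun e => M.Bdd e ∧ t e = t (M.rB e)).card := by
      rw [Finset.card_eq_sum_card_fiberwise (f := mk) (t := Finset.univ) (by simp)]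
      refine Finset.sum_congr rfl fun b _ => ?_
      rw [Finset.filter_filter]
      exact congrArg Finset.card (Finset.filter_congr fun e _ => by tauto)
    rw [h1, h2, add_comm, ← Finset.card_filter_add_card_filter_not
      (s := Finset.univ.filter fun e => M.Bdd e) (fun e => t e = t (M.rB e)),
      Finset.filter_filter, Finset.filter_filter]
  choose! r hr using hn
  choose! s hs using hN
  let I : Finset B := Finset.univ \ {M.bl M.e00, M.bl M.e10}
  have hI : ∀ b, b ∈ I ↔ b ≠ M.bl M.e00 ∧ b ≠ M.bl M.e10 := by intro b; simp [I]
  have hsB : ∑ b, n b = 2 * I.card + 2 * ∑ b ∈ I, r b + (n (M.bl M.e00) + n (M.bl M.e10)) := by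
    rw [← Finset.sum_sdiff (Finset.subset_univ {M.bl M.e00, M.bl M.e10}), Finset.sum_pair M.b_ne]
    congr 1
    rw [Finset.sum_congr rfl fun b hb => hr b ((hI b).1 hb).1 ((hI b).1 hb).2,
      Finset.sum_add_distrib, Finset.mul_sum, Finset.sum_const, smul_eq_mul, mul_comm]
  let J : Finset Q := Finset.univ \ {mk M.e00}
  have hJ : ∀ q, q ∈ J ↔ q ≠ mk M.e00 := by intro q; simp [J]
  have hsQ : ∑ q, N q = J.card + 2 * ∑ q ∈ J, s q + N (mk M.e00) := by
    rw [← Finset.sum_sdiff (Finset.subset_univ {mk M.e00}), Finset.sum_singleton]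
    congr 1
    rw [Finset.sum_congr rfl fun b hb => hs b ((hJ b).1 hb),
      Finset.sum_add_distrib, Finset.mul_sum, Finset.sum_const, smul_eq_mul, mul_one]
  have hcI : I.card + 2 = Fintype.card B := by
    have h2 := Finset.card_le_univ ({M.bl M.e00, M.bl M.e10} : Finset B)
    rw [Finset.card_sdiff_of_subset (Finset.subset_univ _), Finset.card_univ]
    rw [Finset.card_pair M.b_ne] at h2 ⊢
    omega
  have hcJ : J.card + 1 = Fintype.card Q := by
    have h2 := Finset.card_le_univ ({mk M.e00} : Finset Q)
    rw [Finset.card_sdiff_of_subset (Finset.subset_univ _), Finset.card_univ]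
    rw [Finset.card_singleton] at h2 ⊢
    omega
  have heu := M.euler
  rw [Nat.card_eq_fintype_card, Nat.card_eq_fintype_card, Nat.card_eq_fintype_card,
    Nat.card_eq_fintype_card] at heu
  change _ + _ + Fintype.card Q = _ at heu
  have hbw := M.card_eq
  have hr0 : ∑ b ∈ I, r b = 0 := by omega
  have hs0 : ∑ q ∈ J, s q = 0 := by omega
  rw [Finset.sum_eq_zero_iff] at hr0 hs0
  refine ⟨fun b h0 h1 => ?_, fun e he => ?_, ?_⟩
  · rw [← hn' b h0 h1, hr b h0 h1, hr0 b ((hI b).2 ⟨h0, h1⟩), mul_zero, add_zero]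
  · have hq : mk e ≠ mk M.e00 := fun h => (hout e).1 h he
    rw [← hN' e he, hs _ hq, hs0 _ ((hJ _).2 hq), mul_zero, add_zero]
  · have hN0 : N (mk M.e00) = 0 := by
      rw [Finset.card_eq_zero, Finset.filter_eq_empty_iff]
      rintro e - ⟨h, h2, -⟩
      exact (hout e).1 h h2
    change n _ + n _ = 1
    have := hr0
    have h1 : ∑ b ∈ I, r b = 0 := Finset.sum_eq_zero hr0
    have h2 : ∑ q ∈ J, s q = 0 := Finset.sum_eq_zero hs0
    omega

end Counting

end QMap

namespace QMap

section Admissible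

set_option linter.unusedSectionVars false

variable {B W E : Type*} (M : QMap B W E) [Fintype B] [Fintype W] [Fintype E]

open scoped Classical

/-- Every interior black vertex sees both signs. -/
def Adm (k : E → ℝ) (η : W → ℤˣ) : Prop := ∀ b, b ≠ M.bl M.e00 → b ≠ M.bl M.e10 →
  ∃ e e', M.bl e = b ∧ M.bl e' = b ∧ M.τ k η e ≠ M.τ k η e'

/-- `f` satisfies the Kasteleyn equation at the black vertex `b`. -/
def Harm (k : E → ℝ) (f : W → ℝ) (b : B) : Prop := ∑ e with M.bl e = b, k e * f (M.wh e) = 0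

/-- The sign pattern `η` is compatible with `f`. -/
def Compat (f : W → ℝ) (η : W → ℤˣ) : Prop := ∀ u, f u ≠ 0 → η u = sgn (f u)

variable {M} {k : E → ℝ} {f : W → ℝ} {η : W → ℤˣ}

theorem Compat.τ_eq (hk : M.Kast k) (h : Compat f η) {e : E} (he : f (M.wh e) ≠ 0) :
    M.τ k η e = sgn (k e * f (M.wh e)) := by
  rw [sgn_mul (hk.ne e) he, τ, h _ he]

theorem Harm.exists_pos_neg (hk : M.Kast k) {b : B} (h : M.Harm k f b)
    (hb : ∃ e, M.bl e = b ∧ f (M.wh e) ≠ 0) :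
    (∃ e, M.bl e = b ∧ 0 < k e * f (M.wh e)) ∧ ∃ e, M.bl e = b ∧ k e * f (M.wh e) < 0 := by
  obtain ⟨e, he, hne⟩ := hb
  have hne' := mul_ne_zero (hk.ne e) hne
  constructor
  · obtain ⟨e', h1, h2⟩ := Finset.exists_pos_of_sum_zero_of_exists_nonzero _ h
      ⟨e, by simp [he], hne'⟩
    exact ⟨e', by simpa using h1, h2⟩
  · have h' : ∑ e with M.bl e = b, -(k e * f (M.wh e)) = 0 := by
      rw [Finset.sum_neg_distrib, neg_eq_zero]; exact h
    obtain ⟨e', h1, h2⟩ := Finset.exists_pos_of_sum_zero_of_exists_nonzero _ h'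
      ⟨e, by simp [he], neg_ne_zero.2 hne'⟩
    exact ⟨e', by simpa using h1, by linarith⟩

theorem Harm.exists_ne (hk : M.Kast k) {b : B} (h : M.Harm k f b) (hη : Compat f η)
    (hb : ∃ e, M.bl e = b ∧ f (M.wh e) ≠ 0) :
    ∃ e e', M.bl e = b ∧ M.bl e' = b ∧ M.τ k η e ≠ M.τ k η e' := by
  obtain ⟨⟨e, he, hp⟩, e', he', hn⟩ := h.exists_pos_neg hk hb
  refine ⟨e, e', he, he', ?_⟩
  rw [hη.τ_eq hk (right_ne_zero_of_mul hp.ne'), hη.τ_eq hk (right_ne_zero_of_mul hn.ne),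
    sgn_of_pos hp, sgn_of_neg hn]
  decide

theorem Harm.exists_opposite (hk : M.Kast k) {b : B} (h : M.Harm k f b) (hη : Compat f η)
    {e : E} (he : M.bl e = b) (hne : f (M.wh e) ≠ 0) :
    ∃ e', M.bl e' = b ∧ f (M.wh e') ≠ 0 ∧ M.τ k η e' ≠ M.τ k η e := by
  obtain ⟨⟨e1, he1, hp⟩, e2, he2, hn⟩ := h.exists_pos_neg hk ⟨e, he, hne⟩
  have h1 := right_ne_zero_of_mul hp.ne'
  have h2 := right_ne_zero_of_mul hn.ne
  by_cases hc : M.τ k η e = 1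
  · refine ⟨e2, he2, h2, ?_⟩
    rw [hc, hη.τ_eq hk h2, sgn_of_neg hn]; decide
  · refine ⟨e1, he1, h1, ?_⟩
    rw [hη.τ_eq hk h1, sgn_of_pos hp]; exact fun h => hc h.symm

theorem exists_signs_of_matching (m : B → W) (A : Finset B) (η₀ : W → ℤˣ)
    (hA : ∀ b ∈ A, b ≠ M.bl M.e00 ∧ b ≠ M.bl M.e10) (hm : ∀ b ∈ A, ∃ e, M.bl e = b ∧ M.wh e = m b)
    (hinj : Set.InjOn m A) : ∃ η : W → ℤˣ, (∀ u, u ∉ A.image m → η u = η₀ u) ∧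
      ∀ b ∈ A, ∃ e e', M.bl e = b ∧ M.bl e' = b ∧ M.τ k η e ≠ M.τ k η e' := by
  induction hn : A.card generalizing A η₀ with
  | zero =>
    rw [Finset.card_eq_zero] at hn
    subst hn
    exact ⟨η₀, fun _ _ => rfl, by simp⟩
  | succ n ih =>
    have hne : A.Nonempty := Finset.card_pos.1 (by omega)
    obtain ⟨e, heA, heU⟩ : ∃ e, M.bl e ∈ A ∧ M.wh e ∉ A.image m := by
      by_contra! hc
      have := M.nondegB A (A.image m) hne (fun h => (hA _ h).1 rfl) (fun h => (hA _ h).2 rfl) hc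
      have := Finset.card_image_le (s := A) (f := m)
      omega
    obtain ⟨em, hem, hwm⟩ := hm _ heA
    have hmA : m (M.bl e) ∈ A.image m := Finset.mem_image_of_mem m heA
    have hmA' : m (M.bl e) ∉ (A.erase (M.bl e)).image m := by
      intro h
      obtain ⟨b, hb, hbm⟩ := Finset.mem_image.1 h
      exact (Finset.mem_erase.1 hb).1 (hinj (Finset.mem_erase.1 hb).2 heA hbm)
    obtain ⟨η, h1, h2⟩ := ih (A.erase (M.bl e))
      (Function.update η₀ (m (M.bl e)) (-(sgn (k em) * M.τ k η₀ e)))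
      (fun b hb => hA b (Finset.mem_of_mem_erase hb)) (fun b hb => hm b (Finset.mem_of_mem_erase hb))
      (hinj.mono (by simp)) (by rw [Finset.card_erase_of_mem heA]; omega)
    have hsub : (A.erase (M.bl e)).image m ⊆ A.image m :=
      Finset.image_subset_image (Finset.erase_subset _ _)
    refine ⟨η, fun u hu => ?_, fun b hb => ?_⟩
    · rw [h1 u (fun h => hu (hsub h)), Function.update_of_ne]
      rintro rfl; exact hu hmA
    · by_cases hbe : b = M.bl e
      · refine ⟨em, e, hem.trans hbe.symm, hbe.symm, ?_⟩
        rw [τ, τ, hwm, h1 _ hmA', h1 _ (fun h => heU (hsub h)), Function.update_self,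
          Function.update_of_ne (fun h => heU (by rw [h]; exact hmA)), mul_neg, ← mul_assoc, Int.units_mul_self,
          one_mul, τ]
        rcases Int.units_eq_one_or (sgn (k e) * η₀ (M.wh e)) with h | h <;> rw [h] <;> decide
      · exact h2 b (Finset.mem_erase.2 ⟨hbe, hb⟩)

/-- Prescribed signs at two zeros extend to an admissible sign pattern. -/
theorem exists_adm (hk : M.Kast k)
    (hf : ∀ b, b ≠ M.bl M.e00 → b ≠ M.bl M.e10 → M.Harm k f b) {w w' : W} (hne : w ≠ w')
    (hw : f w = 0) (hw' : f w' = 0) (s s' : ℤˣ) :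
    ∃ η, Compat f η ∧ η w = s ∧ η w' = s' ∧ M.Adm k η := by
  let A : Finset B := Finset.univ.filter fun b =>
    b ≠ M.bl M.e00 ∧ b ≠ M.bl M.e10 ∧ ∀ e, M.bl e = b → f (M.wh e) = 0
  let t : A → Finset W := fun b =>
    Finset.univ.filter fun u => (∃ e, M.bl e = b ∧ M.wh e = u) ∧ u ≠ w ∧ u ≠ w'
  obtain ⟨m, hminj, hmt⟩ := (Finset.all_card_le_biUnion_card_iff_exists_injective t).1 (by
    intro S
    rcases S.eq_empty_or_nonempty with rfl | hS
    · simp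
    have h1 := M.nondegB (S.map (Function.Embedding.subtype _)) (insert w (insert w' (S.biUnion t)))
      (by simpa using hS)
      (by
        intro h
        obtain ⟨b, -, hb⟩ := Finset.mem_map.1 h
        exact (Finset.mem_filter.1 b.2).2.1 hb)
      (by
        intro h
        obtain ⟨b, -, hb⟩ := Finset.mem_map.1 h
        exact (Finset.mem_filter.1 b.2).2.2.1 hb)
      (by
        intro e he
        obtain ⟨b, hbS, hb⟩ := Finset.mem_map.1 he
        by_cases h1 : M.wh e = w
        · simp [h1]
        by_cases h2 : M.wh e = w'
        · simp [h2]
        refine Finset.mem_insert_of_mem (Finset.mem_insert_of_mem (Finset.mem_biUnion.2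
          ⟨b, hbS, Finset.mem_filter.2 ⟨Finset.mem_univ _, ⟨e, hb.symm, rfl⟩, h1, h2⟩⟩)))
    rw [Finset.card_map] at h1
    have h2 := Finset.card_insert_le w (insert w' (S.biUnion t))
    have h3 := Finset.card_insert_le w' (S.biUnion t)
    omega)
  have : Nonempty W := ⟨w⟩
  let m' : B → W := fun b => if h : b ∈ A then m ⟨b, h⟩ else w
  have hm' : ∀ b (h : b ∈ A), m' b = m ⟨b, h⟩ := fun b h => dif_pos h
  have hmem : ∀ b (h : b ∈ A), (∃ e, M.bl e = b ∧ M.wh e = m' b) ∧ m' b ≠ w ∧ m' b ≠ w' := by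
    intro b h
    rw [hm' b h]
    exact (Finset.mem_filter.1 (hmt ⟨b, h⟩)).2
  obtain ⟨η, h1, h2⟩ := exists_signs_of_matching (M := M) (k := k) m' A
    (fun u => if u = w then s else if u = w' then s' else sgn (f u))
    (fun b hb => ⟨(Finset.mem_filter.1 hb).2.1, (Finset.mem_filter.1 hb).2.2.1⟩)
    (fun b hb => (hmem b hb).1)
    (by
      intro b hb b' hb' h
      rw [hm' b hb, hm' b' hb'] at h
      exact congrArg Subtype.val (hminj h))
  have hw1 : w ∉ A.image m' := fun h => by
    obtain ⟨b, hb, h⟩ := Finset.mem_image.1 h; exact (hmem b hb).2.1 h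
  have hw2 : w' ∉ A.image m' := fun h => by
    obtain ⟨b, hb, h⟩ := Finset.mem_image.1 h; exact (hmem b hb).2.2 h
  have hc : Compat f η := by
    intro u hu
    have h3 : u ∉ A.image m' := fun h => by
      obtain ⟨b, hb, h⟩ := Finset.mem_image.1 h
      obtain ⟨⟨e, he, hu'⟩, -⟩ := hmem b hb
      exact hu (by rw [← h, ← hu']; exact (Finset.mem_filter.1 hb).2.2.2 e he)
    rw [h1 u h3, if_neg, if_neg]
    · rintro rfl; exact hu hw'
    · rintro rfl; exact hu hw
  refine ⟨η, hc, ?_, ?_, ?_⟩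
  · rw [h1 w hw1, if_pos rfl]
  · rw [h1 w' hw2, if_neg hne.symm, if_pos rfl]
  · intro b hb0 hb1
    by_cases hb : b ∈ A
    · exact h2 b hb
    · refine (hf b hb0 hb1).exists_ne hk hc ?_
      by_contra! hcon
      exact hb (Finset.mem_filter.2 ⟨Finset.mem_univ _, hb0, hb1, hcon⟩)

theorem Adm.face_unique (hk : M.Kast k) (h : M.Adm k η) {e e' : E} (he : M.Bdd e)
    (hc : M.φ.SameCycle e e') (h1 : M.τ k η e = M.τ k η (M.rB e))
    (h2 : M.τ k η e' = M.τ k η (M.rB e')) : e = e' := by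
  obtain ⟨x, hx⟩ := Finset.card_eq_one.1 ((M.index hk η h).2.1 e he)
  have h3 : e ∈ ({x} : Finset E) := hx ▸ (by simp [h1, Equiv.Perm.SameCycle.refl])
  have h4 : e' ∈ ({x} : Finset E) := hx ▸ (by simp [h2, hc])
  rw [Finset.mem_singleton] at h3 h4
  rw [h3, h4]

theorem Adm.bdry_unique (hk : M.Kast k) (h : M.Adm k η) {e e' : E} (he : M.Bdd e) (he' : M.Bdd e')
    (hb : M.bl e = M.bl M.e00 ∨ M.bl e = M.bl M.e10)
    (hb' : M.bl e' = M.bl M.e00 ∨ M.bl e' = M.bl M.e10)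
    (h1 : M.τ k η e ≠ M.τ k η (M.rB e))
    (h2 : M.τ k η e' ≠ M.τ k η (M.rB e')) : e = e' := by
  have hi := (M.index hk η h).2.2
  rw [← Finset.card_union_of_disjoint] at hi
  · obtain ⟨x, hx⟩ := Finset.card_eq_one.1 hi
    have h3 : e ∈ ({x} : Finset E) := hx ▸ (by simp [h1, he, hb])
    have h4 : e' ∈ ({x} : Finset E) := hx ▸ (by simp [h2, he', hb'])
    rw [Finset.mem_singleton] at h3 h4
    rw [h3, h4]
  · rw [Finset.disjoint_left]
    intro a h3 h4
    simp only [Finset.mem_filter, Finset.mem_univ, true_and] at h3 h4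
    exact M.b_ne (h3.1.symm.trans h4.1)

theorem Adm.card_rise (hk : M.Kast k) (h : M.Adm k η) {b : B} (hb0 : b ≠ M.bl M.e00)
    (hb1 : b ≠ M.bl M.e10) :
    (Finset.univ.filter fun e => M.bl e = b ∧ M.τ k η e = -1 ∧ M.τ k η (M.rB e) = 1).card = 1 := by
  have h2 := M.rB.card_changes (Finset.univ.filter fun e => M.bl e = b) (M.mem_fiber_rB b)
    (M.τ k η)
  rw [Finset.filter_filter, Finset.filter_filter, (M.index hk η h).1 b hb0 hb1] at h2
  omega

theorem Adm.rise_unique (hk : M.Kast k) (h : M.Adm k η) {e e' : E} (hb0 : M.bl e ≠ M.bl M.e00)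
    (hb1 : M.bl e ≠ M.bl M.e10) (hb : M.bl e' = M.bl e)
    (h1 : M.τ k η e = -1) (h2 : M.τ k η (M.rB e) = 1)
    (h1' : M.τ k η e' = -1) (h2' : M.τ k η (M.rB e') = 1) : e = e' := by
  obtain ⟨x, hx⟩ := Finset.card_eq_one.1 (h.card_rise hk hb0 hb1)
  have h3 : e ∈ ({x} : Finset E) := hx ▸ (by simp [h1, h2])
  have h4 : e' ∈ ({x} : Finset E) := hx ▸ (by simp [h1', h2', hb])
  rw [Finset.mem_singleton] at h3 h4
  rw [h3, h4]

theorem τ_neg (e : E) : M.τ k (fun w => -η w) e = -M.τ k η e := by simp [τ]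

theorem Adm.neg (h : M.Adm k η) : M.Adm k fun w => -η w := by
  intro b h0 h1
  obtain ⟨e, e', he, he', hne⟩ := h b h0 h1
  exact ⟨e, e', he, he', by rw [τ_neg, τ_neg]; exact fun h => hne (neg_injective h)⟩

theorem Adm.fall_unique (hk : M.Kast k) (h : M.Adm k η) {e e' : E} (hb0 : M.bl e ≠ M.bl M.e00)
    (hb1 : M.bl e ≠ M.bl M.e10) (hb : M.bl e' = M.bl e)
    (h1 : M.τ k η e = 1) (h2 : M.τ k η (M.rB e) = -1)
    (h1' : M.τ k η e' = 1) (h2' : M.τ k η (M.rB e') = -1) : e = e' :=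
  h.neg.rise_unique hk hb0 hb1 hb (by rw [τ_neg, h1]) (by rw [τ_neg, h2]; decide)
    (by rw [τ_neg, h1']) (by rw [τ_neg, h2']; decide)

end Admissible

section Connected

set_option linter.unusedSectionVars false

variable {B W E : Type*} (M : QMap B W E) [Finite E]

theorem bdd_e01 : M.Bdd M.e01 :=
  ⟨fun h => M.w_ne (by rw [h]), fun h => M.b_ne (by rw [M.bl_e00, M.bl_e10, h])⟩

theorem bdd_e10 : M.Bdd M.e10 :=
  ⟨fun h => M.b_ne (by rw [h]), fun h => M.w_ne (by rw [M.wh_e00, M.wh_e01, h])⟩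

theorem bl_ne_of_interior {e : E} (hb0 : M.bl e ≠ M.bl M.e00) (hb1 : M.bl e ≠ M.bl M.e10) :
    M.Bdd e := ⟨fun h => hb0 (by rw [h]), fun h => hb1 (by rw [h, M.bl_e10])⟩

open Classical in
/-- The bounded corners are connected. -/
theorem bdd_connected (p : E → Prop)
    (h1 : ∀ e, M.Bdd e → M.Bdd (M.rB e) → (p e ↔ p (M.rB e)))
    (h2 : ∀ e, M.Bdd e → (p e ↔ p (M.φ e))) :
    ∀ e e', M.Bdd e → M.Bdd e' → p e → p e' := by
  let q : E → Prop := fun e => if e = M.e00 then p M.e01 else if e = M.e11 then p M.e10 else p e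
  have hq : ∀ e, M.Bdd e → (q e ↔ p e) := fun e he => by simp [q, he.1, he.2]
  have h0011 : M.e11 ≠ M.e00 := fun h => M.b_ne (by rw [M.bl_e10, h])
  have hrB : ∀ e, M.rB e ≠ M.e00 → M.rB e ≠ M.e11 → (q e ↔ q (M.rB e)) := by
    intro e h3 h4
    rw [hq _ ⟨h3, h4⟩]
    by_cases he0 : e = M.e00
    · rw [he0, M.rB_e00]; simp [q]
    by_cases he1 : e = M.e11
    · rw [he1, M.rB_e11]; simp [q, h0011]
    rw [hq e ⟨he0, he1⟩]
    exact h1 e ⟨he0, he1⟩ ⟨h3, h4⟩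
  have hrB' : ∀ e, q e ↔ q (M.rB e) := by
    intro e
    by_cases h3 : M.rB e = M.e00 ∨ M.rB e = M.e11
    · refine M.rB.cycle_gap e q fun y hy hne => hrB y ?_ ?_
      · intro h4
        rcases h3 with h3 | h3
        · exact hne (M.rB.injective (h4.trans h3.symm))
        · have := (M.rB_cycle _ _).1 hy
          rw [← M.bl_rB e, ← M.bl_rB y, h3, h4, ← M.bl_e10] at this
          exact M.b_ne this.symm
      · intro h4
        rcases h3 with h3 | h3
        · have := (M.rB_cycle _ _).1 hy
          rw [← M.bl_rB e, ← M.bl_rB y, h3, h4, ← M.bl_e10] at this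
          exact M.b_ne this
        · exact hne (M.rB.injective (h4.trans h3.symm))
    · rw [not_or] at h3
      exact hrB e h3.1 h3.2
  have hrW : ∀ e, M.Bdd e → (q e ↔ q (M.rW⁻¹ e)) := by
    intro e he
    rw [← M.rB_φ, ← hrB', hq _ he, hq _ (M.bdd_φ.2 he)]
    exact h2 e he
  have hrW' : ∀ e, q e ↔ q (M.rW⁻¹ e) := by
    intro e
    by_cases he : M.Bdd e
    · exact hrW e he
    · refine (M.rW⁻¹).cycle_gap e q fun y hy hne => hrW y ?_
      rw [Equiv.Perm.sameCycle_inv, M.rW_cycle] at hy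
      unfold Bdd at he
      rw [not_and_or, not_not, not_not] at he
      rcases he with rfl | rfl
      · exact ⟨hne, fun h => M.w_ne (by rw [hy, h, M.wh_e01])⟩
      · exact ⟨fun h => M.w_ne (by rw [M.wh_e01, hy, h]), hne⟩
  intro e e' he he' hp
  rw [← hq e' he']
  refine M.trans q (fun e h => (hrB' e).1 h) (fun e h => ?_) e e' ((hq e he).2 hp)
  rw [hrW']; simpa using h

end Connected

section Key

set_option linter.unusedSectionVars false

variable {B W E : Type*} {M : QMap B W E} [Fintype B] [Fintype W] [Fintype E]
variable {k : E → ℝ} {f : W → ℝ} {η : W → ℤˣ}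

open scoped Classical

theorem rB_ne (e : E) : M.rB e ≠ e := by
  intro h
  have hfix : ∀ e', M.bl e' = M.bl e → e' = e := by
    intro e' he'
    obtain ⟨n, hn⟩ := (M.rB_cycle e e').2 he'.symm
    rw [← hn, Equiv.Perm.zpow_apply_eq_self_of_apply_eq_self h]
  by_cases h0 : M.bl e = M.bl M.e00
  · exact M.w_ne (by rw [hfix M.e00 h0.symm, hfix M.e01 (M.bl_e00.symm.trans h0.symm)])
  by_cases h1 : M.bl e = M.bl M.e10
  · exact M.w_ne (by rw [M.wh_e00, M.wh_e01, hfix M.e10 h1.symm,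
      hfix M.e11 (M.bl_e10.symm.trans h1.symm)])
  have := M.nondegB {M.bl e} {M.wh e} (by simp) (by simpa using fun h => h0 h.symm)
    (by simpa using fun h => h1 h.symm) (by
      intro e' he'
      rw [hfix e' (by simpa using he')]; simp)
  simp at this

theorem wh_rB_ne (e : E) : M.wh (M.rB e) ≠ M.wh e :=
  fun h => rB_ne (M := M) e (M.inj _ _ (M.bl_rB e) h)

/-- The sign that makes `τ e` equal to `t`. -/
noncomputable def want (k : E → ℝ) (e : E) (t : ℤˣ) : ℤˣ := sgn (k e) * t

theorem τ_of_want {e : E} {t : ℤˣ} (h : η (M.wh e) = want k e t) : M.τ k η e = t := by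
  rw [τ, h, want, ← mul_assoc, Int.units_mul_self, one_mul]

theorem zero_φ (hk : M.Kast k) (hf : ∀ b, b ≠ M.bl M.e00 → b ≠ M.bl M.e10 → M.Harm k f b)
    {e : E} (he : M.Bdd e) (h0 : f (M.wh e) = 0) (h1 : f (M.wh (M.rB e)) = 0) :
    f (M.wh (M.φ e)) = 0 := by
  by_contra h2
  have hs : ∀ η, Compat f η → M.τ k η (M.φ e) = sgn (k (M.φ e) * f (M.wh (M.φ e))) :=
    fun η hη => hη.τ_eq hk h2
  set t := sgn (k (M.φ e) * f (M.wh (M.φ e)))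
  have hw : M.wh (M.rB (M.φ e)) = M.wh e := M.wh_rB_φ e
  let s := want k (M.rB (M.φ e)) t
  obtain ⟨η, hc, h3, h4, had⟩ := exists_adm hk hf (wh_rB_ne e).symm h0 h1 s
    (want k (M.rB e) (sgn (k e) * s))
  have h5 : M.τ k η (M.φ e) = M.τ k η (M.rB (M.φ e)) := by
    rw [hs η hc, τ_of_want (t := t)]; rw [hw, h3]
  have h6 : M.τ k η e = M.τ k η (M.rB e) := by
    rw [τ_of_want h4, τ, h3]
  have h7 := had.face_unique hk he ⟨1, by simp⟩ h6 h5
  rw [← h7] at h2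
  exact h2 h0

theorem zero_rB_bdry (hk : M.Kast k) (hf : ∀ b, b ≠ M.bl M.e00 → b ≠ M.bl M.e10 → M.Harm k f b)
    {e : E} (he : M.Bdd e) (he' : M.Bdd (M.rB e))
    (hb : M.bl e = M.bl M.e00 ∨ M.bl e = M.bl M.e10) :
    (f (M.wh e) = 0 ∧ f (M.wh (M.rB e)) = 0) ↔
      (f (M.wh (M.rB e)) = 0 ∧ f (M.wh (M.rB (M.rB e))) = 0) := by
  constructor
  · rintro ⟨h0, h1⟩
    refine ⟨h1, ?_⟩
    by_contra h2
    set t := sgn (k (M.rB (M.rB e)) * f (M.wh (M.rB (M.rB e)))) with ht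
    obtain ⟨η, hc, h3, h4, had⟩ := exists_adm hk hf (wh_rB_ne e).symm h0 h1 (want k e t)
      (want k (M.rB e) (-t))
    have h5 : M.τ k η (M.rB (M.rB e)) = t := hc.τ_eq hk h2
    have h6 := τ_of_want h3
    have h7 := τ_of_want h4
    refine rB_ne (M := M) e (had.bdry_unique hk he he' hb (by rwa [M.bl_rB]) ?_ ?_).symm
    · rw [h6, h7]; rw [Int.units_ne_iff, neg_neg]
    · rw [h5, h7]; rw [Int.units_ne_iff]
  · rintro ⟨h1, h2⟩
    refine ⟨?_, h1⟩
    by_contra h0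
    set t := sgn (k e * f (M.wh e)) with ht
    obtain ⟨η, hc, h3, h4, had⟩ := exists_adm hk hf (wh_rB_ne (M.rB e)).symm h1 h2
      (want k (M.rB e) (-t)) (want k (M.rB (M.rB e)) t)
    have h5 : M.τ k η e = t := hc.τ_eq hk h0
    have h6 := τ_of_want h3
    have h7 := τ_of_want h4
    refine rB_ne (M := M) e (had.bdry_unique hk he he' hb (by rwa [M.bl_rB]) ?_ ?_).symm
    · rw [h5, h6]; rw [Int.units_ne_iff, neg_neg]
    · rw [h6, h7]; rw [Int.units_ne_iff]

theorem Adm.no_alternation (hk : M.Kast k) (had : M.Adm k η) {e y : E} {t : ℤˣ}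
    (hb0 : M.bl e ≠ M.bl M.e00) (hb1 : M.bl e ≠ M.bl M.e10) (h1 : M.τ k η e = t)
    (h2 : M.τ k η (M.rB e) = -t) (h3 : M.τ k η (M.rB (M.rB e)) = t) (hy : M.bl y = M.bl e)
    (hye : y ≠ M.rB e) (hyt : M.τ k η y ≠ t) : False := by
  have huniq : ∀ y, M.bl y = M.bl e → M.τ k η y = t → M.τ k η (M.rB y) = -t → y = e := by
    intro y hy hy1 hy2
    rcases Int.units_eq_one_or t with h | h
    · rw [h] at h1 h2 hy1 hy2
      exact (had.fall_unique hk hb0 hb1 hy h1 h2 hy1 hy2).symm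
    · rw [h, neg_neg] at h2 hy2
      rw [h] at h1 hy1
      exact (had.rise_unique hk hb0 hb1 hy h1 h2 hy1 hy2).symm
  have hall := M.rB.cycle_induct_of_mem (M.rB e) (fun z => z = M.rB e ∨ M.τ k η z = t)
    (Or.inl rfl) (by
      rintro z hz (rfl | hz1)
      · exact Or.inr h3
      · by_cases hze : z = e
        · left; rw [hze]
        · right
          by_contra hne
          refine hze (huniq z ?_ hz1 (by rw [Int.units_ne_iff.1 hne]))
          rw [← (M.rB_cycle _ _).1 hz, M.bl_rB]) y (by rw [M.rB_cycle, M.bl_rB, hy])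
  rcases hall with h | h
  · exact hye h
  · exact hyt h

theorem zero_rB_interior (hk : M.Kast k)
    (hf : ∀ b, b ≠ M.bl M.e00 → b ≠ M.bl M.e10 → M.Harm k f b)
    {e : E} (hb0 : M.bl e ≠ M.bl M.e00) (hb1 : M.bl e ≠ M.bl M.e10)
    (h0 : f (M.wh e) = 0) (h1 : f (M.wh (M.rB e)) = 0) : f (M.wh (M.rB (M.rB e))) = 0 := by
  by_contra h2
  set t := sgn (k (M.rB (M.rB e)) * f (M.wh (M.rB (M.rB e)))) with ht
  obtain ⟨η, hc, h3, h4, had⟩ := exists_adm hk hf (wh_rB_ne e).symm h0 h1 (want k e t)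
    (want k (M.rB e) (-t))
  have h5 : M.τ k η (M.rB (M.rB e)) = t := hc.τ_eq hk h2
  obtain ⟨y, hy, hyf, hyt⟩ := (hf _ hb0 hb1).exists_opposite hk hc (e := M.rB (M.rB e))
    (by rw [M.bl_rB, M.bl_rB]) h2
  rw [h5] at hyt
  exact had.no_alternation hk hb0 hb1 (τ_of_want h3) (τ_of_want h4) h5 hy
    (by rintro rfl; exact hyf h1) hyt

/-- A function that is harmonic at the interior black vertices and vanishes at two consecutive
vertices of a bounded face vanishes identically. -/
theorem eq_zero_of_consecutive (hk : M.Kast k)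
    (hf : ∀ b, b ≠ M.bl M.e00 → b ≠ M.bl M.e10 → M.Harm k f b)
    {e : E} (he : M.Bdd e) (h0 : f (M.wh e) = 0) (h1 : f (M.wh (M.rB e)) = 0) (w : W) :
    f w = 0 := by
  let p : E → Prop := fun e => f (M.wh e) = 0 ∧ f (M.wh (M.rB e)) = 0
  have hφ : ∀ e, M.Bdd e → p e → p (M.φ e) := fun e he hp =>
    ⟨zero_φ hk hf he hp.1 hp.2, by rw [wh_rB_φ]; exact hp.1⟩
  have hint : ∀ e, M.bl e ≠ M.bl M.e00 → M.bl e ≠ M.bl M.e10 → p e → p (M.rB e) :=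
    fun e hb0 hb1 hp => ⟨hp.2, zero_rB_interior hk hf hb0 hb1 hp.1 hp.2⟩
  have hall : ∀ e', M.Bdd e' → p e' := by
    intro e' he'
    refine M.bdd_connected p ?_ ?_ e e' he he' ⟨h0, h1⟩
    · intro e he1 he2
      by_cases hb : M.bl e = M.bl M.e00 ∨ M.bl e = M.bl M.e10
      · exact zero_rB_bdry hk hf he1 he2 hb
      · rw [not_or] at hb
        refine ⟨hint e hb.1 hb.2, fun hp => ?_⟩
        refine M.rB.cycle_induct_of_mem (M.rB e) p hp (fun y hy hpy => ?_) e ⟨-1, by simp⟩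
        have := (M.rB_cycle _ _).1 hy
        rw [M.bl_rB] at this
        exact hint y (this ▸ hb.1) (this ▸ hb.2) hpy
    · intro e he1
      refine ⟨hφ e he1, fun hp => ?_⟩
      have := M.φ.cycle_induct_of_mem (M.φ e) (fun y => M.Bdd y ∧ p y) ⟨M.bdd_φ.2 he1, hp⟩
        (fun y hy hpy => ⟨M.bdd_φ.2 hpy.1, hφ y hpy.1 hpy.2⟩) e ⟨-1, by simp⟩
      exact this.2
  obtain ⟨e', rfl⟩ := M.wh_surj w
  by_cases hb : M.Bdd e'
  · exact (hall e' hb).1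
  · obtain ⟨y, rfl⟩ := M.rB.surjective e'
    refine (hall y ⟨?_, ?_⟩).2
    · rintro rfl
      rw [M.rB_e00] at hb; exact hb M.bdd_e01
    · rintro rfl
      rw [M.rB_e11] at hb; exact hb M.bdd_e10

/-- Every sign pattern compatible with a nonzero harmonic function is admissible. -/
theorem Compat.adm (hk : M.Kast k) (hη : Compat f η)
    (hf : ∀ b, b ≠ M.bl M.e00 → b ≠ M.bl M.e10 → M.Harm k f b) (hne : f ≠ 0) : M.Adm k η := by
  intro b hb0 hb1
  refine (hf b hb0 hb1).exists_ne hk hη ?_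
  by_contra! hc
  obtain ⟨e, rfl⟩ := M.bl_surj b
  exact hne (funext fun w => eq_zero_of_consecutive hk hf (M.bl_ne_of_interior hb0 hb1) (hc e rfl)
    (hc _ (M.bl_rB e)) w)

theorem exists_ne_at (hk : M.Kast k)
    (hf : ∀ b, b ≠ M.bl M.e00 → b ≠ M.bl M.e10 → M.Harm k f b) (hne : f ≠ 0) (b : B) :
    ∃ e, M.bl e = b ∧ f (M.wh e) ≠ 0 := by
  by_contra! hc
  obtain ⟨e, he, hbd⟩ : ∃ e, M.bl e = b ∧ M.Bdd e := by
    by_cases h0 : b = M.bl M.e00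
    · exact ⟨M.e01, by rw [h0, M.bl_e00], M.bdd_e01⟩
    by_cases h1 : b = M.bl M.e10
    · exact ⟨M.e10, h1.symm, M.bdd_e10⟩
    obtain ⟨e, rfl⟩ := M.bl_surj b
    exact ⟨e, rfl, M.bl_ne_of_interior h0 h1⟩
  exact hne (funext fun w => eq_zero_of_consecutive hk hf hbd (hc e he)
    (hc _ ((M.bl_rB e).trans he)) w)

end Key

end QMap

namespace QMap

section Inverse

set_option linter.unusedSectionVars false

variable {B W E : Type*} {M : QMap B W E} [Fintype B] [Fintype W] [Fintype E]
variable {k : E → ℝ} {f : W → ℝ} {η : W → ℤˣ}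

open scoped Classical

theorem exists_compat {f : W → ℝ} {w : W} (hw : f w = 0) (s : ℤˣ) :
    ∃ η, Compat f η ∧ η w = s := by
  refine ⟨Function.update (fun u => sgn (f u)) w s, fun u hu => ?_, Function.update_self _ _ _⟩
  rw [Function.update_of_ne]
  rintro rfl; exact hu hw

theorem bdry_const {b : B} (hb : b = M.bl M.e00 ∨ b = M.bl M.e10)
    (h : ∀ e, M.Bdd e → M.bl e = b → M.τ k η e = M.τ k η (M.rB e)) {e e' : E}
    (he : M.bl e = b) (he' : M.bl e' = b) : M.τ k η e = M.τ k η e' := by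
  have key : ∀ x, M.bl x = b → (x = M.e00 ∨ x = M.e11) →
      ∀ y, M.bl y = b → M.τ k η y = M.τ k η (M.rB x) := by
    intro x hx hx' y hy
    refine M.rB.cycle_induct x (fun y => M.τ k η y = M.τ k η (M.rB x)) rfl ?_ y
      (by rw [M.rB_cycle, hx, hy])
    intro z hz hzx h1
    rw [M.rB_cycle, hx] at hz
    rw [← h z ?_ hz.symm, h1]
    rcases hx' with rfl | rfl
    · exact ⟨hzx, fun h => M.b_ne (by rw [hx, hz, h, M.bl_e10])⟩
    · exact ⟨fun h => M.b_ne (by rw [← h, ← hz, ← hx, M.bl_e10]), hzx⟩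
  rcases hb with rfl | rfl
  · rw [key _ rfl (Or.inl rfl) e he, key _ rfl (Or.inl rfl) e' he']
  · rw [key _ M.bl_e10.symm (Or.inr rfl) e he, key _ M.bl_e10.symm (Or.inr rfl) e' he']

theorem Harm.exists_bdry_change (hk : M.Kast k) {b : B} (hb : b = M.bl M.e00 ∨ b = M.bl M.e10)
    (hf : M.Harm k f b) (hη : Compat f η) (hne : ∃ e, M.bl e = b ∧ f (M.wh e) ≠ 0) :
    ∃ e, M.Bdd e ∧ M.bl e = b ∧ M.τ k η e ≠ M.τ k η (M.rB e) := by
  by_contra! hc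
  obtain ⟨e, e', he, he', h⟩ := hf.exists_ne hk hη hne
  exact h (bdry_const hb hc he he')

theorem kernel_trivial (hk : M.Kast k) (hf : ∀ b, M.Harm k f b) : f = 0 := by
  by_contra hne
  have hc : Compat f fun u => sgn (f u) := fun _ _ => rfl
  have hf' : ∀ b, b ≠ M.bl M.e00 → b ≠ M.bl M.e10 → M.Harm k f b := fun b _ _ => hf b
  have had := hc.adm hk hf' hne
  obtain ⟨e, he, hb, h⟩ := (hf _).exists_bdry_change hk (Or.inl rfl) hc
    (exists_ne_at hk hf' hne _)
  obtain ⟨e', he', hb', h'⟩ := (hf _).exists_bdry_change hk (Or.inr rfl) hc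
    (exists_ne_at hk hf' hne _)
  have := had.bdry_unique hk he he' (Or.inl hb) (Or.inr hb') h h'
  exact M.b_ne (by rw [← hb, ← hb', this])

theorem bdry_pos (hk : M.Kast k) {b b' : B}
    (hbb : (b = M.bl M.e00 ∧ b' = M.bl M.e10) ∨ (b = M.bl M.e10 ∧ b' = M.bl M.e00))
    (hf : ∀ c, ∑ e with M.bl e = c, k e * f (M.wh e) = if c = b then 1 else 0) {e : E}
    (he : M.bl e = b) : 0 < k e * f (M.wh e) := by
  have hbne : b' ≠ b := by
    rcases hbb with ⟨rfl, rfl⟩ | ⟨rfl, rfl⟩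
    · exact M.b_ne.symm
    · exact M.b_ne
  have hb : b = M.bl M.e00 ∨ b = M.bl M.e10 := by tauto
  have hb' : b' = M.bl M.e00 ∨ b' = M.bl M.e10 := by tauto
  have hharm : ∀ c, c ≠ b → M.Harm k f c := fun c hc => by rw [Harm, hf, if_neg hc]
  have hf' : ∀ c, c ≠ M.bl M.e00 → c ≠ M.bl M.e10 → M.Harm k f c := fun c h0 h1 =>
    hharm c (by rcases hb with rfl | rfl <;> assumption)
  have hne : f ≠ 0 := by
    rintro rfl
    have := hf b
    simp at this
  have hconst : ∀ η, Compat f η → ∀ x y, M.bl x = b → M.bl y = b → M.τ k η x = M.τ k η y := by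
    intro η hη x y hx hy
    refine bdry_const hb (fun z hz hzb => ?_) hx hy
    by_contra hcon
    obtain ⟨z', hz', hzb', h'⟩ := (hharm b' hbne).exists_bdry_change hk hb' hη
      (exists_ne_at hk hf' hne _)
    have := (hη.adm hk hf' hne).bdry_unique hk hz hz' (by rwa [hzb]) (by rwa [hzb']) hcon h'
    exact hbne (by rw [← hzb, ← hzb', this])
  obtain ⟨x, hx, hxne⟩ := exists_ne_at hk hf' hne b
  have hall : ∀ y, M.bl y = b → f (M.wh y) ≠ 0 := by
    intro y hy h0
    obtain ⟨η, hc, hη⟩ := exists_compat h0 (want k y (-sgn (k x * f (M.wh x))))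
    have h1 := hconst _ hc x y hx hy
    rw [hc.τ_eq hk hxne, τ_of_want hη] at h1
    exact absurd rfl (Int.units_ne_iff.2 h1)
  have hc : Compat f fun u => sgn (f u) := fun _ _ => rfl
  have hpos : ∀ y, M.bl y = b → (0 < k y * f (M.wh y) ↔ 0 < k e * f (M.wh e)) := by
    intro y hy
    rw [← sgn_eq_one_iff, ← sgn_eq_one_iff, ← hc.τ_eq hk (hall y hy), ← hc.τ_eq hk (hall e he),
      hconst _ hc y e hy he]
  by_contra hcon
  have h1 : ∑ e with M.bl e = b, k e * f (M.wh e) ≤ 0 := by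
    refine Finset.sum_nonpos fun y hy => ?_
    rw [← not_lt, hpos y (by simpa using hy)]
    exact hcon
  rw [hf, if_pos rfl] at h1
  linarith

variable (M) in
/-- `v₀`, `v₁` are the columns of the inverse Kasteleyn matrix at the black boundary vertices. -/
structure Cols (k : E → ℝ) (v₀ v₁ : W → ℝ) : Prop where
  h0 : ∀ b, ∑ e with M.bl e = b, k e * v₀ (M.wh e) = if b = M.bl M.e00 then 1 else 0
  h1 : ∀ b, ∑ e with M.bl e = b, k e * v₁ (M.wh e) = if b = M.bl M.e10 then 1 else 0

variable {v₀ v₁ : W → ℝ}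

theorem Cols.pos0 (hv : M.Cols k v₀ v₁) (hk : M.Kast k) {e : E} (he : M.bl e = M.bl M.e00) :
    0 < k e * v₀ (M.wh e) := bdry_pos hk (Or.inl ⟨rfl, rfl⟩) hv.h0 he

theorem Cols.pos1 (hv : M.Cols k v₀ v₁) (hk : M.Kast k) {e : E} (he : M.bl e = M.bl M.e10) :
    0 < k e * v₁ (M.wh e) := bdry_pos hk (Or.inr ⟨rfl, rfl⟩) hv.h1 he

theorem Cols.sum_comb (hv : M.Cols k v₀ v₁) (α β : ℝ) (b : B) :
    ∑ e with M.bl e = b, k e * (α * v₀ (M.wh e) + β * v₁ (M.wh e))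
      = α * (if b = M.bl M.e00 then 1 else 0) + β * (if b = M.bl M.e10 then 1 else 0) := by
  rw [← hv.h0, ← hv.h1, Finset.mul_sum, Finset.mul_sum, ← Finset.sum_add_distrib]
  exact Finset.sum_congr rfl fun e _ => by ring

theorem Cols.harm (hv : M.Cols k v₀ v₁) (α β : ℝ) (b : B) (h0 : b ≠ M.bl M.e00)
    (h1 : b ≠ M.bl M.e10) : M.Harm k (fun w => α * v₀ w + β * v₁ w) b := by
  rw [Harm, hv.sum_comb, if_neg h0, if_neg h1]; ring

theorem Cols.comb_ne_zero (hv : M.Cols k v₀ v₁) {α β : ℝ} (h : α ≠ 0 ∨ β ≠ 0) :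
    (fun w => α * v₀ w + β * v₁ w) ≠ 0 := by
  intro hz
  have hz' : ∀ w, α * v₀ w + β * v₁ w = 0 := fun w => congrFun hz w
  have h0 := hv.sum_comb α β (M.bl M.e00)
  have h1 := hv.sum_comb α β (M.bl M.e10)
  simp only [hz', M.b_ne, M.b_ne.symm, mul_zero, Finset.sum_const_zero, if_true, if_false] at h0 h1
  rcases h with h | h
  · exact h (by linarith)
  · exact h (by linarith)

theorem Cols.adm (hv : M.Cols k v₀ v₁) (hk : M.Kast k) {α β : ℝ} (h : α ≠ 0 ∨ β ≠ 0)
    (hη : Compat (fun w => α * v₀ w + β * v₁ w) η) : M.Adm k η :=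
  hη.adm hk (hv.harm α β) (hv.comb_ne_zero h)

theorem Cols.k_prod_neg (hv : M.Cols k v₀ v₁) (hk : M.Kast k) :
    k M.e00 * k M.e01 * (k M.e10 * k M.e11) < 0 := by
  have h00 := hv.pos0 hk (e := M.e00) rfl
  have h01 := hv.pos0 hk (e := M.e01) M.bl_e00.symm
  have hw0 := right_ne_zero_of_mul h00.ne'
  have hw1 := right_ne_zero_of_mul h01.ne'
  have hc : Compat v₀ fun u => sgn (v₀ u) := fun _ _ => rfl
  have hharm : ∀ b, b ≠ M.bl M.e00 → b ≠ M.bl M.e10 → M.Harm k v₀ b := fun b h0 _ => by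
    rw [Harm, hv.h0, if_neg h0]
  have hne : v₀ ≠ 0 := by rintro rfl; exact hw0 rfl
  have had := hc.adm hk hharm hne
  obtain ⟨y, hy, hyb, hyc⟩ := Harm.exists_bdry_change hk (Or.inr rfl)
    (by rw [Harm, hv.h0, if_neg M.b_ne.symm]) hc (exists_ne_at hk hharm hne _)
  have hneg : M.τ k (fun u => sgn (v₀ u)) M.e11 ≠ M.τ k (fun u => sgn (v₀ u)) M.e10 := by
    intro heq
    have := M.rB.cycle_gap y (fun z => M.τ k (fun u => sgn (v₀ u)) z = 1) (by
      intro z hz hzy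
      rw [M.rB_cycle, hyb] at hz
      suffices h : M.τ k (fun u => sgn (v₀ u)) z = M.τ k (fun u => sgn (v₀ u)) (M.rB z) by rw [h]
      by_cases hzb : M.Bdd z
      · by_contra hcon
        exact hzy (had.bdry_unique hk hzb hy (Or.inr hz.symm) (Or.inr hyb) hcon hyc)
      · have hz11 : z = M.e11 := by
          unfold Bdd at hzb
          rw [not_and_or, not_not, not_not] at hzb
          rcases hzb with rfl | rfl
          · exact absurd hz.symm M.b_ne
          · rfl
        rw [hz11, M.rB_e11, heq])
    rcases Int.units_eq_one_or (M.τ k (fun u => sgn (v₀ u)) y) with h | h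
    · exact hyc (by rw [h, this.1 h])
    · rcases Int.units_eq_one_or (M.τ k (fun u => sgn (v₀ u)) (M.rB y)) with h' | h'
      · exact hyc (by rw [h', this.2 h'])
      · exact hyc (by rw [h, h'])
  rw [hc.τ_eq hk (by rwa [← M.wh_e01]), hc.τ_eq hk (by rwa [← M.wh_e00]), Ne, sgn_eq_sgn_iff
    (mul_ne_zero (hk.ne _) (by rwa [← M.wh_e01])) (mul_ne_zero (hk.ne _) (by rwa [← M.wh_e00])),
    ← M.wh_e00, ← M.wh_e01, not_lt] at hneg
  have h1 := mul_pos h00 h01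
  have h2 : 0 < (v₀ (M.wh M.e00) * v₀ (M.wh M.e01)) ^ 2 := by positivity
  have h3 : k M.e00 * k M.e01 * (k M.e10 * k M.e11) * (v₀ (M.wh M.e00) * v₀ (M.wh M.e01)) ^ 2
    ≤ 0 := by
    calc _ = (k M.e00 * v₀ (M.wh M.e00) * (k M.e01 * v₀ (M.wh M.e01))) *
        (k M.e11 * v₀ (M.wh M.e01) * (k M.e10 * v₀ (M.wh M.e00))) := by ring
      _ ≤ 0 := mul_nonpos_of_nonneg_of_nonpos h1.le hneg
  have h4 : k M.e00 * k M.e01 * (k M.e10 * k M.e11) ≤ 0 := by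
    by_contra hcon
    exact absurd h3 (not_le.2 (mul_pos (not_le.1 hcon) h2))
  exact lt_of_le_of_ne h4 (mul_ne_zero (mul_ne_zero (hk.ne _) (hk.ne _))
    (mul_ne_zero (hk.ne _) (hk.ne _)))

variable (M) in
/-- The oriented area of the vectors `k(e) (v₀, v₁)(w)` at two consecutive edges. -/
def ω (k : E → ℝ) (v₀ v₁ : W → ℝ) (e : E) : ℝ := k e * k (M.rB e) *
  (v₀ (M.wh e) * v₁ (M.wh (M.rB e)) - v₁ (M.wh e) * v₀ (M.wh (M.rB e)))

theorem Cols.det_ne_zero (hv : M.Cols k v₀ v₁) (hk : M.Kast k) {e : E} (he : M.Bdd e) :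
    v₀ (M.wh e) * v₁ (M.wh (M.rB e)) - v₁ (M.wh e) * v₀ (M.wh (M.rB e)) ≠ 0 := by
  intro h
  have key : ∀ α β : ℝ, (α ≠ 0 ∨ β ≠ 0) → α * v₀ (M.wh e) + β * v₁ (M.wh e) = 0 →
      α * v₀ (M.wh (M.rB e)) + β * v₁ (M.wh (M.rB e)) = 0 → False := by
    intro α β hαβ h1 h2
    exact hv.comb_ne_zero hαβ (funext fun w =>
      eq_zero_of_consecutive (f := fun w => α * v₀ w + β * v₁ w) hk (hv.harm α β) he h1 h2 w)
  by_cases h1 : v₁ (M.wh e) ≠ 0 ∨ -v₀ (M.wh e) ≠ 0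
  · exact key _ _ h1 (by ring) (by linarith)
  rw [not_or, not_not, not_not, neg_eq_zero] at h1
  by_cases h2 : v₁ (M.wh (M.rB e)) ≠ 0 ∨ -v₀ (M.wh (M.rB e)) ≠ 0
  · exact key _ _ h2 (by rw [h1.1, h1.2]; ring) (by ring)
  rw [not_or, not_not, not_not, neg_eq_zero] at h2
  exact key 1 0 (Or.inl one_ne_zero) (by rw [h1.1, h1.2]; ring) (by rw [h2.1, h2.2]; ring)

theorem Cols.ω_ne_zero (hv : M.Cols k v₀ v₁) (hk : M.Kast k) {e : E} (he : M.Bdd e) :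
    M.ω k v₀ v₁ e ≠ 0 :=
  mul_ne_zero (mul_ne_zero (hk.ne _) (hk.ne _)) (hv.det_ne_zero hk he)

theorem Cols.ne_zero (hv : M.Cols k v₀ v₁) (hk : M.Kast k) (w : W) : v₁ w ≠ 0 ∨ v₀ w ≠ 0 := by
  obtain ⟨e, rfl⟩ := M.wh_surj w
  by_contra! h
  by_cases he : M.Bdd e
  · exact hv.det_ne_zero hk he (by rw [h.1, h.2]; ring)
  · obtain ⟨y, rfl⟩ := M.rB.surjective e
    refine hv.det_ne_zero (e := y) hk ⟨?_, ?_⟩ (by rw [h.1, h.2]; ring)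
    · rintro rfl
      rw [M.rB_e00] at he; exact he M.bdd_e01
    · rintro rfl
      rw [M.rB_e11] at he; exact he M.bdd_e10

theorem Cols.ω_rB (hv : M.Cols k v₀ v₁) (hk : M.Kast k) {e : E} (he : M.Bdd e)
    (he' : M.Bdd (M.rB e)) : 0 < M.ω k v₀ v₁ e * M.ω k v₀ v₁ (M.rB e) := by
  set m := M.rB e with hm
  set f : W → ℝ := fun u => v₁ (M.wh m) * v₀ u + -v₀ (M.wh m) * v₁ u with hf
  have hαβ : v₁ (M.wh m) ≠ 0 ∨ -v₀ (M.wh m) ≠ 0 := by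
    simpa using hv.ne_zero hk (M.wh m)
  have h1 : M.ω k v₀ v₁ e = k m * (k e * f (M.wh e)) := by rw [ω, ← hm, hf]; ring
  have h2 : M.ω k v₀ v₁ m = -(k m * (k (M.rB m) * f (M.wh (M.rB m)))) := by rw [ω, hf]; ring
  have h1' := right_ne_zero_of_mul (right_ne_zero_of_mul (h1 ▸ hv.ω_ne_zero hk he))
  have h2' := right_ne_zero_of_mul (right_ne_zero_of_mul
    (neg_ne_zero.1 (h2 ▸ hv.ω_ne_zero hk he')))
  have hfm : f (M.wh m) = 0 := by rw [hf]; ring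
  by_contra hcon
  set x := k e * f (M.wh e) with hx
  set z := k (M.rB m) * f (M.wh (M.rB m)) with hz
  have hxne : x ≠ 0 := mul_ne_zero (hk.ne _) h1'
  have hzne : z ≠ 0 := mul_ne_zero (hk.ne _) h2'
  have hxz : 0 < x * z := by
    rw [h1, h2] at hcon
    have h3 : 0 ≤ k m ^ 2 * (x * z) := by nlinarith
    have h4 : 0 < k m ^ 2 := by have := hk.ne m; positivity
    exact lt_of_le_of_ne (nonneg_of_mul_nonneg_right h3 h4) (mul_ne_zero hxne hzne).symm
  have hsg : sgn x = sgn z := (sgn_eq_sgn_iff hxne hzne).2 hxz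
  obtain ⟨η, hc, hη⟩ := exists_compat hfm (want k m (-sgn x))
  have had := hv.adm hk hαβ hc
  have ht1 : M.τ k η e = sgn x := hc.τ_eq hk h1'
  have ht2 : M.τ k η m = -sgn x := τ_of_want hη
  have ht3 : M.τ k η (M.rB m) = sgn x := (hc.τ_eq hk h2').trans hsg.symm
  by_cases hb : M.bl e = M.bl M.e00 ∨ M.bl e = M.bl M.e10
  · refine rB_ne (M := M) e (had.bdry_unique hk he he' hb (by rwa [hm, M.bl_rB]) ?_ ?_).symm
    · rw [ht1, ← hm, ht2, Int.units_ne_iff, neg_neg]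
    · rw [ht2, ht3, Int.units_ne_iff]
  · rw [not_or] at hb
    obtain ⟨y, hy, hyf, hyt⟩ := (hv.harm (v₁ (M.wh m)) (-v₀ (M.wh m)) _ hb.1 hb.2).exists_opposite
      hk hc (e := e) rfl h1'
    rw [ht1] at hyt
    exact had.no_alternation hk hb.1 hb.2 ht1 ht2 ht3 hy (by rintro rfl; exact hyf hfm) hyt

theorem Cols.ω_φ (hv : M.Cols k v₀ v₁) (hk : M.Kast k) {e : E} (he : M.Bdd e) :
    0 < M.ω k v₀ v₁ e * M.ω k v₀ v₁ (M.φ e) := by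
  set f : W → ℝ := fun u => v₁ (M.wh e) * v₀ u + -v₀ (M.wh e) * v₁ u with hf
  have hαβ : v₁ (M.wh e) ≠ 0 ∨ -v₀ (M.wh e) ≠ 0 := by
    simpa using hv.ne_zero hk (M.wh e)
  set d := M.φ e with hd
  have hwd : M.wh (M.rB d) = M.wh e := M.wh_rB_φ e
  have h1 : M.ω k v₀ v₁ e = -(k e * (k (M.rB e) * f (M.wh (M.rB e)))) := by rw [ω, hf]; ring
  have h2 : M.ω k v₀ v₁ d = k (M.rB d) * (k d * f (M.wh d)) := by rw [ω, hf, hwd]; ring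
  have h1' := right_ne_zero_of_mul (right_ne_zero_of_mul
    (neg_ne_zero.1 (h1 ▸ hv.ω_ne_zero hk he)))
  have h2' := right_ne_zero_of_mul (right_ne_zero_of_mul
    (h2 ▸ hv.ω_ne_zero hk (M.bdd_φ.2 he)))
  have hfm : f (M.wh e) = 0 := by rw [hf]; ring
  by_contra hcon
  set x := k (M.rB e) * f (M.wh (M.rB e)) with hx
  set z := k d * f (M.wh d) with hz
  have hxne : x ≠ 0 := mul_ne_zero (hk.ne _) h1'
  have hzne : z ≠ 0 := mul_ne_zero (hk.ne _) h2'
  have hke := hk.ne e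
  have hkd := hk.ne (M.rB d)
  have hxz : 0 < (k e * x) * (k (M.rB d) * z) := by
    rw [h1, h2] at hcon
    exact lt_of_le_of_ne (by linarith) (mul_ne_zero (mul_ne_zero hke hxne)
      (mul_ne_zero hkd hzne)).symm
  have hsg := (sgn_eq_sgn_iff (mul_ne_zero hke hxne) (mul_ne_zero hkd hzne)).2 hxz
  rw [sgn_mul hke hxne, sgn_mul hkd hzne] at hsg
  obtain ⟨η, hc, hη⟩ := exists_compat hfm (want k e (sgn x))
  have had := hv.adm hk hαβ hc
  have ht1 : M.τ k η e = sgn x := τ_of_want hη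
  have ht2 : M.τ k η (M.rB e) = sgn x := hc.τ_eq hk h1'
  have ht3 : M.τ k η d = sgn z := hc.τ_eq hk h2'
  have ht4 : M.τ k η (M.rB d) = sgn z := by
    rw [τ, hwd, hη, want, hsg, ← mul_assoc, Int.units_mul_self, one_mul]
  have := had.face_unique hk he (e' := d) ⟨1, by simp [hd]⟩ (by rw [ht1, ht2]) (by rw [ht3, ht4])
  rw [← this] at h2'
  exact h2' hfm

/-- All bounded corners are oriented in the same way. -/
theorem Cols.ω_sign (hv : M.Cols k v₀ v₁) (hk : M.Kast k) {e : E} (he : M.Bdd e) :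
    0 < k M.e00 * k M.e10 * M.ω k v₀ v₁ e := by
  set s := k M.e00 * k M.e10 with hs
  have hsne : s ≠ 0 := mul_ne_zero (hk.ne _) (hk.ne _)
  by_contra hcon
  have hneg : ∀ y, M.Bdd y → s * M.ω k v₀ v₁ y < 0 := by
    intro y hy
    refine M.bdd_connected (fun y => s * M.ω k v₀ v₁ y < 0) ?_ ?_ e y he hy
      (lt_of_le_of_ne (not_lt.1 hcon) (mul_ne_zero hsne (hv.ω_ne_zero hk he)))
    · intro y h1 h2
      have := hv.ω_rB hk h1 h2
      have h3 : 0 < s * M.ω k v₀ v₁ y * (s * M.ω k v₀ v₁ (M.rB y)) := by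
        have : 0 < s ^ 2 := by positivity
        nlinarith
      exact ⟨fun h => (neg_iff_neg_of_mul_pos h3).1 h, fun h => (neg_iff_neg_of_mul_pos h3).2 h⟩
    · intro y h1
      have := hv.ω_φ hk h1
      have h3 : 0 < s * M.ω k v₀ v₁ y * (s * M.ω k v₀ v₁ (M.φ y)) := by
        have : 0 < s ^ 2 := by positivity
        nlinarith
      exact ⟨fun h => (neg_iff_neg_of_mul_pos h3).1 h, fun h => (neg_iff_neg_of_mul_pos h3).2 h⟩
  let slope : E → ℝ := fun y => s * (v₁ (M.wh y) / v₀ (M.wh y))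
  have hx : ∀ y, M.bl y = M.bl M.e00 → 0 < k y * v₀ (M.wh y) := fun y hy => hv.pos0 hk hy
  have hmono : ∀ y, M.bl y = M.bl M.e00 → y ≠ M.e00 → slope (M.rB y) < slope y := by
    intro y hy hne
    have h1 := hneg y ⟨hne, by rintro rfl; exact M.b_ne (hy.symm.trans M.bl_e10.symm)⟩
    have h2 := hx y hy
    have h3 := hx (M.rB y) (by rw [M.bl_rB, hy])
    have h2' := right_ne_zero_of_mul h2.ne'
    have h3' := right_ne_zero_of_mul h3.ne'
    have h4 : s * M.ω k v₀ v₁ y = (k y * v₀ (M.wh y)) * (k (M.rB y) * v₀ (M.wh (M.rB y))) *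
        (slope (M.rB y) - slope y) := by
      simp only [slope, ω]; field_simp
    rw [h4] at h1
    have := neg_of_mul_neg_right h1 (mul_pos h2 h3).le
    linarith
  have hle : slope M.e00 ≤ slope M.e01 := by
    refine M.rB.cycle_induct M.e00 (fun y => slope y ≤ slope M.e01) (by rw [M.rB_e00]) ?_ M.e00
      (Equiv.Perm.SameCycle.refl _ _)
    intro y hy hne h1
    exact (hmono y ((M.rB_cycle _ _).1 hy).symm hne).le.trans h1
  have h00 := hx M.e00 rfl
  have h01 := hx M.e01 M.bl_e00.symm
  have h10 := hv.pos1 hk (e := M.e10) rfl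
  have h11 := hv.pos1 hk (e := M.e11) M.bl_e10.symm
  rw [← M.wh_e00] at h10
  rw [← M.wh_e01] at h11
  have hw0 := right_ne_zero_of_mul h00.ne'
  have hw1 := right_ne_zero_of_mul h01.ne'
  have p1 : 0 < slope M.e00 := by
    have h0 := hk.ne M.e00
    have : slope M.e00 = (k M.e10 * v₁ (M.wh M.e00)) * k M.e00 ^ 2 /
        (k M.e00 * v₀ (M.wh M.e00)) := by
      simp only [slope, hs]; field_simp
    rw [this]; positivity
  have p2 : slope M.e01 < 0 := by
    have h0 := hk.ne M.e01
    have h1 := hk.ne M.e11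
    have : slope M.e01 = (k M.e11 * v₁ (M.wh M.e01)) * (k M.e00 * k M.e01 * (k M.e10 * k M.e11)) /
        ((k M.e01 * v₀ (M.wh M.e01)) * k M.e11 ^ 2) := by
      simp only [slope, hs]; field_simp
    rw [this]
    refine div_neg_of_neg_of_pos (mul_neg_of_pos_of_neg h11 (hv.k_prod_neg hk)) (by positivity)
  linarith

end Inverse

end QMap

/-- The oriented area spanned by two complex numbers. -/
def crs (a b : ℂ) : ℝ := (conj a * b).im

theorem crs_eq (a b : ℂ) : crs a b = a.re * b.im - a.im * b.re := by
  simp [crs, Complex.mul_im]; ring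

theorem crs_self (a : ℂ) : crs a a = 0 := by rw [crs_eq]; ring

theorem crs_swap (a b : ℂ) : crs a b = -crs b a := by rw [crs_eq, crs_eq]; ring

theorem crs_add (a b c : ℂ) : crs a (b + c) = crs a b + crs a c := by
  simp only [crs_eq, Complex.add_re, Complex.add_im]; ring

theorem crs_sub (a b c : ℂ) : crs a (b - c) = crs a b - crs a c := by
  simp only [crs_eq, Complex.sub_re, Complex.sub_im]; ring

theorem crs_neg (a b : ℂ) : crs a (-b) = -crs a b := by
  simp only [crs_eq, Complex.neg_re, Complex.neg_im]; ring

theorem neg_crs (a b : ℂ) : crs (-a) b = -crs a b := by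
  simp only [crs_eq, Complex.neg_re, Complex.neg_im]; ring

theorem crs_smul (a b : ℂ) (t : ℝ) : crs a (t * b) = t * crs a b := by
  simp only [crs_eq, Complex.mul_re, Complex.mul_im, Complex.ofReal_re, Complex.ofReal_im]; ring

theorem crs_mul_left (c a b : ℂ) : crs (c * a) (c * b) = Complex.normSq c * crs a b := by
  simp only [crs_eq, Complex.mul_re, Complex.mul_im, Complex.normSq_apply]; ring

/-! ### Sums of arguments -/

theorem arg_div_upper {p q : ℂ} (hp : 0 < p.im) (hq : 0 < q.im) {m : ℝ} (hm : 0 < m) :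
    Complex.arg (m * (q / p)) = Complex.arg q - Complex.arg p := by
  have hp1 := Complex.arg_nonneg_iff.2 hp.le
  have hq1 := Complex.arg_nonneg_iff.2 hq.le
  have hp2 := Complex.arg_lt_pi_iff.2 (Or.inr hp.ne')
  have hq2 := Complex.arg_lt_pi_iff.2 (Or.inr hq.ne')
  have hp0 : p ≠ 0 := by rintro rfl; simp at hp
  have hq0 : q ≠ 0 := by rintro rfl; simp at hq
  have h : q / p = ((‖q‖ / ‖p‖ : ℝ) : ℂ) * Complex.exp ((Complex.arg q - Complex.arg p : ℝ) * Complex.I) := by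
    conv_lhs => rw [← Complex.norm_mul_exp_arg_mul_I q, ← Complex.norm_mul_exp_arg_mul_I p]
    push_cast
    rw [sub_mul, Complex.exp_sub, mul_div_mul_comm]
  rw [Complex.arg_real_mul _ hm, h, Complex.arg_real_mul _ (by positivity), Complex.exp_mul_I,
    Complex.arg_cos_add_sin_mul_I]
  constructor <;> linarith

theorem arg_neg_div_upper {p q : ℂ} (hp : 0 < p.im) (hq : 0 < q.im) {m : ℝ} (hm : 0 < m)
    (him : 0 < (-(m * (q / p)) : ℂ).im) :
    Complex.arg (-(m * (q / p))) = Complex.arg q - Complex.arg p + Real.pi := by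
  have h := Complex.arg_neg_eq_arg_sub_pi_of_im_pos him
  rw [neg_neg, arg_div_upper hp hq hm] at h
  linarith

namespace QMap

section Angles

set_option linter.unusedSectionVars false

variable {B W E : Type*} {M : QMap B W E} [Fintype B] [Fintype W] [Fintype E]
variable {k : E → ℝ} {η : W → ℤˣ} {v₀ v₁ : W → ℝ}

open scoped Classical

variable (M) in
/-- The sign patterns of all combinations of `v₀`, `v₁` are admissible, and the bounded corners are
positively oriented. -/
structure Conv (k : E → ℝ) (v₀ v₁ : W → ℝ) : Prop where
  adm : ∀ (α β : ℝ) (η : W → ℤˣ), (α ≠ 0 ∨ β ≠ 0) → Compat (fun w => α * v₀ w + β * v₁ w) η →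
    M.Adm k η
  ne_zero : ∀ w, v₁ w ≠ 0 ∨ v₀ w ≠ 0
  ω_pos : ∀ e, M.Bdd e → 0 < M.ω k v₀ v₁ e

theorem Cols.conv (hv : M.Cols k v₀ v₁) (hk : M.Kast k) (h : 0 < k M.e00 * k M.e10) :
    M.Conv k v₀ v₁ where
  adm _ _ _ := hv.adm hk
  ne_zero := hv.ne_zero hk
  ω_pos _ he := pos_of_mul_pos_right (hv.ω_sign hk he) h.le |> fun h => h

theorem Cols.conv_swap (hv : M.Cols k v₀ v₁) (hk : M.Kast k) (h : k M.e00 * k M.e10 < 0) :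
    M.Conv k v₁ v₀ where
  adm α β η h hc := hv.adm hk h.symm (by
    intro u hu
    have h1 : α * v₁ u + β * v₀ u = β * v₀ u + α * v₁ u := add_comm _ _
    exact (hc u (ne_of_eq_of_ne h1 hu)).trans (congrArg sgn h1))
  ne_zero w := (hv.ne_zero hk w).symm
  ω_pos e he := by
    have h1 := hv.ω_sign hk he
    have h2 : M.ω k v₁ v₀ e = -M.ω k v₀ v₁ e := by simp only [ω]; ring
    rw [h2]
    have := neg_of_mul_pos_right h1 h.le
    linarith

/-- The complex function `v₀ + i v₁`. -/
def cplx (v₀ v₁ : W → ℝ) (w : W) : ℂ := v₀ w + v₁ w * Complex.I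

theorem ω_eq_crs (e : E) : M.ω k v₀ v₁ e
    = crs (k e * cplx v₀ v₁ (M.wh e)) (k (M.rB e) * cplx v₀ v₁ (M.wh (M.rB e))) := by
  simp [crs_eq, cplx, ω]; ring

theorem Conv.exists_generic (hC : M.Conv k v₀ v₁) : ∃ t : ℝ, ∀ w, v₀ w + t * v₁ w ≠ 0 := by
  obtain ⟨t, ht⟩ := Infinite.exists_notMem_finset (Finset.univ.image fun w => -v₀ w / v₁ w)
  refine ⟨t, fun w h => ?_⟩
  by_cases h1 : v₁ w = 0
  · rw [h1, mul_zero, add_zero] at h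
    rcases hC.ne_zero w with h2 | h2
    · exact h2 h1
    · exact h2 h
  · exact ht (Finset.mem_image.2 ⟨w, Finset.mem_univ _, by field_simp; linarith⟩)

theorem im_neg_div (a b : ℂ) : (-a / b).im = crs a b / Complex.normSq b := by
  rw [crs_eq, Complex.div_im]; simp only [Complex.neg_im, Complex.neg_re]; ring

theorem Conv.im_pos (hC : M.Conv k v₀ v₁) {e : E} (he : M.Bdd e) :
    0 < (-(k e * cplx v₀ v₁ (M.wh e)) / (k (M.rB e) * cplx v₀ v₁ (M.wh (M.rB e)))).im := by
  have h := hC.ω_pos e he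
  rw [ω_eq_crs] at h
  rw [im_neg_div]
  refine div_pos h (Complex.normSq_pos.2 ?_)
  intro h0
  rw [h0] at h
  simp [crs] at h

theorem Conv.sum_arg (hC : M.Conv k v₀ v₁) (hk : M.Kast k) {e : E} (he : M.Bdd e) :
    ∑ e' with M.φ.SameCycle e e', Complex.arg (-(k e' * cplx v₀ v₁ (M.wh e')) /
      (k (M.rB e') * cplx v₀ v₁ (M.wh (M.rB e')))) = Real.pi := by
  obtain ⟨t, ht⟩ := hC.exists_generic
  let g : W → ℝ := fun w => v₀ w + t * v₁ w
  let η : W → ℤˣ := fun w => sgn (g w)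
  have hg : g = fun w => 1 * v₀ w + t * v₁ w := by simp [g]
  have hη : Compat g η := fun _ _ => rfl
  have had : M.Adm k η := hC.adm 1 t η (Or.inl one_ne_zero) (hg ▸ hη)
  let N : W → ℂ := fun w => g w * (cplx v₀ v₁ w * (t + Complex.I))
  have hN : ∀ w, 0 < (N w).im := by
    intro w
    have : (N w).im = g w * g w := by simp only [N, g, cplx, Complex.mul_im, Complex.mul_re, Complex.add_re, Complex.add_im,
        Complex.ofReal_re, Complex.ofReal_im, Complex.I_re, Complex.I_im]; ring
    rw [this]
    exact mul_self_pos.2 (ht w)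
  have htI : (t + Complex.I : ℂ) ≠ 0 := by
    intro h; have := congrArg Complex.im h; simp at this
  have hbdd : ∀ e', M.φ.SameCycle e e' → M.Bdd e' := fun e' h =>
    M.φ.cycle_induct_of_mem e M.Bdd he (fun y _ hy => M.bdd_φ.2 hy) e' h
  have hterm : ∀ e', M.Bdd e' → Complex.arg (-(k e' * cplx v₀ v₁ (M.wh e')) /
      (k (M.rB e') * cplx v₀ v₁ (M.wh (M.rB e')))) = Complex.arg (N (M.wh e'))
        - Complex.arg (N (M.wh (M.rB e'))) +
        if M.τ k η e' = M.τ k η (M.rB e') then Real.pi else 0 := by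
    intro y hy
    have him := hC.im_pos hy
    have hge := ht (M.wh y)
    have hgr := ht (M.wh (M.rB y))
    change g _ ≠ 0 at hge hgr
    set x := k y * g (M.wh y) with hx
    set z := k (M.rB y) * g (M.wh (M.rB y)) with hz
    have hxne : x ≠ 0 := mul_ne_zero (hk.ne _) hge
    have hzne : z ≠ 0 := mul_ne_zero (hk.ne _) hgr
    have hΦ : cplx v₀ v₁ (M.wh (M.rB y)) ≠ 0 := by
      intro h0; have := hN (M.wh (M.rB y)); simp [N, h0] at this
    have key : -(k y * cplx v₀ v₁ (M.wh y)) / (k (M.rB y) * cplx v₀ v₁ (M.wh (M.rB y)))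
        = -(((k y / g (M.wh y)) / (k (M.rB y) / g (M.wh (M.rB y))) : ℝ) *
          (N (M.wh y) / N (M.wh (M.rB y))) : ℂ) := by
      have h1 : (k (M.rB y) : ℂ) ≠ 0 := Complex.ofReal_ne_zero.2 (hk.ne _)
      have h2 : (g (M.wh y) : ℂ) ≠ 0 := Complex.ofReal_ne_zero.2 hge
      have h3 : (g (M.wh (M.rB y)) : ℂ) ≠ 0 := Complex.ofReal_ne_zero.2 hgr
      simp only [N]
      push_cast
      field_simp
    have hmsign : ((k y / g (M.wh y)) / (k (M.rB y) / g (M.wh (M.rB y))))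
        = (x * z) * (1 / (g (M.wh y) * k (M.rB y)) ^ 2) := by
      have := hk.ne (M.rB y)
      rw [hx, hz]; field_simp
    have hposf : 0 < 1 / (g (M.wh y) * k (M.rB y)) ^ 2 := by
      have := hk.ne (M.rB y)
      positivity
    rw [key] at him ⊢
    have hiff : M.τ k η y = M.τ k η (M.rB y) ↔ 0 < x * z := by
      rw [hη.τ_eq hk hge, hη.τ_eq hk hgr, sgn_eq_sgn_iff hxne hzne]
    simp only [hiff]
    split_ifs with hs
    · exact arg_neg_div_upper (hN _) (hN _) (by rw [hmsign]; positivity) him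
    · have hs' : x * z < 0 := lt_of_le_of_ne (not_lt.1 hs) (mul_ne_zero hxne hzne)
      have h2 := arg_div_upper (hN (M.wh (M.rB y))) (hN (M.wh y))
        (m := -((k y / g (M.wh y)) / (k (M.rB y) / g (M.wh (M.rB y)))))
        (by rw [hmsign, ← neg_mul]; exact mul_pos (by linarith) hposf)
      rw [add_zero, ← h2]
      congr 1
      push_cast
      ring
  rw [Finset.sum_congr rfl fun y hy => hterm y (hbdd y (by simpa using hy)),
    Finset.sum_add_distrib, Finset.sum_sub_distrib]
  have h2 := M.φ.sum_comp_of_invariant (Finset.univ.filter fun e' => M.φ.SameCycle e e')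
    (fun y => by simp [Equiv.Perm.sameCycle_apply_right])
    (fun x => Complex.arg (N (M.wh (M.rB x))))
  simp only [wh_rB_φ] at h2
  rw [h2, sub_self, zero_add, ← Finset.sum_filter, Finset.sum_const, Finset.filter_filter,
    (M.index hk η had).2.1 e he, one_smul]

end Angles

/-! ### Polygons with the outer edges included -/

section Polygon

set_option linter.unusedSectionVars false

variable {B W E : Type*} (M : QMap B W E) [Fintype B] [Fintype W] [Fintype E]

open scoped Classical

/-- The rotation at black vertices, with an outer edge inserted in each outer corner. -/
noncomputable def ρ : Equiv.Perm (E ⊕ Bool) :=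
  Equiv.swap (Sum.inl M.e01) (Sum.inr false) * Equiv.swap (Sum.inl M.e10) (Sum.inr true) *
    Equiv.sumCongr M.rB (Equiv.refl Bool)

theorem ρ_inl {e : E} (he : M.Bdd e) : M.ρ (Sum.inl e) = Sum.inl (M.rB e) := by
  have h1 : M.rB e ≠ M.e01 := fun h => he.1 (M.rB.injective (h.trans M.rB_e00.symm))
  have h2 : M.rB e ≠ M.e10 := fun h => he.2 (M.rB.injective (h.trans M.rB_e11.symm))
  simp [ρ, Equiv.swap_apply_def, h1, h2]

theorem ρ_e00 : M.ρ (Sum.inl M.e00) = Sum.inr false := by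
  have : M.e01 ≠ M.e10 := fun h => M.b_ne (by rw [M.bl_e00, h])
  simp [ρ, Equiv.swap_apply_def, M.rB_e00, this]

theorem ρ_e11 : M.ρ (Sum.inl M.e11) = Sum.inr true := by
  simp [ρ, Equiv.swap_apply_def, M.rB_e11]

theorem ρ_false : M.ρ (Sum.inr false) = Sum.inl M.e01 := by
  simp [ρ, Equiv.swap_apply_def]

theorem ρ_true : M.ρ (Sum.inr true) = Sum.inl M.e10 := by
  have : M.e10 ≠ M.e01 := fun h => M.b_ne (by rw [M.bl_e00, h])
  simp [ρ, Equiv.swap_apply_def, this]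

/-- The black vertex at which a (possibly outer) edge sits. -/
def blx : E ⊕ Bool → B
  | Sum.inl e => M.bl e
  | Sum.inr false => M.bl M.e00
  | Sum.inr true => M.bl M.e10

theorem not_bdd {e : E} (he : ¬ M.Bdd e) : e = M.e00 ∨ e = M.e11 := by
  unfold Bdd at he
  rwa [not_and_or, not_not, not_not] at he

theorem blx_ρ (y : E ⊕ Bool) : M.blx (M.ρ y) = M.blx y := by
  rcases y with e | b
  · by_cases he : M.Bdd e
    · rw [M.ρ_inl he]; exact M.bl_rB e
    · rcases M.not_bdd he with rfl | rfl
      · rw [ρ_e00]; rfl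
      · rw [ρ_e11]; exact M.bl_e10
  · cases b
    · rw [ρ_false]; exact M.bl_e00.symm
    · rw [ρ_true]; rfl

theorem blx_ρ_inv (y : E ⊕ Bool) : M.blx (M.ρ⁻¹ y) = M.blx y := by
  rw [← M.blx_ρ (M.ρ⁻¹ y)]; simp

theorem ρ_induct (p : E ⊕ Bool → Prop) (hp : ∀ y, p y → p (M.ρ y)) {y y' : E ⊕ Bool}
    (h : M.blx y = M.blx y') (hy : p y) : p y' := by
  have hE : ∀ e e', M.bl e = M.bl e' → p (Sum.inl e) → p (Sum.inl e') := by
    intro e e' hb he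
    refine M.rB.cycle_induct_of_mem e (fun e => p (Sum.inl e)) he (fun z _ hz => ?_) e'
      ((M.rB_cycle _ _).2 hb)
    by_cases hbd : M.Bdd z
    · rw [← M.ρ_inl hbd]; exact hp _ hz
    · rcases M.not_bdd hbd with rfl | rfl
      · have := hp _ (hp _ hz)
        rwa [ρ_e00, ρ_false, ← M.rB_e00] at this
      · have := hp _ (hp _ hz)
        rwa [ρ_e11, ρ_true, ← M.rB_e11] at this
  have hl : ∀ y, p y → ∃ e, M.bl e = M.blx y ∧ p (Sum.inl e) := by
    intro y hy
    rcases y with e | b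
    · exact ⟨e, rfl, hy⟩
    · have h1 := hp _ hy
      cases b
      · rw [ρ_false] at h1; exact ⟨_, M.bl_e00.symm, h1⟩
      · rw [ρ_true] at h1; exact ⟨_, rfl, h1⟩
  obtain ⟨e, he, hpe⟩ := hl y hy
  rcases y' with e' | b
  · exact hE e e' (he.trans h) hpe
  · cases b
    · have := hp _ (hE e M.e00 (he.trans h) hpe)
      rwa [ρ_e00] at this
    · have := hp _ (hE e M.e11 (he.trans (h.trans M.bl_e10)) hpe)
      rwa [ρ_e11] at this

variable {M} {k : E → ℝ} {η : W → ℤˣ} {v₀ v₁ : W → ℝ}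

theorem Adm.ext_card_le (hk : M.Kast k) (had : M.Adm k η) {σ : E ⊕ Bool → ℤˣ} {b : B} {e₀ : E}
    {o : Bool} (hb : b = M.bl M.e00 ∨ b = M.bl M.e10)
    (h1 : ∀ e, M.bl e = b → e ≠ e₀ → M.Bdd e) (h2 : ∀ i, M.blx (Sum.inr i) = b → i = o)
    (hσ : ∀ e, M.bl e = b → σ (Sum.inl e) = M.τ k η e) :
    (Finset.univ.filter fun y => M.blx y = b ∧ σ y ≠ σ (M.ρ y)).card ≤ 3 := by
  have hsub : (Finset.univ.filter fun y => M.blx y = b ∧ σ y ≠ σ (M.ρ y)) ⊆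
      insert (Sum.inl e₀) (insert (Sum.inr o) ((Finset.univ.filter fun e => M.bl e = b ∧ M.Bdd e ∧
        M.τ k η e ≠ M.τ k η (M.rB e)).image Sum.inl)) := by
    intro y hy
    obtain ⟨-, hyb, hys⟩ := Finset.mem_filter.1 hy
    rcases y with e | i
    · by_cases he : e = e₀
      · simp [he]
      · have hbd := h1 e hyb he
        rw [M.ρ_inl hbd, hσ e hyb, hσ _ ((M.bl_rB e).trans hyb)] at hys
        simp only [Finset.mem_insert, Finset.mem_image, Finset.mem_filter, Finset.mem_univ,
          true_and]
        exact Or.inr (Or.inr ⟨e, ⟨hyb, hbd, hys⟩, rfl⟩)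
    · simp [h2 i hyb]
  refine (Finset.card_le_card hsub).trans ?_
  have h3 := Finset.card_insert_le (Sum.inl e₀ : E ⊕ Bool) (insert (Sum.inr o)
    ((Finset.univ.filter fun e => M.bl e = b ∧ M.Bdd e ∧
        M.τ k η e ≠ M.τ k η (M.rB e)).image Sum.inl))
  have h4 := Finset.card_insert_le (Sum.inr o : E ⊕ Bool) ((Finset.univ.filter fun e => M.bl e = b ∧ M.Bdd e ∧
        M.τ k η e ≠ M.τ k η (M.rB e)).image (Sum.inl : E → E ⊕ Bool))
  have h5 := Finset.card_image_le (f := (Sum.inl : E → E ⊕ Bool))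
    (s := Finset.univ.filter fun e => M.bl e = b ∧ M.Bdd e ∧ M.τ k η e ≠ M.τ k η (M.rB e))
  have h6 := (M.index hk η had).2.2
  rcases hb with rfl | rfl <;> omega

theorem Adm.ext_rise_unique (hk : M.Kast k) (had : M.Adm k η) {σ : E ⊕ Bool → ℤˣ}
    {y y' : E ⊕ Bool} (hyy : M.blx y' = M.blx y)
    (hσ : ∀ e, M.bl e = M.blx y → σ (Sum.inl e) = M.τ k η e)
    (h1 : σ y = -1) (h2 : σ (M.ρ y) = 1) (h1' : σ y' = -1) (h2' : σ (M.ρ y') = 1) : y = y' := by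
  set b := M.blx y with hb
  by_cases hbd : b = M.bl M.e00 ∨ b = M.bl M.e10
  · have hle : (Finset.univ.filter fun y => M.blx y = b ∧ σ y ≠ σ (M.ρ y)).card ≤ 3 := by
      rcases hbd with h | h
      · refine had.ext_card_le hk (e₀ := M.e00) (o := false) (Or.inl h) ?_ ?_ hσ
        · exact fun e he hne => ⟨hne, fun h' => M.b_ne (by rw [← h, ← he, h', M.bl_e10])⟩
        · intro i hi
          cases i
          · rfl
          · exact absurd (h.symm.trans hi.symm) M.b_ne
      · refine had.ext_card_le hk (e₀ := M.e11) (o := true) (Or.inr h) ?_ ?_ hσ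
        · exact fun e he hne => ⟨fun h' => M.b_ne (by rw [← h, ← he, h']), hne⟩
        · intro i hi
          cases i
          · exact absurd (hi.trans h) M.b_ne
          · rfl
    have hc := M.ρ.card_changes (Finset.univ.filter fun y => M.blx y = b)
      (fun y => by simp [blx_ρ]) σ
    rw [Finset.filter_filter, Finset.filter_filter] at hc
    have hle1 : (Finset.univ.filter fun y => M.blx y = b ∧ σ y = -1 ∧ σ (M.ρ y) = 1).card ≤ 1 := by
      omega
    exact Finset.card_le_one.1 hle1 y (by simp [← hb, h1, h2]) y' (by simp [hyy, h1', h2'])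
  · rw [not_or] at hbd
    have hinl : ∀ y, M.blx y = b → ∃ e, y = Sum.inl e := by
      intro y hy
      rcases y with e | i
      · exact ⟨e, rfl⟩
      · cases i
        · exact absurd hy.symm hbd.1
        · exact absurd hy.symm hbd.2
    obtain ⟨e, rfl⟩ := hinl y hb.symm
    obtain ⟨e', rfl⟩ := hinl y' hyy
    have hbe : M.bl e = b := rfl
    have hbe' : M.bl e' = b := hyy
    rw [M.ρ_inl (M.bl_ne_of_interior (hbe ▸ hbd.1) (hbe ▸ hbd.2)), hσ _ ((M.bl_rB e).trans hbe)] at h2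
    rw [M.ρ_inl (M.bl_ne_of_interior (hbe' ▸ hbd.1) (hbe' ▸ hbd.2)),
      hσ _ ((M.bl_rB e').trans hbe')] at h2'
    rw [hσ _ hbe] at h1
    rw [hσ _ hbe'] at h1'
    rw [had.rise_unique hk (hbe ▸ hbd.1) (hbe ▸ hbd.2) (hbe'.trans hbe.symm) h1 h2 h1' h2']

variable (M) in
/-- The polygons around the black vertices: `p y` is the initial vertex of the side `y`, and
`p (ρ y)` its terminal vertex. -/
structure Poly (k : E → ℝ) (v₀ v₁ : W → ℝ) (c : B → ℂ) (p : E ⊕ Bool → ℂ) : Prop where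
  side : ∀ e, p (M.ρ (Sum.inl e)) - p (Sum.inl e) = c (M.bl e) * (k e * cplx v₀ v₁ (M.wh e))
  corner : ∀ y, 0 < crs (p (M.ρ y) - p y) (p (M.ρ (M.ρ y)) - p (M.ρ y))

theorem Poly.of_corners (hC : M.Conv k v₀ v₁) {c : B → ℂ} (hc : ∀ b, c b ≠ 0) {p : E ⊕ Bool → ℂ}
    (side : ∀ e, p (M.ρ (Sum.inl e)) - p (Sum.inl e) = c (M.bl e) * (k e * cplx v₀ v₁ (M.wh e)))
    (h00 : 0 < crs (p (Sum.inr false) - p (Sum.inl M.e00)) (p (Sum.inl M.e01) - p (Sum.inr false)))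
    (h01 : 0 < crs (p (Sum.inl M.e01) - p (Sum.inr false))
      (p (M.ρ (Sum.inl M.e01)) - p (Sum.inl M.e01)))
    (h11 : 0 < crs (p (Sum.inr true) - p (Sum.inl M.e11)) (p (Sum.inl M.e10) - p (Sum.inr true)))
    (h10 : 0 < crs (p (Sum.inl M.e10) - p (Sum.inr true))
      (p (M.ρ (Sum.inl M.e10)) - p (Sum.inl M.e10))) : M.Poly k v₀ v₁ c p where
  side := side
  corner y := by
    rcases y with e | i
    · by_cases he : M.Bdd e
      · have h1 := side (M.rB e)
        rw [M.bl_rB] at h1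
        rw [side e, M.ρ_inl he, h1, crs_mul_left, ← ω_eq_crs]
        exact mul_pos (Complex.normSq_pos.2 (hc _)) (hC.ω_pos e he)
      · rcases M.not_bdd he with rfl | rfl
        · rw [ρ_e00, ρ_false]; exact h00
        · rw [ρ_e11, ρ_true]; exact h11
    · cases i
      · rw [ρ_false]; exact h01
      · rw [ρ_true]; exact h10

/-- The polygons are strictly convex. -/
theorem Poly.strict_convex {c : B → ℂ} {p : E ⊕ Bool → ℂ} (hP : M.Poly k v₀ v₁ c p)
    (hC : M.Conv k v₀ v₁) (hk : M.Kast k) (hc : ∀ b, c b ≠ 0) {y y' : E ⊕ Bool}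
    (hb : M.blx y' = M.blx y) (h1 : y' ≠ y) (h2 : y' ≠ M.ρ y) :
    0 < crs (p (M.ρ y) - p y) (p y' - p y) := by
  set ζ := p (M.ρ y) - p y with hζ
  let H : E ⊕ Bool → ℝ := fun x => crs ζ (p x - p y)
  let s : E ⊕ Bool → ℝ := fun x => crs ζ (p (M.ρ x) - p x)
  have hHs : ∀ x, H (M.ρ x) = H x + s x := by
    intro x; simp only [H, s]; rw [← crs_add]; congr 1; ring
  have hζ0 : ζ ≠ 0 := by
    intro h
    have := hP.corner y
    rw [← hζ, h] at this
    simp [crs] at this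
  have hHy : H y = 0 := by simp [H, crs]
  have hHρ : H (M.ρ y) = 0 := crs_self ζ
  have hsy : s y = 0 := crs_self ζ
  have hsρ : 0 < s (M.ρ y) := hP.corner y
  have hspre : s (M.ρ⁻¹ y) < 0 := by
    have h3 : M.ρ (M.ρ⁻¹ y) = y := by simp
    have := hP.corner (M.ρ⁻¹ y)
    rw [crs_swap, h3] at this
    simp only [s, h3]
    linarith
  have hfix : ∀ x, M.ρ x ≠ x := by
    intro x hx
    have := hP.corner x
    rw [hx, sub_self] at this
    simp [crs] at this
  by_contra hcon
  let S : Finset (E ⊕ Bool) := Finset.univ.filter fun x => M.blx x = M.blx y ∧ x ≠ y ∧ x ≠ M.ρ y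
  obtain ⟨m, hmS, hmin⟩ := S.exists_min_image H ⟨y', by simp [S, hb, h1, h2]⟩
  have hHm : H m ≤ 0 := (hmin y' (by simp [S, hb, h1, h2])).trans (not_lt.1 hcon)
  obtain ⟨-, hmb, hmy, hmρ⟩ := Finset.mem_filter.1 hmS
  set z := M.ρ⁻¹ m with hz
  have hρz : M.ρ z = m := by simp [hz]
  have hzy : z ≠ y := by intro h; rw [← hρz, h] at hmρ; exact hmρ rfl
  have hzρ : z ≠ M.ρ y := by
    intro h
    have := hHs z
    rw [hρz, h, hHρ] at this
    linarith
  have hzb : M.blx z = M.blx y := by rw [hz, blx_ρ_inv, hmb]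
  have hsz : s z ≤ 0 := by
    have h3 := hmin z (by simp [S, hzb, hzy, hzρ])
    have := hHs z
    rw [hρz] at this
    linarith
  have hsm : 0 ≤ s m := by
    have h3 := hHs m
    by_cases h4 : M.ρ m = y
    · rw [h4, hHy] at h3; linarith
    · have h5 : M.ρ m ≠ M.ρ y := fun h => hmy (M.ρ.injective h)
      have := hmin (M.ρ m) (by simp [S, blx_ρ, hmb, h4, h5])
      linarith
  let σ : E ⊕ Bool → ℤˣ := fun x => if s x ≠ 0 then sgn (s x) else if x = z then -1 else 1
  let g : ℂ := conj ζ * c (M.blx y)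
  have hg : g ≠ 0 := mul_ne_zero ((map_ne_zero _).2 hζ0) (hc _)
  let f : W → ℝ := fun w => g.im * v₀ w + g.re * v₁ w
  have hsf : ∀ e, M.bl e = M.blx y → s (Sum.inl e) = k e * f (M.wh e) := by
    intro e he
    simp only [s, f, hP.side, he, crs]
    have : conj ζ * (c (M.blx y) * (k e * cplx v₀ v₁ (M.wh e)))
      = k e * (g * cplx v₀ v₁ (M.wh e)) := by simp only [g]; ring
    rw [this]
    simp only [cplx, Complex.mul_im, Complex.mul_re, Complex.add_re, Complex.add_im,
      Complex.ofReal_re, Complex.ofReal_im, Complex.I_re, Complex.I_im]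
    ring
  let η : W → ℤˣ := fun w => if h : ∃ e, M.bl e = M.blx y ∧ M.wh e = w then
    want k h.choose (σ (Sum.inl h.choose)) else sgn (f w)
  have hηe : ∀ e, M.bl e = M.blx y → η (M.wh e) = want k e (σ (Sum.inl e)) := by
    intro e he
    have h : ∃ e', M.bl e' = M.blx y ∧ M.wh e' = M.wh e := ⟨e, he, rfl⟩
    have h3 : h.choose = e := M.inj _ _ (h.choose_spec.1.trans he.symm) h.choose_spec.2
    simp only [η]
    rw [dif_pos h, h3]
  have hcomp : Compat f η := by
    intro u hu
    by_cases h : ∃ e, M.bl e = M.blx y ∧ M.wh e = u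
    · obtain ⟨e, he, rfl⟩ := h
      have h3 : s (Sum.inl e) ≠ 0 := by rw [hsf e he]; exact mul_ne_zero (hk.ne _) hu
      rw [hηe e he, want]
      simp only [σ]
      rw [if_pos h3, hsf e he, sgn_mul (hk.ne _) hu, ← mul_assoc, Int.units_mul_self, one_mul]
    · simp only [η]; rw [dif_neg h]
  have had : M.Adm k η := hC.adm g.im g.re η (by
    by_contra! h
    exact hg (Complex.ext h.2 h.1)) hcomp
  have e1 : σ (M.ρ⁻¹ y) = -1 := by
    simp only [σ]; rw [if_pos hspre.ne, sgn_of_neg hspre]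
  have e2 : σ y = 1 := by
    simp only [σ]; rw [if_neg (not_not.2 hsy), if_neg hzy.symm]
  have e3 : σ z = -1 := by
    simp only [σ]
    split_ifs with h
    · exact sgn_of_neg (lt_of_le_of_ne hsz h)
    · rfl
  have e4 : σ m = 1 := by
    simp only [σ]
    split_ifs with h h'
    · exact sgn_of_pos (lt_of_le_of_ne hsm h.symm)
    · exact absurd (hρz.trans h') (hfix z)
    · rfl
  have := had.ext_rise_unique hk (σ := σ) (y := M.ρ⁻¹ y) (y' := z) (by rw [hzb, blx_ρ_inv])
    (fun e he => (τ_of_want (hηe e (by rw [he, blx_ρ_inv]))).symm) e1 (by simpa using e2) e3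
    (by rw [hρz]; exact e4)
  exact hmy (by rw [← hρz, ← this]; simp)

end Polygon

end QMap

/-! ### Plane geometry -/

section Plane

open Filter Topology

theorem crs_add_left (a b c : ℂ) : crs (a + b) c = crs a c + crs b c := by
  simp only [crs_eq, Complex.add_re, Complex.add_im]; ring

theorem smul_crs (a b : ℂ) (t : ℝ) : crs (t * a) b = t * crs a b := by
  simp only [crs_eq, Complex.mul_re, Complex.mul_im, Complex.ofReal_re, Complex.ofReal_im]; ring

theorem crs_mul_I (d : ℂ) : crs d (Complex.I * d) = Complex.normSq d := by
  simp [crs_eq, Complex.normSq_apply]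

theorem continuous_crs (d : ℂ) : Continuous (crs d) := by
  unfold crs; fun_prop

theorem continuous_crs_left (d : ℂ) : Continuous fun z => crs z d := by
  unfold crs; fun_prop

theorem convex_crs_nonneg (d z : ℂ) : Convex ℝ {w | 0 ≤ crs d (w - z)} := by
  intro x hx y hy a b ha hb hab
  have h : crs d (a • x + b • y - z) = a * crs d (x - z) + b * crs d (y - z) := by
    have hb' : b = 1 - a := by linarith
    subst hb'
    simp only [crs_eq, Complex.sub_re, Complex.sub_im, Complex.add_re, Complex.add_im,
      Complex.real_smul, Complex.mul_re, Complex.mul_im, Complex.ofReal_re, Complex.ofReal_im]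
    ring
  show 0 ≤ crs d (a • x + b • y - z)
  rw [h]
  exact add_nonneg (mul_nonneg ha hx) (mul_nonneg hb hy)

/-- Inside a nonempty open set one can avoid finitely many lines. -/
theorem exists_off_lines (F : Finset (ℂ × ℂ)) (hF : ∀ q ∈ F, q.1 ≠ 0) {U : Set ℂ} (hU : IsOpen U)
    (hne : U.Nonempty) : ∃ w ∈ U, ∀ q ∈ F, crs q.1 (w - q.2) ≠ 0 := by
  classical
  induction F using Finset.induction_on generalizing U with
  | empty => obtain ⟨w, hw⟩ := hne; exact ⟨w, hw, by simp⟩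
  | insert q F hq ih =>
    have hcont : Continuous fun w => crs q.1 (w - q.2) :=
      (continuous_crs _).comp (continuous_id.sub continuous_const)
    have hq0 : q.1 ≠ 0 := hF q (Finset.mem_insert_self _ _)
    have hU' : IsOpen (U ∩ {w | crs q.1 (w - q.2) ≠ 0}) :=
      hU.inter (isOpen_ne.preimage hcont)
    obtain ⟨w, hw, h⟩ := ih (fun q hq => hF q (Finset.mem_insert_of_mem hq)) hU' (by
      obtain ⟨w₀, hw₀⟩ := hne
      by_cases h0 : crs q.1 (w₀ - q.2) = 0
      · have hc : Continuous fun t : ℝ => w₀ + t * (Complex.I * q.1) := by fun_prop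
        have h1 : ∀ᶠ t : ℝ in 𝓝[>] 0, w₀ + t * (Complex.I * q.1) ∈ U := by
          refine nhdsWithin_le_nhds (hc.continuousAt.eventually (hU.mem_nhds ?_))
          simpa using hw₀
        obtain ⟨t, ht, ht0⟩ := (h1.and self_mem_nhdsWithin).exists
        refine ⟨_, ht, ?_⟩
        have h2 : w₀ + t * (Complex.I * q.1) - q.2 = (w₀ - q.2) + t * (Complex.I * q.1) := by ring
        change crs _ _ ≠ 0
        rw [h2, crs_add, h0, crs_smul, crs_mul_I, zero_add]
        exact mul_ne_zero (ne_of_gt ht0) (Complex.normSq_pos.2 hq0).ne'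
      · exact ⟨w₀, hw₀, h0⟩)
    refine ⟨w, hw.1, fun q' hq' => ?_⟩
    rcases Finset.mem_insert.1 hq' with rfl | hq'
    · exact hw.2
    · exact h q' hq'

theorem mem_interior_of_triangle {S : Set ℂ} (hS : Convex ℝ S) {x d₁ d₂ y : ℂ} (h0 : x ∈ S)
    (h1 : x + d₁ ∈ S) (h2 : x + d₂ ∈ S) (hd : 0 < crs d₁ d₂) (hy1 : 0 < crs d₁ (y - x))
    (hy2 : 0 < crs (y - x) d₂) (hy3 : crs d₁ (y - x) + crs (y - x) d₂ < crs d₁ d₂) :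
    y ∈ interior S := by
  let U : Set ℂ := {y | 0 < crs d₁ (y - x) ∧ 0 < crs (y - x) d₂ ∧
    crs d₁ (y - x) + crs (y - x) d₂ < crs d₁ d₂}
  have hc1 : Continuous fun y => crs d₁ (y - x) :=
    (continuous_crs _).comp (continuous_id.sub continuous_const)
  have hc2 : Continuous fun y => crs (y - x) d₂ :=
    (continuous_crs_left _).comp (continuous_id.sub continuous_const)
  have hU : IsOpen U := (isOpen_lt continuous_const hc1).inter
    ((isOpen_lt continuous_const hc2).inter (isOpen_lt (hc1.add hc2) continuous_const))
  refine interior_maximal ?_ hU ⟨hy1, hy2, hy3⟩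
  rintro y ⟨h3, h4, h5⟩
  set Δ := crs d₁ d₂ with hΔ
  set α := crs (y - x) d₂ / Δ with hα
  set β := crs d₁ (y - x) / Δ with hβ
  have hα0 : 0 < α := div_pos h4 hd
  have hβ0 : 0 < β := div_pos h3 hd
  have hαβ : α + β < 1 := by rw [hα, hβ, ← add_div, div_lt_one hd]; linarith
  have hyx : y - x = α * d₁ + β * d₂ := by
    have hne : Δ ≠ 0 := hd.ne'
    have hα1 : α * Δ = crs (y - x) d₂ := div_mul_cancel₀ _ hne
    have hβ1 : β * Δ = crs d₁ (y - x) := div_mul_cancel₀ _ hne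
    rw [hΔ, crs_eq] at hα1 hβ1
    rw [crs_eq] at hα1 hβ1
    rw [hΔ, crs_eq] at hne
    apply Complex.ext
    · apply mul_right_cancel₀ hne
      simp only [Complex.add_re, Complex.mul_re, Complex.ofReal_re, Complex.ofReal_im]
      linear_combination -hα1 * d₁.re - hβ1 * d₂.re
    · apply mul_right_cancel₀ hne
      simp only [Complex.add_im, Complex.mul_im, Complex.ofReal_re, Complex.ofReal_im]
      linear_combination -hα1 * d₁.im - hβ1 * d₂.im
  have h6 : y = (1 - α - β) • x + α • (x + d₁) + β • (x + d₂) := by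
    simp only [Complex.real_smul]
    push_cast
    linear_combination hyx
  rw [h6]
  have h7 := hS.sum_mem (t := Finset.univ) (w := ![1 - α - β, α, β]) (z := ![x, x + d₁, x + d₂])
    (by intro i _; fin_cases i <;> simp <;> linarith) (by simp [Fin.sum_univ_three]; ring)
    (by intro i _; fin_cases i <;> simp only [] <;> assumption)
  rw [Fin.sum_univ_three] at h7
  exact h7

theorem eventually_corner {S : Set ℂ} (hS : Convex ℝ S) {x d₁ d₂ δ : ℂ} (h0 : x ∈ S)
    (h1 : x + d₁ ∈ S) (h2 : x + d₂ ∈ S) (hd : 0 < crs d₁ d₂) (hδ1 : 0 < crs d₁ δ)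
    (hδ2 : 0 < crs δ d₂) : ∀ᶠ t : ℝ in 𝓝[>] 0, x + t * δ ∈ interior S := by
  have hc : Continuous fun t : ℝ => t * crs d₁ δ + t * crs δ d₂ := by fun_prop
  have h3 : ∀ᶠ t : ℝ in 𝓝[>] 0, t * crs d₁ δ + t * crs δ d₂ < crs d₁ d₂ :=
    nhdsWithin_le_nhds ((hc.tendsto 0).eventually (gt_mem_nhds (by simpa using hd)))
  filter_upwards [h3, self_mem_nhdsWithin] with t ht ht0
  have ht0' : 0 < t := ht0
  refine mem_interior_of_triangle hS h0 h1 h2 hd ?_ ?_ ?_ <;> rw [add_sub_cancel_left]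
  · rw [crs_smul]; positivity
  · rw [smul_crs]; positivity
  · rw [crs_smul, smul_crs]; exact ht

theorem eventually_side {S : Set ℂ} (hS : Convex ℝ S) {x d₁ d₂ δ : ℂ} (h0 : x ∈ S)
    (h1 : x + d₁ ∈ S) (h2 : x + d₂ ∈ S) (hd : 0 < crs d₁ d₂) {l : ℝ} (hl0 : 0 < l) (hl1 : l < 1)
    (hδ : 0 < crs d₁ δ) : ∀ᶠ t : ℝ in 𝓝[>] 0, x + l * d₁ + t * δ ∈ interior S := by
  have hc : Continuous fun t : ℝ => l * crs d₁ d₂ + t * crs δ d₂ := by fun_prop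
  have hc' : Continuous fun t : ℝ => t * crs d₁ δ + (l * crs d₁ d₂ + t * crs δ d₂) := by fun_prop
  have h3 : ∀ᶠ t : ℝ in 𝓝[>] 0, 0 < l * crs d₁ d₂ + t * crs δ d₂ :=
    nhdsWithin_le_nhds ((hc.tendsto 0).eventually (lt_mem_nhds (by simp; positivity)))
  have h4 : ∀ᶠ t : ℝ in 𝓝[>] 0, t * crs d₁ δ + (l * crs d₁ d₂ + t * crs δ d₂) < crs d₁ d₂ :=
    nhdsWithin_le_nhds ((hc'.tendsto 0).eventually (gt_mem_nhds (by
      simp only [zero_mul, add_zero, zero_add]; nlinarith)))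
  filter_upwards [h3, h4, self_mem_nhdsWithin] with t ht3 ht4 ht0
  have ht0' : 0 < t := ht0
  have e1 : x + l * d₁ + t * δ - x = l * d₁ + t * δ := by ring
  have e2 : crs d₁ (l * d₁ + t * δ) = t * crs d₁ δ := by
    rw [crs_add, crs_smul, crs_smul, crs_self]; ring
  have e3 : crs (l * d₁ + t * δ) d₂ = l * crs d₁ d₂ + t * crs δ d₂ := by
    rw [crs_add_left, smul_crs, smul_crs]
  refine mem_interior_of_triangle hS h0 h1 h2 hd ?_ ?_ ?_ <;> rw [e1]
  · rw [e2]; positivity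
  · rw [e3]; exact ht3
  · rw [e2, e3]; exact ht4

theorem crs_pos_of_mem_interior {S : Set ℂ} {d x z : ℂ} (hd : d ≠ 0)
    (hS : ∀ w ∈ S, 0 ≤ crs d (w - x)) (hz : z ∈ interior S) : 0 < crs d (z - x) := by
  have hc : Continuous fun t : ℝ => z - t * (Complex.I * d) := by fun_prop
  have h1 : ∀ᶠ t : ℝ in 𝓝[>] 0, z - t * (Complex.I * d) ∈ interior S :=
    nhdsWithin_le_nhds (hc.continuousAt.eventually (isOpen_interior.mem_nhds (by simpa using hz)))
  obtain ⟨t, ht, ht0⟩ := (h1.and self_mem_nhdsWithin).exists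
  have h2 := hS _ (interior_subset ht)
  have h3 : z - t * (Complex.I * d) - x = (z - x) - t * (Complex.I * d) := by ring
  rw [h3, crs_sub, crs_smul, crs_mul_I] at h2
  have : 0 < t * Complex.normSq d := mul_pos ht0 (Complex.normSq_pos.2 hd)
  linarith

theorem arg_lt_of_crs {u v : ℂ} (hu : u.im ≠ 0) (hv : v.im ≠ 0) (h : 0 < crs u v)
    (hn : ¬ (0 < u.im ∧ v.im < 0)) : Complex.arg u < Complex.arg v := by
  have key : ∀ u v : ℂ, 0 < u.im → 0 < v.im → 0 < crs u v → Complex.arg u < Complex.arg v := by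
    intro u v hu hv h
    have h1 := arg_div_upper hu hv one_pos
    have h2 : 0 < (v / u).im := by
      have hu0 : u ≠ 0 := by rintro rfl; simp at hu
      have : (v / u).im = crs u v / Complex.normSq u := by
        rw [crs_eq, Complex.div_im]; ring
      rw [this]
      exact div_pos h (Complex.normSq_pos.2 hu0)
    have h3 : 0 ≤ Complex.arg (v / u) := Complex.arg_nonneg_iff.2 h2.le
    have h4 : Complex.arg (v / u) ≠ 0 := by
      intro h0
      rw [Complex.arg_eq_zero_iff] at h0
      exact h2.ne' h0.2
    have h5 := lt_of_le_of_ne h3 h4.symm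
    rw [Complex.ofReal_one, one_mul] at h1
    linarith
  rcases lt_or_gt_of_ne hu with hu' | hu' <;> rcases lt_or_gt_of_ne hv with hv' | hv'
  · have h1 := key (-u) (-v) (by simpa using hu') (by simpa using hv')
      (by rw [neg_crs, crs_neg, neg_neg]; exact h)
    rw [Complex.arg_neg_eq_arg_add_pi_of_im_neg hu', Complex.arg_neg_eq_arg_add_pi_of_im_neg hv']
      at h1
    linarith
  · exact (Complex.arg_neg_iff.2 hu').trans_le (Complex.arg_nonneg_iff.2 hv'.le)
  · exact absurd ⟨hu', hv'⟩ hn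
  · exact key u v hu' hv' h

theorem arg_lt_of_not_sector {d d' δ : ℂ} (h : 0 < crs d d') (h1 : crs d δ ≠ 0)
    (h2 : crs d' δ ≠ 0) (hn : ¬ (0 < crs d δ ∧ 0 < crs δ d')) :
    Complex.arg (-d / δ) < Complex.arg (-d' / δ) := by
  have hδ : δ ≠ 0 := by rintro rfl; simp [crs] at h1
  have hN := Complex.normSq_pos.2 hδ
  have e1 : (-d / δ).im = crs d δ / Complex.normSq δ := QMap.im_neg_div d δ
  have e2 : (-d' / δ).im = crs d' δ / Complex.normSq δ := QMap.im_neg_div d' δ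
  have e3 : crs d d' = Complex.normSq δ * crs (-d / δ) (-d' / δ) := by
    rw [← crs_mul_left, mul_div_cancel₀ _ hδ, mul_div_cancel₀ _ hδ, neg_crs, crs_neg, neg_neg]
  refine arg_lt_of_crs ?_ ?_ (pos_of_mul_pos_right (e3 ▸ h) hN.le) ?_
  · rw [e1]; exact div_ne_zero h1 hN.ne'
  · rw [e2]; exact div_ne_zero h2 hN.ne'
  · rintro ⟨h3, h4⟩
    rw [e1] at h3
    rw [e2] at h4
    refine hn ⟨(div_pos_iff_of_pos_right hN).1 h3, ?_⟩
    rw [crs_swap]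
    have := neg_of_div_neg_left h4 hN.le
    linarith

end Plane

/-! ### Tilings of a rhombus by convex polygons -/

/-- The signed crossing of the segment from `a` to `b` with the horizontal ray from `z` to the
right. -/
noncomputable def crossing (z a b : ℂ) : ℤ :=
  if a.im < z.im ∧ z.im < b.im ∧ 0 < crs (b - a) (z - a) then 1
  else if b.im < z.im ∧ z.im < a.im ∧ 0 < crs (a - b) (z - b) then -1 else 0

theorem crossing_swap (z a b : ℂ) : crossing z b a = -crossing z a b := by
  unfold crossing
  split_ifs with h1 h2 h2 <;> try simp
  exact absurd (h1.1.trans h1.2.1) (not_lt.2 (h2.1.trans h2.2.1).le)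

/-- The vertices of the rhombus. -/
noncomputable def rhombus (a s : ℝ) : Fin 4 → ℂ :=
  ![0, (a - Complex.I) * s, 2 * a * s, (a + Complex.I) * s]

/-- A finite family of strictly convex polygons, with sides `p y`, `p (ρ y)`, whose boundary is that
of a rhombus. -/
structure Tiling {Y I : Type*} [Fintype Y] (ρ : Equiv.Perm Y) (c : Y → I) (p : Y → ℂ) (a s : ℝ) :
    Prop where
  a_pos : 0 < a
  s_pos : 0 < s
  c_ρ : ∀ y, c (ρ y) = c y
  induct : ∀ P : Y → Prop, (∀ y, P y → P (ρ y)) → ∀ y y', c y = c y' → P y → P y'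
  convex : ∀ y y', c y' = c y → y' ≠ y → y' ≠ ρ y → 0 < crs (p (ρ y) - p y) (p y' - p y)
  corner : ∀ y, 0 < crs (p (ρ y) - p y) (p (ρ (ρ y)) - p (ρ y))
  bdry : ∀ g : ℂ → ℂ → ℤ, (∀ x y, g y x = -g x y) →
    ∑ y, g (p y) (p (ρ y)) = ∑ k : Fin 4, g (rhombus a s k) (rhombus a s (k + 1))

namespace Tiling

set_option linter.unusedSectionVars false

open Filter Topology

variable {Y I : Type*} [Fintype Y] [Fintype I] {ρ : Equiv.Perm Y} {c : Y → I} {p : Y → ℂ} {a s : ℝ}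

open scoped Classical

/-- The tile with index `i`. -/
def hull (c : Y → I) (p : Y → ℂ) (i : I) : Set ℂ := convexHull ℝ (p '' {y | c y = i})

theorem convex_hull (i : I) : Convex ℝ (hull c p i) := convex_convexHull _ _

theorem mem_hull (y : Y) : p y ∈ hull c p (c y) := subset_convexHull _ _ ⟨y, rfl, rfl⟩

theorem mem_hull' {y : Y} {i : I} (h : c y = i) : p y ∈ hull c p i := h ▸ mem_hull y

theorem side_ne (hT : Tiling ρ c p a s) (y : Y) : p (ρ y) - p y ≠ 0 := by
  intro h
  have := hT.corner y
  rw [h] at this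
  simp [crs] at this

theorem weak_convex (hT : Tiling ρ c p a s) {y y' : Y} (h : c y' = c y) :
    0 ≤ crs (p (ρ y) - p y) (p y' - p y) := by
  by_cases h1 : y' = y
  · simp [h1, crs]
  by_cases h2 : y' = ρ y
  · rw [h2, crs_self]
  exact (hT.convex y y' h h1 h2).le

theorem hull_left (hT : Tiling ρ c p a s) {y : Y} {z : ℂ} (hz : z ∈ hull c p (c y)) :
    0 ≤ crs (p (ρ y) - p y) (z - p y) := by
  refine convexHull_min ?_ (convex_crs_nonneg (p (ρ y) - p y) (p y)) hz
  rintro _ ⟨y', hy', rfl⟩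
  exact hT.weak_convex hy'

theorem interior_left (hT : Tiling ρ c p a s) {y : Y} {z : ℂ} (hz : z ∈ interior (hull c p (c y))) :
    0 < crs (p (ρ y) - p y) (z - p y) :=
  crs_pos_of_mem_interior (hT.side_ne y) (fun _ hw => hT.hull_left hw) hz

theorem p_injOn (hT : Tiling ρ c p a s) {y y' : Y} (h : c y' = c y) (hp : p y' = p y) : y' = y := by
  by_contra hne
  by_cases h2 : y' = ρ y
  · exact hT.side_ne y (by rw [← h2, hp, sub_self])
  · have := hT.convex y y' h hne h2
    rw [hp, sub_self] at this
    simp [crs] at this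

/-- A point in the interior of a side of a tile lies on no other side of this tile. -/
theorem side_unique (hT : Tiling ρ c p a s) {y y' : Y} (h : c y' = c y) {z : ℂ}
    (hz : z ∈ openSegment ℝ (p y) (p (ρ y))) (hz' : z ∈ segment ℝ (p y') (p (ρ y'))) : y' = y := by
  by_contra hne
  have hd := sub_ne_zero.1 (hT.side_ne y)
  have hzl : z ≠ p y := by rintro rfl; exact hd (left_mem_openSegment_iff.1 hz).symm
  have hzr : z ≠ p (ρ y) := by rintro rfl; exact hd (right_mem_openSegment_iff.1 hz).symm
  have h4 : crs (p (ρ y) - p y) (z - p y) = 0 := by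
    obtain ⟨l₁, l, -, -, hl, rfl⟩ := hz
    have : l₁ • p y + l • p (ρ y) - p y = l * (p (ρ y) - p y) := by
      rw [← eq_sub_iff_add_eq] at hl
      rw [hl, Complex.real_smul, Complex.real_smul]; push_cast; ring
    rw [this, crs_smul, crs_self, mul_zero]
  obtain ⟨l₁, l₂, h1, h2, hl, rfl⟩ := hz'
  have h5 : l₁ • p y' + l₂ • p (ρ y') - p y = l₁ * (p y' - p y) + l₂ * (p (ρ y') - p y) := by
    rw [← eq_sub_iff_add_eq] at hl
    rw [hl, Complex.real_smul, Complex.real_smul]; push_cast; ring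
  rw [h5, crs_add, crs_smul, crs_smul] at h4
  have h6 := hT.weak_convex h
  have h7 := hT.weak_convex ((hT.c_ρ y').trans h)
  have h8 : l₁ = 0 ∨ y' = ρ y := by
    by_contra! hcon
    have := mul_pos (lt_of_le_of_ne h1 hcon.1.symm) (hT.convex y y' h hne hcon.2)
    linarith [mul_nonneg h2 h7]
  have h9 : l₂ = 0 ∨ ρ y' = y := by
    by_contra! hcon
    have := mul_pos (lt_of_le_of_ne h2 hcon.1.symm)
      (hT.convex y (ρ y') ((hT.c_ρ y').trans h) hcon.2 fun h' => hne (ρ.injective h'))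
    linarith [mul_nonneg h1 h6]
  rcases h8 with rfl | h8
  · obtain rfl : l₂ = 1 := by linarith
    rcases h9 with h9 | h9
    · exact one_ne_zero h9
    · rw [h9] at hzl; simp at hzl
  rcases h9 with rfl | h9
  · obtain rfl : l₁ = 1 := by linarith
    rw [h8] at hzr; simp at hzr
  have := hT.corner y
  rw [← h8, h9, h8, ← neg_sub (p (ρ y)), crs_neg, crs_self] at this
  simp at this

theorem crossing_sum_eq (ρ : Equiv.Perm Y) (c : Y → I) (p : Y → ℂ) (i : I) (z : ℂ) :
    ∑ y with c y = i, crossing z (p y) (p (ρ y)) =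
    ((Finset.univ.filter fun y => c y = i ∧ (p y).im < z.im ∧ z.im < (p (ρ y)).im ∧
      0 < crs (p (ρ y) - p y) (z - p y)).card : ℤ) -
    ((Finset.univ.filter fun y => c y = i ∧ (p (ρ y)).im < z.im ∧ z.im < (p y).im ∧
      0 < crs (p y - p (ρ y)) (z - p (ρ y))).card : ℤ) := by
  rw [Finset.card_filter, Finset.card_filter]
  push_cast
  rw [Finset.sum_filter, ← Finset.sum_sub_distrib]
  refine Finset.sum_congr rfl fun y _ => ?_
  by_cases h : c y = i
  · simp only [h, true_and, if_true, crossing]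
    split_ifs with h1 h2 h2 <;> try simp
    exact absurd (h1.1.trans h1.2.1) (not_lt.2 (h2.1.trans h2.2.1).le)
  · simp [h]

theorem card_up_eq_card_down (hT : Tiling ρ c p a s) {z : ℂ} (hz : ∀ y, (p y).im ≠ z.im) (i : I) :
    (Finset.univ.filter fun y => c y = i ∧ (p y).im < z.im ∧ z.im < (p (ρ y)).im).card =
    (Finset.univ.filter fun y => c y = i ∧ (p (ρ y)).im < z.im ∧ z.im < (p y).im).card := by
  have h := ρ.sum_comp_of_invariant (Finset.univ.filter fun y => c y = i)
    (fun y => by simp [hT.c_ρ]) (fun y => if z.im < (p y).im then (1 : ℤ) else 0)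
  have h1 : ∀ y, (if z.im < (p (ρ y)).im then (1 : ℤ) else 0) - (if z.im < (p y).im then 1 else 0)
      = (if (p y).im < z.im ∧ z.im < (p (ρ y)).im then 1 else 0) -
        (if (p (ρ y)).im < z.im ∧ z.im < (p y).im then 1 else 0) := by
    intro y
    rcases lt_or_gt_of_ne (hz y) with h1 | h1 <;> rcases lt_or_gt_of_ne (hz (ρ y)) with h2 | h2 <;>
      simp [h1, h2, h1.not_gt, h2.not_gt]
  rw [← sub_eq_zero, ← Finset.sum_sub_distrib, Finset.sum_congr rfl fun y _ => h1 y,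
    Finset.sum_sub_distrib, sub_eq_zero, Finset.sum_boole, Finset.sum_boole, Finset.filter_filter,
    Finset.filter_filter] at h
  exact_mod_cast h

theorem crossing_sum_nonneg (hT : Tiling ρ c p a s) {z : ℂ} (hz : ∀ y, (p y).im ≠ z.im) (i : I) :
    0 ≤ ∑ y with c y = i, crossing z (p y) (p (ρ y)) := by
  rw [crossing_sum_eq]
  by_cases hD : ∃ y, c y = i ∧ (p (ρ y)).im < z.im ∧ z.im < (p y).im ∧
      0 < crs (p y - p (ρ y)) (z - p (ρ y))
  · obtain ⟨y, hy, hy1, hy2, hy3⟩ := hD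
    have hU : ∀ x, c x = i → (p x).im < z.im → z.im < (p (ρ x)).im →
        0 < crs (p (ρ x) - p x) (z - p x) := by
      intro x hx hx1 hx2
      set l := (z.im - (p (ρ y)).im) / ((p y).im - (p (ρ y)).im) with hl
      have hden : 0 < (p y).im - (p (ρ y)).im := by linarith
      have hl0 : 0 ≤ l := div_nonneg (by linarith) hden.le
      have hl1 : l ≤ 1 := (div_le_one hden).2 (by linarith)
      set q := (1 - l) • p (ρ y) + l • p y with hq
      have hqim : q.im = z.im := by
        simp only [hq, Complex.add_im, Complex.real_smul, Complex.mul_im, Complex.ofReal_re,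
          Complex.ofReal_im]
        have : l * ((p y).im - (p (ρ y)).im) = z.im - (p (ρ y)).im := div_mul_cancel₀ _ hden.ne'
        linarith
      have hqh : q ∈ hull c p (c x) := convex_hull _ (mem_hull' (by rw [hT.c_ρ, hy, hx]))
        (mem_hull' (by rw [hy, hx])) (by linarith) hl0 (by ring)
      have h1 := hT.hull_left hqh
      have h2 : crs (p y - p (ρ y)) (q - p (ρ y)) = 0 := by
        have : q - p (ρ y) = l * (p y - p (ρ y)) := by
          simp only [hq, Complex.real_smul]; push_cast; ring
        rw [this, crs_smul, crs_self, mul_zero]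
      have h3 : ∀ d e : ℂ, crs d (z - e) = crs d (q - e) - d.im * (z.re - q.re) := by
        intro d e
        simp only [crs_eq, Complex.sub_re, Complex.sub_im, hqim]; ring
      rw [h3, h2, Complex.sub_im] at hy3
      have h4 : z.re - q.re < 0 := by
        by_contra hcon
        have := mul_nonneg hden.le (not_lt.1 hcon)
        linarith
      rw [h3]
      have h5 : 0 < (p (ρ x) - p x).im := by rw [Complex.sub_im]; linarith
      have := mul_neg_of_pos_of_neg h5 h4
      linarith
    have e1 : (Finset.univ.filter fun y => c y = i ∧ (p y).im < z.im ∧ z.im < (p (ρ y)).im ∧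
      0 < crs (p (ρ y) - p y) (z - p y)) =
      (Finset.univ.filter fun y => c y = i ∧ (p y).im < z.im ∧ z.im < (p (ρ y)).im) :=
      Finset.filter_congr fun x _ => ⟨fun h => ⟨h.1, h.2.1, h.2.2.1⟩,
        fun h => ⟨h.1, h.2.1, h.2.2, hU x h.1 h.2.1 h.2.2⟩⟩
    rw [e1, hT.card_up_eq_card_down hz, sub_nonneg, Nat.cast_le]
    refine Finset.card_le_card fun x hx => ?_
    simp only [Finset.mem_filter, Finset.mem_univ, true_and] at hx ⊢
    exact ⟨hx.1, hx.2.1, hx.2.2.1⟩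
  · have : (Finset.univ.filter fun y => c y = i ∧ (p (ρ y)).im < z.im ∧ z.im < (p y).im ∧
      0 < crs (p y - p (ρ y)) (z - p (ρ y))) = ∅ :=
      Finset.filter_eq_empty_iff.2 fun y _ h => hD ⟨y, h⟩
    rw [this]; simp

theorem crossing_sum_pos (hT : Tiling ρ c p a s) {z : ℂ} (hz : ∀ y, (p y).im ≠ z.im) {i : I}
    (hi : z ∈ interior (hull c p i)) : 1 ≤ ∑ y with c y = i, crossing z (p y) (p (ρ y)) := by
  rw [crossing_sum_eq]
  have hleft : ∀ y, c y = i → 0 < crs (p (ρ y) - p y) (z - p y) := by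
    rintro y rfl; exact hT.interior_left hi
  have hD : (Finset.univ.filter fun y => c y = i ∧ (p (ρ y)).im < z.im ∧ z.im < (p y).im ∧
      0 < crs (p y - p (ρ y)) (z - p (ρ y))) = ∅ := by
    refine Finset.filter_eq_empty_iff.2 fun y _ h => ?_
    have h1 := hleft y h.1
    have h2 := h.2.2.2
    have h3 : crs (p y - p (ρ y)) (z - p (ρ y)) = -crs (p (ρ y) - p y) (z - p y) := by
      simp only [crs_eq, Complex.sub_re, Complex.sub_im]; ring
    linarith
  have hU : ∃ y, c y = i ∧ (p y).im < z.im ∧ z.im < (p (ρ y)).im := by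
    by_contra! hU
    have hzh : z ∈ hull c p i := interior_subset hi
    have hdown : (Finset.univ.filter fun y => c y = i ∧ (p (ρ y)).im < z.im ∧ z.im < (p y).im).card
        = 0 := by
      rw [← hT.card_up_eq_card_down hz, Finset.card_eq_zero]
      exact Finset.filter_eq_empty_iff.2 fun y _ h => absurd h.2.2 (not_lt.2 (hU y h.1 h.2.1))
    by_cases hA : ∃ y, c y = i ∧ (p y).im < z.im
    · obtain ⟨y, hy, hy1⟩ := hA
      have hall : ∀ y', c y' = i → (p y').im < z.im := by
        intro y' hy'
        refine (hT.induct (fun y => c y = i ∧ (p y).im < z.im) ?_ y y' (hy.trans hy'.symm)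
          ⟨hy, hy1⟩).2
        rintro x ⟨hx, hx1⟩
        exact ⟨(hT.c_ρ x).trans hx, lt_of_le_of_ne (hU x hx hx1) (hz _)⟩
      have : hull c p i ⊆ {w | w.im < z.im} := by
        refine convexHull_min ?_ (convex_halfSpace_im_lt _)
        rintro _ ⟨y', hy', rfl⟩
        exact hall y' hy'
      exact lt_irrefl z.im (this hzh)
    · have : hull c p i ⊆ {w | z.im < w.im} := by
        refine convexHull_min ?_ (convex_halfSpace_im_gt _)
        rintro _ ⟨y', hy', rfl⟩
        rcases lt_or_gt_of_ne (hz y') with h | h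
        · exact absurd ⟨y', hy', h⟩ hA
        · exact h
      exact lt_irrefl z.im (this hzh)
  obtain ⟨y, hy, hy1, hy2⟩ := hU
  rw [hD, Finset.card_empty, Nat.cast_zero, sub_zero]
  have : 0 < (Finset.univ.filter fun y => c y = i ∧ (p y).im < z.im ∧ z.im < (p (ρ y)).im ∧
      0 < crs (p (ρ y) - p y) (z - p y)).card :=
    Finset.card_pos.2 ⟨y, by simp [hy, hy1, hy2, hleft y hy]⟩
  exact_mod_cast this

/-- The closed rhombus. -/
def closedRhombus (a s : ℝ) : Set ℂ :=
  {z | ∀ k : Fin 4, 0 ≤ crs (rhombus a s (k + 1) - rhombus a s k) (z - rhombus a s k)}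

theorem isClosed_closedRhombus : IsClosed (closedRhombus a s) := by
  have : closedRhombus a s
    = ⋂ k : Fin 4, {z | 0 ≤ crs (rhombus a s (k + 1) - rhombus a s k) (z - rhombus a s k)} := by
    ext; simp [closedRhombus]
  rw [this]
  exact isClosed_iInter fun k => isClosed_le continuous_const
    ((continuous_crs _).comp (continuous_id.sub continuous_const))

theorem mem_closedRhombus (hs : 0 < s) {z : ℂ} : z ∈ closedRhombus a s ↔
    0 ≤ a * z.im + z.re ∧ 0 ≤ a * z.im + 2 * a * s - z.re ∧ 0 ≤ -(a * z.im) + 2 * a * s - z.re ∧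
      0 ≤ -(a * z.im) + z.re := by
  have h : ∀ x : ℝ, 0 ≤ s * x ↔ 0 ≤ x := fun x => mul_nonneg_iff_of_pos_left hs
  rw [← h (a * z.im + z.re), ← h (a * z.im + 2 * a * s - z.re),
    ← h (-(a * z.im) + 2 * a * s - z.re), ← h (-(a * z.im) + z.re)]
  have e0 : crs (rhombus a s 1 - rhombus a s 0) (z - rhombus a s 0) = s * (a * z.im + z.re) := by
    simp [crs_eq, rhombus]; ring
  have e1 : crs (rhombus a s 2 - rhombus a s 1) (z - rhombus a s 1)
      = s * (a * z.im + 2 * a * s - z.re) := by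
    simp [crs_eq, rhombus]; ring
  have e2 : crs (rhombus a s 3 - rhombus a s 2) (z - rhombus a s 2)
      = s * (-(a * z.im) + 2 * a * s - z.re) := by
    simp [crs_eq, rhombus]; ring
  have e3 : crs (rhombus a s 0 - rhombus a s 3) (z - rhombus a s 3)
      = s * (-(a * z.im) + z.re) := by
    simp [crs_eq, rhombus]; ring
  rw [← e0, ← e1, ← e2, ← e3]
  constructor
  · intro h; exact ⟨h 0, h 1, h 2, h 3⟩
  · rintro ⟨h0, h1, h2, h3⟩ k
    fin_cases k
    · exact h0
    · exact h1
    · exact h2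
    · exact h3

theorem rhombus_crossing (ha : 0 < a) (hs : 0 < s) (z : ℂ) :
    ∑ k : Fin 4, crossing z (rhombus a s k) (rhombus a s (k + 1)) ≤ 1 ∧
    (1 ≤ ∑ k : Fin 4, crossing z (rhombus a s k) (rhombus a s (k + 1)) →
      z ∈ closedRhombus a s) := by
  rw [Fin.sum_univ_four]
  have h1 : crossing z (rhombus a s 0) (rhombus a s (0 + 1)) =
      if -s < z.im ∧ z.im < 0 ∧ 0 < -s * (a * z.im + z.re) then -1 else 0 := by
    have e : crs (rhombus a s 0 - rhombus a s 1) (z - rhombus a s 1) = -s * (a * z.im + z.re) := by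
      simp [crs_eq, rhombus]; ring
    change crossing z (rhombus a s 0) (rhombus a s 1) = _
    have i0 : (rhombus a s 0).im = 0 := by simp [rhombus]
    have i1 : (rhombus a s 1).im = -s := by simp [rhombus]
    rw [crossing, e, i0, i1, if_neg]
    rintro ⟨x, y, -⟩; linarith
  have h2 : crossing z (rhombus a s 1) (rhombus a s (1 + 1)) =
      if -s < z.im ∧ z.im < 0 ∧ 0 < s * (a * z.im + 2 * a * s - z.re) then 1 else 0 := by
    have e : crs (rhombus a s 2 - rhombus a s 1) (z - rhombus a s 1)
        = s * (a * z.im + 2 * a * s - z.re) := by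
      simp [crs_eq, rhombus]; ring
    change crossing z (rhombus a s 1) (rhombus a s 2) = _
    have i0 : (rhombus a s 2).im = 0 := by simp [rhombus]
    have i1 : (rhombus a s 1).im = -s := by simp [rhombus]
    rw [crossing, e, i0, i1]
    congr 1
    rw [if_neg]
    rintro ⟨x, y, -⟩; linarith
  have h3 : crossing z (rhombus a s 2) (rhombus a s (2 + 1)) =
      if 0 < z.im ∧ z.im < s ∧ 0 < s * (-(a * z.im) + 2 * a * s - z.re) then 1 else 0 := by
    have e : crs (rhombus a s 3 - rhombus a s 2) (z - rhombus a s 2)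
        = s * (-(a * z.im) + 2 * a * s - z.re) := by
      simp [crs_eq, rhombus]; ring
    change crossing z (rhombus a s 2) (rhombus a s 3) = _
    have i0 : (rhombus a s 2).im = 0 := by simp [rhombus]
    have i1 : (rhombus a s 3).im = s := by simp [rhombus]
    rw [crossing, e, i0, i1]
    congr 1
    rw [if_neg]
    rintro ⟨x, y, -⟩; linarith
  have h4 : crossing z (rhombus a s 3) (rhombus a s (3 + 1)) =
      if 0 < z.im ∧ z.im < s ∧ 0 < -s * (-(a * z.im) + z.re) then -1 else 0 := by
    have e : crs (rhombus a s 3 - rhombus a s 0) (z - rhombus a s 0)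
        = -s * (-(a * z.im) + z.re) := by
      simp [crs_eq, rhombus]; ring
    change crossing z (rhombus a s 3) (rhombus a s 0) = _
    have i0 : (rhombus a s 0).im = 0 := by simp [rhombus]
    have i1 : (rhombus a s 3).im = s := by simp [rhombus]
    rw [crossing, e, i0, i1, if_neg]
    rintro ⟨x, y, -⟩; linarith
  rw [h1, h2, h3, h4, mem_closedRhombus hs]
  rcases lt_trichotomy z.im 0 with hz | hz | hz
  · have n3 : ¬ (0 < z.im ∧ z.im < s ∧ 0 < s * (-(a * z.im) + 2 * a * s - z.re)) :=
      fun h => absurd h.1 hz.not_gt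
    have n4 : ¬ (0 < z.im ∧ z.im < s ∧ 0 < -s * (-(a * z.im) + z.re)) :=
      fun h => absurd h.1 hz.not_gt
    rw [if_neg n3, if_neg n4]
    constructor
    · split_ifs <;> simp
    · intro h
      have haz := mul_neg_of_pos_of_neg ha hz
      split_ifs at h with c1 c2 c2 <;> try simp at h
      have q := pos_of_mul_pos_right c2.2.2 hs.le
      have q' : 0 ≤ a * z.im + z.re := by
        by_contra hcon
        exact c1 ⟨c2.1, c2.2.1, mul_pos_of_neg_of_neg (by linarith) (not_le.1 hcon)⟩
      refine ⟨q', q.le, by linarith, by linarith⟩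
  · simp [hz]
  · have n1 : ¬ (-s < z.im ∧ z.im < 0 ∧ 0 < -s * (a * z.im + z.re)) :=
      fun h => absurd h.2.1 hz.not_gt
    have n2 : ¬ (-s < z.im ∧ z.im < 0 ∧ 0 < s * (a * z.im + 2 * a * s - z.re)) :=
      fun h => absurd h.2.1 hz.not_gt
    rw [if_neg n1, if_neg n2]
    constructor
    · split_ifs <;> simp
    · intro h
      have haz := mul_pos ha hz
      split_ifs at h with c1 c2 c2 <;> try simp at h
      have q := pos_of_mul_pos_right c1.2.2 hs.le
      have q' : 0 ≤ -(a * z.im) + z.re := by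
        by_contra hcon
        exact c2 ⟨c1.1, c1.2.1, mul_pos_of_neg_of_neg (by linarith) (not_le.1 hcon)⟩
      refine ⟨by linarith, by linarith, q.le, q'⟩

theorem sum_crossing (hT : Tiling ρ c p a s) (z : ℂ) :
    ∑ i, ∑ y with c y = i, crossing z (p y) (p (ρ y)) =
      ∑ k : Fin 4, crossing z (rhombus a s k) (rhombus a s (k + 1)) := by
  rw [← hT.bdry (crossing z) (fun x y => crossing_swap z x y)]
  exact Finset.sum_fiberwise Finset.univ c (fun y => crossing z (p y) (p (ρ y)))

theorem exists_generic (p : Y → ℂ) {U : Set ℂ} (hU : IsOpen U) (hne : U.Nonempty) :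
    ∃ w ∈ U, ∀ y, (p y).im ≠ w.im := by
  obtain ⟨w, hw, h⟩ := exists_off_lines (Finset.univ.image fun y => ((1 : ℂ), p y)) (by simp) hU hne
  refine ⟨w, hw, fun y hy => h (1, p y) (by simp) ?_⟩
  simp [crs_eq, hy]

/-- The interiors of distinct tiles are disjoint. -/
theorem eq_of_mem_interior (hT : Tiling ρ c p a s) {z : ℂ} {i j : I}
    (hi : z ∈ interior (hull c p i)) (hj : z ∈ interior (hull c p j)) : i = j := by
  obtain ⟨w, ⟨hwi, hwj⟩, hw⟩ := exists_generic p (isOpen_interior.inter isOpen_interior)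
    ⟨z, hi, hj⟩
  by_contra hij
  have h1 := hT.crossing_sum_pos hw hwi
  have h2 := hT.crossing_sum_pos hw hwj
  have h3 := (rhombus_crossing hT.a_pos hT.s_pos w).1
  rw [← hT.sum_crossing, ← Finset.add_sum_erase _ _ (Finset.mem_univ i),
    ← Finset.add_sum_erase _ _ (Finset.mem_erase.2 ⟨Ne.symm hij, Finset.mem_univ j⟩)] at h3
  have h4 := Finset.sum_nonneg fun x (_ : x ∈ (Finset.univ.erase i).erase j) =>
    hT.crossing_sum_nonneg hw x
  linarith

theorem interior_subset_rhombus (hT : Tiling ρ c p a s) (i : I) :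
    interior (hull c p i) ⊆ closedRhombus a s := by
  intro z hz
  by_contra hcon
  obtain ⟨w, ⟨hwi, hwj⟩, hw⟩ := exists_generic p
    (isOpen_interior.inter (isClosed_closedRhombus (a := a) (s := s)).isOpen_compl) ⟨z, hz, hcon⟩
  refine hwj ((rhombus_crossing hT.a_pos hT.s_pos w).2 ?_)
  rw [← hT.sum_crossing, ← Finset.add_sum_erase _ _ (Finset.mem_univ i)]
  have h4 := Finset.sum_nonneg fun x (_ : x ∈ (Finset.univ.erase i)) =>
    hT.crossing_sum_nonneg hw x
  have := hT.crossing_sum_pos hw hwi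
  linarith

theorem interior_nonempty (hT : Tiling ρ c p a s) (y : Y) : (interior (hull c p (c y))).Nonempty := by
  have hd := hT.corner y
  set d₁ := p (ρ y) - p y with hd1
  set d₂ := p (ρ (ρ y)) - p (ρ y) with hd2
  have := eventually_side (l := 1 / 2) (convex_hull (c := c) (p := p) (c y)) (x := p y) (d₁ := d₁)
    (d₂ := d₁ + d₂) (δ := d₂) (mem_hull y)
    (by rw [hd1, add_sub_cancel]; exact mem_hull' (hT.c_ρ y))
    (by
      have : p y + (d₁ + d₂) = p (ρ (ρ y)) := by rw [hd1, hd2]; ring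
      rw [this]; exact mem_hull' ((hT.c_ρ _).trans (hT.c_ρ y)))
    (by rw [crs_add, crs_self, zero_add]; exact hd) (by norm_num) (by norm_num) hd
  obtain ⟨t, ht⟩ := this.exists
  exact ⟨_, ht⟩

theorem eventually_of_mem {i : I} {z w : ℂ} (hz : z ∈ hull c p i) (hw : w ∈ interior (hull c p i)) :
    ∀ᶠ t : ℝ in 𝓝[>] 0, z + t * (w - z) ∈ interior (hull c p i) := by
  have h1 : ∀ᶠ t : ℝ in 𝓝[>] 0, t < 1 := nhdsWithin_le_nhds (gt_mem_nhds one_pos)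
  filter_upwards [h1, self_mem_nhdsWithin] with t ht ht0
  have := (convex_hull (c := c) (p := p) i).add_smul_sub_mem_interior hz hw ⟨ht0, ht.le⟩
  rwa [Complex.real_smul] at this

theorem eventually_of_side (hT : Tiling ρ c p a s) (y : Y) {z δ : ℂ}
    (hz : z ∈ openSegment ℝ (p y) (p (ρ y))) (hδ : 0 < crs (p (ρ y) - p y) δ) :
    ∀ᶠ t : ℝ in 𝓝[>] 0, z + t * δ ∈ interior (hull c p (c y)) := by
  obtain ⟨l₁, l, h1, h0, hl, rfl⟩ := hz
  have hd := hT.corner y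
  set d₁ := p (ρ y) - p y with hd1
  set d₂ := p (ρ (ρ y)) - p (ρ y) with hd2
  have := eventually_side (l := l) (convex_hull (c := c) (p := p) (c y)) (x := p y) (d₁ := d₁)
    (d₂ := d₁ + d₂) (δ := δ) (mem_hull y)
    (by rw [hd1, add_sub_cancel]; exact mem_hull' (hT.c_ρ y))
    (by
      have : p y + (d₁ + d₂) = p (ρ (ρ y)) := by rw [hd1, hd2]; ring
      rw [this]; exact mem_hull' ((hT.c_ρ _).trans (hT.c_ρ y)))
    (by rw [crs_add, crs_self, zero_add]; exact hd) h0 (by linarith) hδ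
  have e : l₁ • p y + l • p (ρ y) = p y + l * d₁ := by
    rw [hd1, Complex.real_smul, Complex.real_smul, ← eq_sub_iff_add_eq] at *
    rw [hl]; push_cast; ring
  rw [e]
  exact this

theorem exists_label (hne : ∀ i, ∃ y, c y = i) (hT : Tiling ρ c p a s) (i : I) :
    (interior (hull c p i)).Nonempty := by
  obtain ⟨y, rfl⟩ := hne i; exact hT.interior_nonempty y

/-- A tile that meets the interior of a common side of two tiles is one of these. -/
theorem eq_of_mem_inner_side (hT : Tiling ρ c p a s) (hne : ∀ i, ∃ y, c y = i) {y y' : Y}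
    (h1 : p y' = p (ρ y)) (h2 : p (ρ y') = p y) {z : ℂ} (hz : z ∈ openSegment ℝ (p y) (p (ρ y)))
    {i : I} (hi : z ∈ hull c p i) : i = c y ∨ i = c y' := by
  obtain ⟨w, hw, hoff⟩ := exists_off_lines {(p (ρ y) - p y, z)} (by simpa using hT.side_ne y)
    isOpen_interior (exists_label hne hT i)
  have hoff' := hoff _ (Finset.mem_singleton_self _)
  have hev := eventually_of_mem hi hw
  rcases lt_or_gt_of_ne hoff' with h | h
  · right
    have hz' : z ∈ openSegment ℝ (p y') (p (ρ y')) := by rwa [h1, h2, openSegment_symm]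
    obtain ⟨t, ht1, ht2⟩ := (hev.and (hT.eventually_of_side y' hz' (δ := w - z) (by
      rw [h1, h2, ← neg_sub, neg_crs]; exact neg_pos.2 h))).exists
    exact hT.eq_of_mem_interior ht1 ht2
  · left
    obtain ⟨t, ht1, ht2⟩ := (hev.and (hT.eventually_of_side y hz h)).exists
    exact hT.eq_of_mem_interior ht1 ht2

/-- A tile that meets the interior of a boundary side is the adjacent tile. -/
theorem eq_of_mem_outer_side (hT : Tiling ρ c p a s) (hne : ∀ i, ∃ y, c y = i) {y : Y} {k : Fin 4}
    (h1 : p y = rhombus a s k) (h2 : p (ρ y) = rhombus a s (k + 1)) {z : ℂ}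
    (hz : z ∈ openSegment ℝ (p y) (p (ρ y))) {i : I} (hi : z ∈ hull c p i) : i = c y := by
  obtain ⟨w, hw⟩ := exists_label hne hT i
  have hd := hT.side_ne y
  have h3 : 0 < crs (p (ρ y) - p y) (w - p y) :=
    crs_pos_of_mem_interior hd (S := interior (hull c p i)) (fun v hv => by
      rw [h1, h2]; exact hT.interior_subset_rhombus i hv k) (by rwa [interior_interior])
  have h4 : crs (p (ρ y) - p y) (z - p y) = 0 := by
    obtain ⟨l₁, l, -, -, hl, rfl⟩ := hz
    have : l₁ • p y + l • p (ρ y) - p y = l * (p (ρ y) - p y) := by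
      rw [← eq_sub_iff_add_eq] at hl
      rw [hl, Complex.real_smul, Complex.real_smul]; push_cast; ring
    rw [this, crs_smul, crs_self, mul_zero]
  have h5 : 0 < crs (p (ρ y) - p y) (w - z) := by
    have : w - z = (w - p y) - (z - p y) := by ring
    rw [this, crs_sub, h4, sub_zero]; exact h3
  obtain ⟨t, ht1, ht2⟩ := ((eventually_of_mem hi hw).and (hT.eventually_of_side y hz h5)).exists
  exact hT.eq_of_mem_interior ht1 ht2

/-- The tiles with corners in a closed cycle around a point are all tiles that contain it. -/
theorem exists_of_mem_vertex (hT : Tiling ρ c p a s) (hne : ∀ i, ∃ y, c y = i) {z : ℂ}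
    {C : Finset Y} (hC : C.Nonempty) (π : Equiv.Perm Y) (hπ : ∀ y, π y ∈ C ↔ y ∈ C)
    (hz : ∀ y ∈ C, p (ρ y) = z) (hturn : ∀ y ∈ C, p (ρ (ρ (π y))) = p y) {i : I}
    (hi : z ∈ hull c p i) : ∃ y ∈ C, c y = i := by
  obtain ⟨w, hw, hoff⟩ := exists_off_lines (C.image fun y => (p y - p (ρ y), z)) (by
    intro q hq
    obtain ⟨y, -, rfl⟩ := Finset.mem_image.1 hq
    exact sub_ne_zero.2 (sub_ne_zero.1 (hT.side_ne y)).symm) isOpen_interior (exists_label hne hT i)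
  set δ := w - z with hδ
  have hoff1 : ∀ y ∈ C, crs (p y - z) δ ≠ 0 := by
    intro y hy
    have := hoff (p y - p (ρ y), z) (Finset.mem_image_of_mem _ hy)
    rwa [hz y hy] at this
  have hoff2 : ∀ y ∈ C, crs (p (ρ (ρ y)) - z) δ ≠ 0 := by
    intro y hy
    obtain ⟨y', rfl⟩ := π.surjective y
    rw [hturn y' ((hπ y').1 hy)]
    exact hoff1 y' ((hπ y').1 hy)
  have hcor : ∀ y ∈ C, 0 < crs (p (ρ (ρ y)) - z) (p y - z) := by
    intro y hy
    have := hT.corner y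
    rw [hz y hy, crs_swap] at this
    have h2 : p y - z = -(z - p y) := by ring
    rw [h2, crs_neg]; exact this
  obtain ⟨y, hy, hs1, hs2⟩ : ∃ y ∈ C, 0 < crs (p (ρ (ρ y)) - z) δ ∧ 0 < crs δ (p y - z) := by
    by_contra! hcon
    have h1 : ∀ y ∈ C, Complex.arg (-(p (ρ (ρ y)) - z) / δ) < Complex.arg (-(p y - z) / δ) :=
      fun y hy => arg_lt_of_not_sector (hcor y hy) (hoff2 y hy) (hoff1 y hy)
        fun h => absurd h.2 (not_lt.2 (hcon y hy h.1))
    have h2 := Finset.sum_lt_sum_of_nonempty hC h1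
    rw [← π.sum_comp_of_invariant C hπ] at h2
    rw [Finset.sum_congr rfl fun y hy => by rw [hturn y hy]] at h2
    exact lt_irrefl _ h2
  refine ⟨y, hy, ?_⟩
  have hev := eventually_corner (convex_hull (c := c) (p := p) (c y)) (x := z)
    (d₁ := p (ρ (ρ y)) - z) (d₂ := p y - z) (δ := δ)
    (by rw [← hz y hy]; exact mem_hull' (hT.c_ρ y))
    (by rw [add_sub_cancel]; exact mem_hull' ((hT.c_ρ _).trans (hT.c_ρ y)))
    (by rw [add_sub_cancel]; exact mem_hull y) (hcor y hy) hs1 hs2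
  obtain ⟨t, ht1, ht2⟩ := ((eventually_of_mem hi hw).and hev).exists
  exact hT.eq_of_mem_interior ht2 ht1

end Tiling

namespace QuadGraph

section Map

variable {B W : Type*} (G : QuadGraph B W)

theorem trans_of_rot [Finite B] [Finite W] (p : G.Edge → Prop) (hB : ∀ e, p e → p (G.rotB e))
    (hW : ∀ e, p e → p (G.rotW e)) (e e' : G.Edge) (he : p e) : p e' := by
  have hb : ∀ e e' : G.Edge, e.1.1 = e'.1.1 → p e → p e' := fun e e' h he =>
    G.rotB.cycle_induct_of_mem e p he (fun y _ => hB y) e' ((G.rotB_cycle _ _).2 h)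
  have hw : ∀ e e' : G.Edge, e.1.2 = e'.1.2 → p e → p e' := fun e e' h he =>
    G.rotW.cycle_induct_of_mem e p he (fun y _ => hW y) e' ((G.rotW_cycle _ _).2 h)
  let Q : B ⊕ W → Prop := fun x =>
    ∀ e : G.Edge, (Sum.inl e.1.1 = x ∨ Sum.inr e.1.2 = x) → p e
  have step : ∀ x y, G.graph.Adj x y → Q x → Q y := by
    rintro (b | w) (b' | w') hadj hx
    · exact absurd (G.bipartite hadj) (by simp)
    · rintro e₁ (h | h)
      · cases h
      · exact hw ⟨(b, w'), hadj⟩ e₁ (Sum.inr_injective h).symm (hx _ (Or.inl rfl))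
    · rintro e₁ (h | h)
      · exact hb ⟨(b', w), hadj.symm⟩ e₁ (Sum.inl_injective h).symm (hx _ (Or.inr rfl))
      · cases h
    · exact absurd (G.bipartite hadj) (by simp)
  have walk : ∀ x y, G.graph.Walk x y → Q x → Q y := by
    intro x y q
    induction q with
    | nil => exact id
    | cons h _ ih => exact fun hx => ih (step _ _ h hx)
  obtain ⟨q⟩ := G.connected.preconnected (Sum.inl e.1.1) (Sum.inl e'.1.1)
  refine walk _ _ q ?_ e' (Or.inl rfl)
  rintro e₁ (h | h)
  · exact hb e e₁ (Sum.inl_injective h).symm he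
  · cases h

theorem black_surjective : Function.Surjective fun e : G.Edge => e.1.1 := by
  intro b
  obtain ⟨q⟩ := G.connected.preconnected (Sum.inl b) (Sum.inr G.w0)
  cases q with
  | @cons _ x _ h _ =>
    rcases x with b' | w
    · exact absurd (G.bipartite h) (by simp)
    · exact ⟨⟨(b, w), h⟩, rfl⟩

theorem white_surjective : Function.Surjective fun e : G.Edge => e.1.2 := by
  intro w
  obtain ⟨q⟩ := G.connected.preconnected (Sum.inr w) (Sum.inl G.b0)
  cases q with
  | @cons _ x _ h _ =>
    rcases x with b | w'
    · exact ⟨⟨(b, w), h.symm⟩, rfl⟩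
    · exact absurd (G.bipartite h) (by simp)

/-- The combinatorial map of a nondegenerate plane bipartite graph. -/
def toQMap [Finite B] [Finite W] (hG : G.Nondegenerate) : QMap B W G.Edge where
  bl e := e.1.1
  wh e := e.1.2
  inj _ _ h h' := Subtype.ext (Prod.ext h h')
  rB := G.rotB
  rW := G.rotW
  rB_cycle := G.rotB_cycle
  rW_cycle := G.rotW_cycle
  trans := G.trans_of_rot
  bl_surj := G.black_surjective
  wh_surj := G.white_surjective
  euler := G.euler
  e00 := G.e00
  e01 := G.e01
  e10 := G.e10
  e11 := G.e11
  bl_e00 := rfl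
  bl_e10 := rfl
  wh_e00 := rfl
  wh_e01 := rfl
  b_ne := G.b_ne
  w_ne := G.w_ne
  rW_e10 := G.rot_w0
  rB_e11 := G.rot_b1
  rW_e01 := G.rot_w1
  rB_e00 := G.rot_b0
  nondegB S U hS h0 h1 hU := by
    have h := hG.1 S (by simpa using hS) (Finset.mem_coe.not.2 h0) (Finset.mem_coe.not.2 h1)
    rw [Set.ncard_coe_finset] at h
    refine h.trans ?_
    rw [← Set.ncard_coe_finset U]
    refine Set.ncard_le_ncard ?_ U.finite_toSet
    rintro w ⟨b, hb, hadj⟩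
    exact hU ⟨(b, w), hadj⟩ hb
  nondegW S U hS h0 h1 hU := by
    have h := hG.2 S (by simpa using hS) (Finset.mem_coe.not.2 h0) (Finset.mem_coe.not.2 h1)
    rw [Set.ncard_coe_finset] at h
    refine h.trans ?_
    rw [← Set.ncard_coe_finset U]
    refine Set.ncard_le_ncard ?_ U.finite_toSet
    rintro b ⟨w, hw, hadj⟩
    exact hU ⟨(b, w), hadj⟩ hw

end Map

section DualVertices

set_option linter.unusedSectionVars false

variable {B W : Type*} [Finite B] [Finite W] {G : QuadGraph B W}

theorem leftFace_eq_iff (hG : G.Nondegenerate) {e e' : G.Edge} :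
    G.leftFace e = G.leftFace e' ↔ (G.toQMap hG).φ.SameCycle e e' :=
  Quotient.eq (r := Equiv.Perm.SameCycle.setoid _)

theorem rightFace_rotB (e : G.Edge) : G.rightFace (G.rotB e) = G.leftFace e := by
  simp [rightFace]

theorem leftFace_rotW (e : G.Edge) : G.leftFace (G.rotW e) = G.rightFace e := by
  refine Quotient.sound (s := Equiv.Perm.SameCycle.setoid _) ⟨1, ?_⟩
  simp

theorem leftFace_eq_outer_iff (hG : G.Nondegenerate) {e : G.Edge} :
    G.leftFace e = G.outer ↔ e = G.e00 ∨ e = G.e11 := by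
  have h0 : (G.toQMap hG).φ G.e00 = G.e11 := (G.toQMap hG).φ_e00
  have h1 : (G.toQMap hG).φ G.e11 = G.e00 := (G.toQMap hG).φ_e11
  constructor
  · intro h
    refine (G.toQMap hG).φ.cycle_induct_of_mem G.e00 (fun e => e = G.e00 ∨ e = G.e11) (Or.inl rfl) ?_
      e ((leftFace_eq_iff hG).1 h.symm)
    rintro y - (rfl | rfl)
    · exact Or.inr h0
    · exact Or.inl h1
  · rintro (rfl | rfl)
    · rfl
    · exact (leftFace_eq_iff hG).2 ⟨1, by simpa using h1⟩

theorem leftFace_ne_outer_iff (hG : G.Nondegenerate) {e : G.Edge} :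
    G.leftFace e ≠ G.outer ↔ (G.toQMap hG).Bdd e := by
  rw [Ne, leftFace_eq_outer_iff hG, not_or]; rfl

theorem rightFace_eq_outer_iff (hG : G.Nondegenerate) {e : G.Edge} :
    G.rightFace e = G.outer ↔ e = G.e01 ∨ e = G.e10 := by
  obtain ⟨y, rfl⟩ := G.rotB.surjective e
  have h0 : G.rotB G.e00 = G.e01 := G.rot_b0
  have h1 : G.rotB G.e11 = G.e10 := G.rot_b1
  rw [rightFace_rotB, leftFace_eq_outer_iff hG, ← h0, ← h1, G.rotB.injective.eq_iff,
    G.rotB.injective.eq_iff]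

theorem e00_ne_e11 : G.e00 ≠ G.e11 := fun h => G.b_ne (congrArg (fun e : G.Edge => e.1.1) h)

theorem e01_ne_e10 : G.e01 ≠ G.e10 := fun h => G.b_ne (congrArg (fun e : G.Edge => e.1.1) h)

theorem leftV_e00 (hG : G.Nondegenerate) : G.leftV G.e00 = G.v 0 := by
  rw [leftV, dif_pos ((leftFace_eq_outer_iff hG).2 (Or.inl rfl)), if_pos rfl]

theorem leftV_e11 (hG : G.Nondegenerate) : G.leftV G.e11 = G.v 2 := by
  rw [leftV, dif_pos ((leftFace_eq_outer_iff hG).2 (Or.inr rfl)), if_neg e00_ne_e11.symm]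

theorem rightV_e01 (hG : G.Nondegenerate) : G.rightV G.e01 = G.v 1 := by
  rw [rightV, dif_pos ((rightFace_eq_outer_iff hG).2 (Or.inl rfl)), if_pos rfl]

theorem rightV_e10 (hG : G.Nondegenerate) : G.rightV G.e10 = G.v 3 := by
  rw [rightV, dif_pos ((rightFace_eq_outer_iff hG).2 (Or.inr rfl)), if_neg e01_ne_e10.symm]

theorem leftV_of_bdd (hG : G.Nondegenerate) {e : G.Edge} (he : e ≠ G.e00) (he' : e ≠ G.e11) :
    ∃ h, G.leftV e = Sum.inl ⟨G.leftFace e, h⟩ := by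
  have h : G.leftFace e ≠ G.outer := fun h => ((leftFace_eq_outer_iff hG).1 h).elim he he'
  exact ⟨h, by rw [leftV, dif_neg h]⟩

theorem rightV_of_bdd (hG : G.Nondegenerate) {e : G.Edge} (he : e ≠ G.e01) (he' : e ≠ G.e10) :
    ∃ h, G.rightV e = Sum.inl ⟨G.rightFace e, h⟩ := by
  have h : G.rightFace e ≠ G.outer := fun h => ((rightFace_eq_outer_iff hG).1 h).elim he he'
  exact ⟨h, by rw [rightV, dif_neg h]⟩

theorem rightV_rotB (hG : G.Nondegenerate) {e : G.Edge} (he : e ≠ G.e00) (he' : e ≠ G.e11) :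
    G.rightV (G.rotB e) = G.leftV e := by
  obtain ⟨h, h'⟩ := leftV_of_bdd hG he he'
  rw [h', rightV, dif_neg (by rwa [rightFace_rotB])]
  simp only [rightFace_rotB]

theorem leftV_rotW (hG : G.Nondegenerate) {e : G.Edge} (he : e ≠ G.e01) (he' : e ≠ G.e10) :
    G.leftV (G.rotW e) = G.rightV e := by
  obtain ⟨h, h'⟩ := rightV_of_bdd hG he he'
  rw [h', leftV, dif_neg (by rwa [leftFace_rotW])]
  simp only [leftFace_rotW]

theorem leftV_eq_inl_iff {e : G.Edge} {f : {f : G.Face // f ≠ G.outer}} :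
    G.leftV e = Sum.inl f ↔ G.leftFace e = f.1 := by
  unfold leftV
  split_ifs with h
  · exact iff_of_false (by simp) fun h' => f.2 (h'.symm.trans h)
  · simp [Subtype.ext_iff]

theorem rightV_eq_inl_iff {e : G.Edge} {f : {f : G.Face // f ≠ G.outer}} :
    G.rightV e = Sum.inl f ↔ G.rightFace e = f.1 := by
  unfold rightV
  split_ifs with h
  · exact iff_of_false (by simp) fun h' => f.2 (h'.symm.trans h)
  · simp [Subtype.ext_iff]

end DualVertices

end QuadGraph

theorem sgn_cast {x : ℝ} (hx : x ≠ 0) : ((sgn x : ℤ) : ℝ) = Real.sign x := by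
  rcases lt_or_gt_of_ne hx with h | h
  · simp [sgn_of_neg h, Real.sign_of_neg h]
  · simp [sgn_of_pos h, Real.sign_of_pos h]

theorem Finset.filter_eq_filter {X : Type*} (s : Finset X) {p q : X → Prop} {_ : DecidablePred p}
    {_ : DecidablePred q} (h : ∀ x, p x ↔ q x) : s.filter p = s.filter q :=
  Finset.ext fun x => by rw [Finset.mem_filter, Finset.mem_filter, h]

namespace QMap

open scoped Classical in
theorem Kast.gauge {B W E : Type*} {M : QMap B W E} [Fintype B] [Fintype W] [Fintype E]
    {k k' : E → ℝ} (hk : M.Kast k) {g : B → ℝ} {h : W → ℝ} (hg : ∀ b, g b ≠ 0) (hh : ∀ w, h w ≠ 0)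
    (hk' : ∀ e, k' e = g (M.bl e) * k e * h (M.wh e)) : M.Kast k' where
  ne e := by rw [hk' e]; exact mul_ne_zero (mul_ne_zero (hg _) (hk.ne e)) (hh _)
  sign e he := by
    rw [← hk.sign e he]
    have hs : ∀ e, sgn (k' e) = sgn (g (M.bl e)) * sgn (k e) * sgn (h (M.wh e)) := fun e => by
      rw [hk' e, sgn_mul (mul_ne_zero (hg _) (hk.ne e)) (hh _), sgn_mul (hg _) (hk.ne e)]
    have h1 : ∀ e, sgn (k' e) * sgn (k' (M.rB e)) =
        (sgn (k e) * sgn (k (M.rB e))) * (sgn (h (M.wh e)) * sgn (h (M.wh (M.rB e)))) := fun e => by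
      rw [hs, hs, M.bl_rB]
      have := Int.units_mul_self (sgn (g (M.bl e)))
      calc _ = (sgn (g (M.bl e)) * sgn (g (M.bl e))) * ((sgn (k e) * sgn (k (M.rB e))) *
          (sgn (h (M.wh e)) * sgn (h (M.wh (M.rB e))))) := by
            simp only [mul_comm, mul_left_comm, mul_assoc]
        _ = _ := by rw [this, one_mul]
    simp only [h1]
    rw [Finset.prod_mul_distrib, Finset.prod_mul_distrib (f := fun e => sgn (h (M.wh e)))]
    have h2 := M.φ.prod_comp_of_invariant (Finset.univ.filter fun e' => M.φ.SameCycle e e')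
      (fun y => by simp) (fun e => sgn (h (M.wh (M.rB e))))
    simp only [M.wh_rB_φ] at h2
    rw [h2, Int.units_mul_self, mul_one]

end QMap

namespace QuadGraph

section Matrices

set_option linter.unusedSectionVars false

variable {B W : Type*} [Fintype B] [Fintype W] {G : QuadGraph B W}

theorem sum_black [DecidableEq B] {R : Type*} [AddCommMonoid R] (F : B → W → R)
    (hF : ∀ b w, ¬ G.graph.Adj (Sum.inl b) (Sum.inr w) → F b w = 0) (b : B) :
    ∑ e : G.Edge with e.1.1 = b, F e.1.1 e.1.2 = ∑ w, F b w := by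
  classical
  rw [← Finset.sum_filter_add_sum_filter_not Finset.univ
    (fun w => G.graph.Adj (Sum.inl b) (Sum.inr w)) (fun w => F b w),
    Finset.sum_eq_zero (s := Finset.univ.filter fun w => ¬ G.graph.Adj (Sum.inl b) (Sum.inr w))
      (fun w hw => hF b w (Finset.mem_filter.1 hw).2), add_zero]
  refine Finset.sum_bij (fun e _ => e.1.2) ?_ ?_ ?_ ?_
  · rintro ⟨⟨b', w⟩, h⟩ hb
    obtain rfl : b' = b := by simpa using hb
    simpa using h
  · rintro ⟨⟨b₁, w₁⟩, h₁⟩ hb₁ ⟨⟨b₂, w₂⟩, h₂⟩ hb₂ h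
    exact Subtype.ext (Prod.ext ((Finset.mem_filter.1 hb₁).2.trans (Finset.mem_filter.1 hb₂).2.symm) h)
  · intro w hw
    exact ⟨⟨(b, w), (Finset.mem_filter.1 hw).2⟩, by simp, rfl⟩
  · intro e he
    rw [(Finset.mem_filter.1 he).2]

theorem sum_white [DecidableEq W] {R : Type*} [AddCommMonoid R] (F : B → W → R)
    (hF : ∀ b w, ¬ G.graph.Adj (Sum.inl b) (Sum.inr w) → F b w = 0) (w : W) :
    ∑ e : G.Edge with e.1.2 = w, F e.1.1 e.1.2 = ∑ b, F b w := by
  classical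
  rw [← Finset.sum_filter_add_sum_filter_not Finset.univ
    (fun b => G.graph.Adj (Sum.inl b) (Sum.inr w)) (fun b => F b w),
    Finset.sum_eq_zero (s := Finset.univ.filter fun b => ¬ G.graph.Adj (Sum.inl b) (Sum.inr w))
      (fun b hb => hF b w (Finset.mem_filter.1 hb).2), add_zero]
  refine Finset.sum_bij (fun e _ => e.1.1) ?_ ?_ ?_ ?_
  · rintro ⟨⟨b, w'⟩, h⟩ hw
    obtain rfl : w' = w := by simpa using hw
    simpa using h
  · rintro ⟨⟨b₁, w₁⟩, h₁⟩ hb₁ ⟨⟨b₂, w₂⟩, h₂⟩ hb₂ h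
    exact Subtype.ext (Prod.ext h ((Finset.mem_filter.1 hb₁).2.trans (Finset.mem_filter.1 hb₂).2.symm))
  · intro b hb
    exact ⟨⟨(b, w), (Finset.mem_filter.1 hb).2⟩, by simp, rfl⟩
  · intro e he
    rw [(Finset.mem_filter.1 he).2]

/-- The matrix entries as a function on the edges. -/
def onEdge (G : QuadGraph B W) (K : Matrix B W ℝ) (e : G.Edge) : ℝ := K e.1.1 e.1.2

theorem IsKasteleyn.kast (hG : G.Nondegenerate) {χ : G.Edge → ℝ} (hχ : ∀ e, 0 < χ e)
    {K : Matrix B W ℝ} (hK : G.IsKasteleyn χ K) : (G.toQMap hG).Kast (G.onEdge K) := by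
  classical
  have hne : ∀ e, G.onEdge K e ≠ 0 := by
    intro e
    rcases hK.on_edge e with h | h <;> rw [onEdge, h]
    · exact (hχ e).ne'
    · exact neg_ne_zero.2 (hχ e).ne'
  refine ⟨hne, fun e he => ?_⟩
  have hs := hK.sign (G.leftFace e) ((leftFace_ne_outer_iff hG).2 he)
  have hfil : (Finset.univ.filter fun e' => (G.toQMap hG).φ.SameCycle e e')
      = Finset.univ.filter fun e' => G.leftFace e' = G.leftFace e := by
    ext e'
    simp only [Finset.mem_filter, Finset.mem_univ, true_and]
    rw [← leftFace_eq_iff hG, eq_comm]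
  have hright : ∏ e' : G.Edge with G.rightFace e' = G.leftFace e, Real.sign (K e'.1.1 e'.1.2)
      = ∏ e' : G.Edge with G.leftFace e' = G.leftFace e,
        Real.sign (K (G.rotB e').1.1 (G.rotB e').1.2) := by
    symm
    refine Finset.prod_equiv G.rotB (fun y => ?_) (fun _ _ => rfl)
    simp [rightFace_rotB]
  have hfil' : (Finset.univ.filter fun e' => (G.toQMap hG).φ.SameCycle e e').card
      = (Finset.univ.filter fun e' => G.leftFace e' = G.leftFace e).card := by rw [hfil]
  have key : ((∏ e' with (G.toQMap hG).φ.SameCycle e e',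
      (sgn (G.onEdge K e') * sgn (G.onEdge K ((G.toQMap hG).rB e'))) : ℤˣ) : ℤ) =
      (((-1) ^ ((Finset.univ.filter fun e' => (G.toQMap hG).φ.SameCycle e e').card + 1) : ℤˣ) : ℤ) := by
    apply Int.cast_injective (α := ℝ)
    rw [hfil', hfil, Finset.prod_mul_distrib]
    push_cast
    have hA : ∀ e', ((sgn (G.onEdge K e') : ℤ) : ℝ) = Real.sign (K e'.1.1 e'.1.2) :=
      fun e' => sgn_cast (hne e')
    have hsq : ∀ x : ℤˣ, ((x : ℤ) : ℝ) * ((x : ℤ) : ℝ) = 1 := by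
      intro x
      rcases Int.units_eq_one_or x with rfl | rfl <;> simp
    simp only [hA]
    convert hs using 1
    · rw [hright, div_eq_mul_inv]
      congr 1
      rw [← Finset.prod_inv_distrib]
      refine Finset.prod_congr (by ext; simp) fun e' _ => ?_
      have h2 : (G.onEdge K (G.rotB e')) = K (G.rotB e').1.1 (G.rotB e').1.2 := rfl
      have := hsq (sgn (G.onEdge K (G.rotB e')))
      rw [hA] at this
      exact eq_inv_of_mul_eq_one_left this
  convert Units.ext key

variable [DecidableEq B] [DecidableEq W]

theorem exists_isInverse (hG : G.Nondegenerate) {K : Matrix B W ℝ}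
    (hk : (G.toQMap hG).Kast (G.onEdge K))
    (hoff : ∀ b w, ¬ G.graph.Adj (Sum.inl b) (Sum.inr w) → K b w = 0) :
    ∃ Kinv, IsInverse K Kinv := by
  have hinj : Function.Injective (Matrix.toLin' K) := by
    rw [← LinearMap.ker_eq_bot, LinearMap.ker_eq_bot']
    intro f hf
    refine QMap.kernel_trivial hk fun b => ?_
    have h := sum_black (fun b w => K b w * f w) (fun b w h => by rw [hoff b w h, zero_mul]) b
    refine (Eq.trans ?_ h).trans ?_
    · exact Finset.sum_congr (Finset.filter_eq_filter _ fun _ => Iff.rfl) fun _ _ => rfl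
    · have := congrFun hf b
      rwa [Matrix.toLin'_apply] at this
  have hdim : Module.finrank ℝ (W → ℝ) = Module.finrank ℝ (B → ℝ) := by
    rw [Module.finrank_fintype_fun_eq_card, Module.finrank_fintype_fun_eq_card,
      (G.toQMap hG).card_eq]
  let L := LinearMap.linearEquivOfInjective (Matrix.toLin' K) hinj hdim
  have hL : (L : (W → ℝ) →ₗ[ℝ] (B → ℝ)) = Matrix.toLin' K := LinearMap.ext fun x => rfl
  refine ⟨LinearMap.toMatrix' (L.symm : (B → ℝ) →ₗ[ℝ] (W → ℝ)), ?_, ?_⟩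
  · apply Matrix.toLin'.injective
    rw [Matrix.toLin'_mul, Matrix.toLin'_toMatrix', Matrix.toLin'_one, ← hL]
    ext; simp
  · apply Matrix.toLin'.injective
    rw [Matrix.toLin'_mul, Matrix.toLin'_toMatrix', Matrix.toLin'_one, ← hL]
    ext; simp

theorem IsInverse.sum_right {K : Matrix B W ℝ} {Kinv : Matrix W B ℝ} (h : IsInverse K Kinv)
    (b b' : B) : ∑ w, K b w * Kinv w b' = if b = b' then 1 else 0 := by
  have := congrFun (congrFun h.1 b) b'
  rwa [Matrix.mul_apply, Matrix.one_apply] at this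

theorem IsInverse.sum_left {K : Matrix B W ℝ} {Kinv : Matrix W B ℝ} (h : IsInverse K Kinv)
    (w w' : W) : ∑ b, Kinv w' b * K b w = if w = w' then 1 else 0 := by
  have := congrFun (congrFun h.2 w') w
  rw [Matrix.mul_apply, Matrix.one_apply] at this
  rw [this]
  exact if_congr eq_comm rfl rfl

theorem IsInverse.cols (hG : G.Nondegenerate) {K : Matrix B W ℝ} {Kinv : Matrix W B ℝ}
    (h : IsInverse K Kinv)
    (hoff : ∀ b w, ¬ G.graph.Adj (Sum.inl b) (Sum.inr w) → K b w = 0) :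
    (G.toQMap hG).Cols (G.onEdge K) (fun w => Kinv w G.b0) (fun w => Kinv w G.b1) := by
  have key : ∀ b' b, (∑ e : G.Edge with e.1.1 = b, K e.1.1 e.1.2 * Kinv e.1.2 b')
      = if b = b' then 1 else 0 := fun b' b => by
    rw [← h.sum_right, ← sum_black (fun b w => K b w * Kinv w b')
      (fun b w h => by rw [hoff b w h, zero_mul])]
  constructor
  · intro b
    convert key G.b0 b using 1
    · exact Finset.sum_congr (Finset.filter_eq_filter _ fun _ => Iff.rfl) fun _ _ => rfl
    · congr!
  · intro b
    convert key G.b1 b using 1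
    · exact Finset.sum_congr (Finset.filter_eq_filter _ fun _ => Iff.rfl) fun _ _ => rfl
    · congr!

theorem IsInverse.cols_swap (hG : G.Nondegenerate) {K : Matrix B W ℝ} {Kinv : Matrix W B ℝ}
    (h : IsInverse K Kinv)
    (hoff : ∀ b w, ¬ G.graph.Adj (Sum.inl b) (Sum.inr w) → K b w = 0) :
    (G.toQMap hG).swap.Cols (G.onEdge K) (fun b => Kinv G.w1 b)
      (fun b => Kinv G.w0 b) := by
  have key : ∀ w' w, (∑ e : G.Edge with e.1.2 = w, K e.1.1 e.1.2 * Kinv w' e.1.1)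
      = if w = w' then 1 else 0 := fun w' w => by
    rw [← h.sum_left, ← sum_white (fun b w => Kinv w' b * K b w)
      (fun b w h => by rw [hoff b w h, mul_zero])]
    exact Finset.sum_congr (by ext; simp) fun _ _ => mul_comm _ _
  constructor
  · intro w
    convert key G.w1 w using 1
    · exact Finset.sum_congr (Finset.filter_eq_filter _ fun _ => Iff.rfl) fun _ _ => rfl
    · congr!
  · intro w
    convert key G.w0 w using 1
    · exact Finset.sum_congr (Finset.filter_eq_filter _ fun _ => Iff.rfl) fun _ _ => rfl
    · congr!

theorem inverse_ratio_pos (hG : G.Nondegenerate) {K : Matrix B W ℝ} {Kinv : Matrix W B ℝ}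
    (hk : (G.toQMap hG).Kast (G.onEdge K))
    (hv : (G.toQMap hG).Cols (G.onEdge K) (fun w => Kinv w G.b0) (fun w => Kinv w G.b1)) :
    0 < -((Kinv G.w0 G.b0 * Kinv G.w1 G.b1) / (Kinv G.w0 G.b1 * Kinv G.w1 G.b0)) := by
  have h00 : 0 < K G.b0 G.w0 * Kinv G.w0 G.b0 := hv.pos0 hk (e := G.e00) rfl
  have h01 : 0 < K G.b0 G.w1 * Kinv G.w1 G.b0 := hv.pos0 hk (e := G.e01) rfl
  have h10 : 0 < K G.b1 G.w0 * Kinv G.w0 G.b1 := hv.pos1 hk (e := G.e10) rfl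
  have h11 : 0 < K G.b1 G.w1 * Kinv G.w1 G.b1 := hv.pos1 hk (e := G.e11) rfl
  have hneg : K G.b0 G.w0 * K G.b0 G.w1 * (K G.b1 G.w0 * K G.b1 G.w1) < 0 := hv.k_prod_neg hk
  rw [neg_pos, div_neg_iff, ← mul_neg_iff]
  refine neg_of_mul_pos_right (b := _) ?_ hneg.le
  convert mul_pos (mul_pos h00 h11) (mul_pos h01 h10) using 1
  ring

theorem aParam_pos {Kinv : Matrix W B ℝ}
    (h : 0 < -((Kinv G.w0 G.b0 * Kinv G.w1 G.b1) / (Kinv G.w0 G.b1 * Kinv G.w1 G.b0))) :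
    0 < G.aParam Kinv := Real.sqrt_pos.2 h

/-- The normalization by a gauge transformation at the boundary. -/
theorem exists_normalized {K : Matrix B W ℝ} {Kinv : Matrix W B ℝ} (h : IsInverse K Kinv)
    (hr : 0 < -((Kinv G.w0 G.b0 * Kinv G.w1 G.b1) / (Kinv G.w0 G.b1 * Kinv G.w1 G.b0))) :
    ∃ (K' : Matrix B W ℝ) (Kinv' : Matrix W B ℝ), G.BoundaryGaugeEquiv K K' ∧ IsInverse K' Kinv' ∧
      G.IsNormalized (G.aParam Kinv) Kinv' := by
  have ha := aParam_pos hr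
  have ha2 : G.aParam Kinv ^ 2
      = -((Kinv G.w0 G.b0 * Kinv G.w1 G.b1) / (Kinv G.w0 G.b1 * Kinv G.w1 G.b0)) :=
    Real.sq_sqrt hr.le
  set a := G.aParam Kinv
  have hr' := hr.ne'
  rw [neg_ne_zero, div_ne_zero_iff, mul_ne_zero_iff, mul_ne_zero_iff] at hr'
  obtain ⟨⟨x00, x11⟩, x01, x10⟩ := hr'
  let g : B → ℝ := fun b => if b = G.b1 then Kinv G.w0 G.b1 * a / Kinv G.w0 G.b0 else 1
  let t : W → ℝ := fun w => if w = G.w0 then Kinv G.w0 G.b0 / a else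
    if w = G.w1 then -Kinv G.w1 G.b0 else 1
  have hg : ∀ b, g b ≠ 0 := by
    intro b; simp only [g]; split_ifs
    · exact div_ne_zero (mul_ne_zero x01 ha.ne') x00
    · exact one_ne_zero
  have ht : ∀ w, t w ≠ 0 := by
    intro w; simp only [t]; split_ifs
    · exact div_ne_zero x00 ha.ne'
    · exact neg_ne_zero.2 x10
    · exact one_ne_zero
  have hg0 : g G.b0 = 1 := if_neg G.b_ne
  have hg1 : g G.b1 = Kinv G.w0 G.b1 * a / Kinv G.w0 G.b0 := if_pos rfl
  have ht0 : t G.w0 = Kinv G.w0 G.b0 / a := if_pos rfl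
  have ht1 : t G.w1 = -Kinv G.w1 G.b0 := by simp [t, G.w_ne.symm]
  refine ⟨Matrix.of fun b w => g b * K b w * t w, Matrix.of fun w b => Kinv w b / (t w * g b),
    ⟨g, t, hg, ht, ?_, ?_, fun b w => rfl⟩, ⟨?_, ?_⟩, ?_, ?_, ?_, ?_⟩
  · intro b _ h1; exact if_neg h1
  · intro w h0 h1; simp only [t]; rw [if_neg h0, if_neg h1]
  · ext b b'
    rw [Matrix.mul_apply, Matrix.one_apply]
    have h1 : ∀ w, g b * K b w * t w * (Kinv w b' / (t w * g b'))
        = (g b / g b') * (K b w * Kinv w b') := fun w => by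
      have := ht w; have := hg b'; field_simp
    simp only [Matrix.of_apply, h1]
    rw [← Finset.mul_sum, h.sum_right]
    split_ifs with hb
    · rw [hb, div_self (hg b'), one_mul]
    · rw [mul_zero]
  · ext w' w
    rw [Matrix.mul_apply, Matrix.one_apply]
    have h1 : ∀ b, Kinv w' b / (t w' * g b) * (g b * K b w * t w)
        = (t w / t w') * (Kinv w' b * K b w) := fun b => by
      have := ht w'; have := hg b; field_simp
    simp only [Matrix.of_apply, h1]
    rw [← Finset.mul_sum, h.sum_left]
    by_cases hw : w = w'
    · rw [if_pos hw, if_pos hw.symm, hw, div_self (ht w'), one_mul]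
    · rw [if_neg hw, if_neg (Ne.symm hw), mul_zero]
  · rw [Matrix.of_apply, hg0, ht0]; field_simp
  · rw [Matrix.of_apply, hg1, ht1]
    have h2 : Kinv G.w1 G.b1 / (-Kinv G.w1 G.b0 * (Kinv G.w0 G.b1 * a / Kinv G.w0 G.b0))
        = -((Kinv G.w0 G.b0 * Kinv G.w1 G.b1) / (Kinv G.w0 G.b1 * Kinv G.w1 G.b0)) / a := by
      have := ha.ne'; field_simp
    rw [h2, ← ha2, pow_two, mul_div_assoc, div_self ha.ne', mul_one]
  · rw [Matrix.of_apply, hg1, ht0]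
    have := ha.ne'; field_simp
  · rw [Matrix.of_apply, hg0, ht1]; field_simp

theorem isCoulombGauge {K : Matrix B W ℝ} {Kinv : Matrix W B ℝ} (h : IsInverse K Kinv) (a : ℝ) :
    G.IsCoulombGauge K (G.FB a Kinv) (G.FW a Kinv) := by
  have hl : ∀ w w', ∑ b, (Kinv w' b : ℂ) * K b w = if w = w' then 1 else 0 := fun w w' => by
    rw [← Complex.ofReal_one, ← Complex.ofReal_zero, ← apply_ite Complex.ofReal, ← h.sum_left w w']
    push_cast; rfl
  have hr : ∀ b b', ∑ w, (K b w : ℂ) * Kinv w b' = if b = b' then 1 else 0 := fun b b' => by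
    rw [← Complex.ofReal_one, ← Complex.ofReal_zero, ← apply_ite Complex.ofReal, ← h.sum_right b b']
    push_cast; rfl
  constructor
  · intro w h0 h1
    have e : ∀ b, (K b w : ℂ) * G.FB a Kinv b = -Complex.sqrt (-a - Complex.I) * (Kinv G.w0 b * K b w)
        - Complex.sqrt (a + Complex.I) * (Kinv G.w1 b * K b w) := fun b => by rw [FB]; ring
    simp only [e]
    rw [Finset.sum_sub_distrib, ← Finset.mul_sum, ← Finset.mul_sum, hl, hl, if_neg h0, if_neg h1]
    ring
  · intro b h0 h1
    have e : ∀ w, (K b w : ℂ) * G.FW a Kinv w = -Complex.sqrt (-a + Complex.I) * (K b w * Kinv w G.b0)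
        + Complex.sqrt (a - Complex.I) * (K b w * Kinv w G.b1) := fun b => by rw [FW]; ring
    simp only [e]
    rw [Finset.sum_add_distrib, ← Finset.mul_sum, ← Finset.mul_sum, hr, hr, if_neg h0, if_neg h1]
    ring

end Matrices

end QuadGraph

namespace QuadGraph

section Potential

set_option linter.unusedSectionVars false

open scoped Classical

variable {B W : Type*} [Fintype B] [Fintype W] [DecidableEq B] [DecidableEq W] {G : QuadGraph B W}

theorem exists_eq_leftV_or_rightV (hG : G.Nondegenerate) (x : G.DualVertex) :
    (∃ e, x = G.leftV e) ∨ ∃ e, x = G.rightV e := by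
  rcases x with ⟨f, hf⟩ | k
  · obtain ⟨e, rfl⟩ := Quotient.exists_rep f
    left
    exact ⟨e, (leftV_eq_inl_iff.2 rfl).symm⟩
  · fin_cases k
    · exact Or.inl ⟨_, (leftV_e00 hG).symm⟩
    · exact Or.inr ⟨_, (rightV_e01 hG).symm⟩
    · exact Or.inl ⟨_, (leftV_e11 hG).symm⟩
    · exact Or.inr ⟨_, (rightV_e10 hG).symm⟩

/-- A function on the augmented dual that does not change across any dual edge is constant. -/
theorem const_of_leftV_eq_rightV (hG : G.Nondegenerate) {X : Type*} {F : G.DualVertex → X}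
    (h : ∀ e, F (G.leftV e) = F (G.rightV e)) (x y : G.DualVertex) : F x = F y := by
  let q : G.Edge → X := fun e => F (G.rightV e)
  have hB : ∀ e, e ≠ G.e00 → e ≠ G.e11 → q e = q (G.rotB e) := fun e h0 h1 => by
    simp only [q]; rw [rightV_rotB hG h0 h1, h]
  have hW : ∀ e, e ≠ G.e01 → e ≠ G.e10 → q e = q (G.rotW e) := fun e h0 h1 => by
    simp only [q]; rw [← h (G.rotW e), leftV_rotW hG h0 h1]
  have hb : ∀ e e' : G.Edge, G.rotB.SameCycle e e' → e.1.1 = e'.1.1 :=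
    fun e e' he => (G.rotB_cycle e e').1 he
  have hw : ∀ e e' : G.Edge, G.rotW.SameCycle e e' → e.1.2 = e'.1.2 :=
    fun e e' he => (G.rotW_cycle e e').1 he
  have hB' : ∀ (z : X) e, q e = z ↔ q (G.rotB e) = z := by
    intro z e
    by_cases h0 : e = G.e00
    · refine G.rotB.cycle_gap e (fun e => q e = z) fun y hy hne => ?_
      rw [hB y (h0 ▸ hne) fun h1 => G.b_ne (by rw [h0, h1] at hy; exact hb _ _ hy)]
    by_cases h1 : e = G.e11
    · refine G.rotB.cycle_gap e (fun e => q e = z) fun y hy hne => ?_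
      rw [hB y (fun h0 => G.b_ne (by rw [h0, h1] at hy; exact (hb _ _ hy).symm)) (h1 ▸ hne)]
    rw [hB e h0 h1]
  have hW' : ∀ (z : X) e, q e = z ↔ q (G.rotW e) = z := by
    intro z e
    by_cases h0 : e = G.e01
    · refine G.rotW.cycle_gap e (fun e => q e = z) fun y hy hne => ?_
      rw [hW y (h0 ▸ hne) fun h1 => G.w_ne (by rw [h0, h1] at hy; exact (hw _ _ hy).symm)]
    by_cases h1 : e = G.e10
    · refine G.rotW.cycle_gap e (fun e => q e = z) fun y hy hne => ?_
      rw [hW y (fun h0 => G.w_ne (by rw [h0, h1] at hy; exact hw _ _ hy)) (h1 ▸ hne)]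
    rw [hW e h0 h1]
  have hq : ∀ e e', q e' = q e := fun e e' =>
    G.trans_of_rot (fun e' => q e' = q e) (fun y => (hB' _ y).1) (fun y => (hW' _ y).1) e e' rfl
  have hF : ∀ x, ∃ e, F x = q e := by
    intro x
    rcases exists_eq_leftV_or_rightV hG x with ⟨e, rfl⟩ | ⟨e, rfl⟩
    · exact ⟨e, h e⟩
    · exact ⟨e, rfl⟩
  obtain ⟨e, he⟩ := hF x
  obtain ⟨e', he'⟩ := hF y
  rw [he, he', hq]

theorem rotB_sum {R : Type*} [AddCommMonoid R] (b : B) (F : G.Edge → R) :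
    ∑ e : G.Edge with e.1.1 = b, F (G.rotB e) = ∑ e : G.Edge with e.1.1 = b, F e := by
  refine G.rotB.sum_comp_of_invariant _ (fun y => ?_) F
  have : (G.rotB y).1.1 = y.1.1 :=
    (G.rotB_cycle _ _).1 (Equiv.Perm.SameCycle.symm ⟨1, by simp⟩)
  simp [this]

theorem rotW_sum {R : Type*} [AddCommMonoid R] (w : W) (F : G.Edge → R) :
    ∑ e : G.Edge with e.1.2 = w, F (G.rotW e) = ∑ e : G.Edge with e.1.2 = w, F e := by
  refine G.rotW.sum_comp_of_invariant _ (fun y => ?_) F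
  have : (G.rotW y).1.2 = y.1.2 :=
    (G.rotW_cycle _ _).1 (Equiv.Perm.SameCycle.symm ⟨1, by simp⟩)
  simp [this]

theorem sum_black_diff (hG : G.Nondegenerate) (F : G.DualVertex → ℂ) (b : B) :
    ∑ e : G.Edge with e.1.1 = b, (F (G.rightV e) - F (G.leftV e)) =
      (if b = G.b0 then F (G.v 1) - F (G.v 0) else 0) +
        if b = G.b1 then F (G.v 3) - F (G.v 2) else 0 := by
  rw [Finset.sum_sub_distrib, ← rotB_sum b (fun e => F (G.rightV e)), ← Finset.sum_sub_distrib]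
  have h : ∀ e, F (G.rightV (G.rotB e)) - F (G.leftV e) =
      (if e = G.e00 then F (G.v 1) - F (G.v 0) else 0) +
        if e = G.e11 then F (G.v 3) - F (G.v 2) else 0 := by
    intro e
    have h0 : G.rotB G.e00 = G.e01 := G.rot_b0
    have h1 : G.rotB G.e11 = G.e10 := G.rot_b1
    by_cases he : e = G.e00
    · rw [he, if_pos rfl, if_neg e00_ne_e11, h0, rightV_e01 hG, leftV_e00 hG, add_zero]
    by_cases he' : e = G.e11
    · rw [he', if_pos rfl, if_neg e00_ne_e11.symm, h1, rightV_e10 hG, leftV_e11 hG, zero_add]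
    rw [if_neg he, if_neg he', rightV_rotB hG he he', sub_self, add_zero]
  simp only [h]
  rw [Finset.sum_add_distrib, Finset.sum_ite_eq', Finset.sum_ite_eq']
  simp only [Finset.mem_filter, Finset.mem_univ, true_and, e00, e11, eq_comm]

theorem sum_white_diff (hG : G.Nondegenerate) (F : G.DualVertex → ℂ) (w : W) :
    ∑ e : G.Edge with e.1.2 = w, (F (G.rightV e) - F (G.leftV e)) =
      (if w = G.w0 then F (G.v 3) - F (G.v 0) else 0) +
        if w = G.w1 then F (G.v 1) - F (G.v 2) else 0 := by
  rw [Finset.sum_sub_distrib, ← rotW_sum w (fun e => F (G.leftV e)), ← Finset.sum_sub_distrib]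
  have h : ∀ e, F (G.rightV e) - F (G.leftV (G.rotW e)) =
      (if e = G.e10 then F (G.v 3) - F (G.v 0) else 0) +
        if e = G.e01 then F (G.v 1) - F (G.v 2) else 0 := by
    intro e
    have h0 : G.rotW G.e10 = G.e00 := G.rot_w0
    have h1 : G.rotW G.e01 = G.e11 := G.rot_w1
    by_cases he : e = G.e10
    · rw [he, if_pos rfl, if_neg e01_ne_e10.symm, h0, rightV_e10 hG, leftV_e00 hG, add_zero]
    by_cases he' : e = G.e01
    · rw [he', if_pos rfl, if_neg e01_ne_e10, h1, rightV_e01 hG, leftV_e11 hG, zero_add]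
    rw [if_neg he, if_neg he', leftV_rotW hG he' he, sub_self, add_zero]
  simp only [h]
  rw [Finset.sum_add_distrib, Finset.sum_ite_eq', Finset.sum_ite_eq']
  simp only [Finset.mem_filter, Finset.mem_univ, true_and, e10, e01, eq_comm]

/-- A closed form on the dual edges is exact. -/
theorem exists_potential (hG : G.Nondegenerate) (δ : G.Edge → ℂ)
    (hb : ∀ b, b ≠ G.b0 → b ≠ G.b1 → ∑ e : G.Edge with e.1.1 = b, δ e = 0)
    (hw : ∀ w, w ≠ G.w0 → w ≠ G.w1 → ∑ e : G.Edge with e.1.2 = w, δ e = 0) :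
    ∃ F : G.DualVertex → ℂ, (∀ e, F (G.rightV e) - F (G.leftV e) = δ e) ∧ F (G.v 0) = 0 := by
  let D : (G.DualVertex → ℂ) →ₗ[ℂ] (G.Edge → ℂ) :=
    { toFun := fun F e => F (G.rightV e) - F (G.leftV e)
      map_add' := fun F F' => by ext e; simp only [Pi.add_apply]; ring
      map_smul' := fun c F => by
        ext e; simp only [Pi.smul_apply, smul_eq_mul, RingHom.id_apply]; ring }
  let V := {b : B // b ≠ G.b0 ∧ b ≠ G.b1} ⊕ {w : W // w ≠ G.w0 ∧ w ≠ G.w1}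
  let C : (G.Edge → ℂ) →ₗ[ℂ] (V → ℂ) :=
    { toFun := fun δ => Sum.elim (fun b => ∑ e : G.Edge with e.1.1 = b.1, δ e)
        (fun w => ∑ e : G.Edge with e.1.2 = w.1, δ e)
      map_add' := fun F F' => by ext (x | x) <;> simp [Finset.sum_add_distrib]
      map_smul' := fun c F => by ext (x | x) <;> simp [Finset.mul_sum] }
  have hDC : LinearMap.range D ≤ LinearMap.ker C := by
    rintro _ ⟨F, rfl⟩
    rw [LinearMap.mem_ker]
    ext (⟨b, h0, h1⟩ | ⟨w, h0, h1⟩)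
    · change ∑ e : G.Edge with e.1.1 = b, (F (G.rightV e) - F (G.leftV e)) = 0
      rw [sum_black_diff hG, if_neg h0, if_neg h1, add_zero]
    · change ∑ e : G.Edge with e.1.2 = w, (F (G.rightV e) - F (G.leftV e)) = 0
      rw [sum_white_diff hG, if_neg h0, if_neg h1, add_zero]
  have hkD : Module.finrank ℂ (LinearMap.ker D) ≤ 1 := by
    have hone : (fun _ => 1 : G.DualVertex → ℂ) ∈ LinearMap.ker D := by
      rw [LinearMap.mem_ker]; ext e; simp [D]
    refine finrank_le_one ⟨_, hone⟩ fun F => ⟨F.1 (G.v 0), ?_⟩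
    ext x
    have hF : ∀ e, F.1 (G.leftV e) = F.1 (G.rightV e) := fun e => by
      have := congrFun (LinearMap.mem_ker.1 F.2) e
      exact (sub_eq_zero.1 this).symm
    simpa using const_of_leftV_eq_rightV hG hF (G.v 0) x
  have hC : LinearMap.range C = ⊤ := by
    by_contra hne
    obtain ⟨g, hg0, hg⟩ := Submodule.exists_le_ker_of_lt_top _ (lt_top_iff_ne_top.2 hne)
    let yB : B → ℂ := fun b => if h : b ≠ G.b0 ∧ b ≠ G.b1 then
      g (Pi.single (Sum.inl ⟨b, h⟩) 1) else 0
    let yW : W → ℂ := fun w => if h : w ≠ G.w0 ∧ w ≠ G.w1 then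
      g (Pi.single (Sum.inr ⟨w, h⟩) 1) else 0
    have hy : ∀ e : G.Edge, yB e.1.1 + yW e.1.2 = 0 := by
      intro e
      have h1 : g (C (Pi.single e 1)) = 0 := hg ⟨_, rfl⟩
      have h2 : C (Pi.single e 1) =
          (if h : e.1.1 ≠ G.b0 ∧ e.1.1 ≠ G.b1 then Pi.single (Sum.inl ⟨e.1.1, h⟩) 1 else 0) +
          (if h : e.1.2 ≠ G.w0 ∧ e.1.2 ≠ G.w1 then Pi.single (Sum.inr ⟨e.1.2, h⟩) 1 else 0) := by
        ext (⟨b, hb⟩ | ⟨w, hw⟩)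
        · have h3 : C (Pi.single e 1) (Sum.inl ⟨b, hb⟩) = if e.1.1 = b then 1 else 0 := by
            simp [C, Pi.single_apply, Finset.sum_ite_eq']
          rw [h3, Pi.add_apply]
          split_ifs with h h' h'' h'' <;> simp [Pi.single_apply, Subtype.ext_iff, eq_comm] <;> grind
        · have h3 : C (Pi.single e 1) (Sum.inr ⟨w, hw⟩) = if e.1.2 = w then 1 else 0 := by
            simp [C, Pi.single_apply, Finset.sum_ite_eq']
          rw [h3, Pi.add_apply]
          split_ifs with h h' h'' h'' <;> simp [Pi.single_apply, Subtype.ext_iff, eq_comm] <;> grind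
      rw [h2, map_add] at h1
      rw [← h1]
      congr 1
      · simp only [yB]; split_ifs <;> simp
      · simp only [yW]; split_ifs <;> simp
    have hz : ∀ e : G.Edge, yB e.1.1 = 0 ∧ yW e.1.2 = 0 := by
      intro e
      refine G.trans_of_rot (fun e => yB e.1.1 = 0 ∧ yW e.1.2 = 0) ?_ ?_ G.e00 e ⟨?_, ?_⟩
      · rintro y ⟨h1, h2⟩
        have : (G.rotB y).1.1 = y.1.1 :=
          (G.rotB_cycle _ _).1 (Equiv.Perm.SameCycle.symm ⟨1, by simp⟩)
        have h3 := hy (G.rotB y)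
        rw [this, h1, zero_add] at h3
        exact ⟨by rw [this, h1], h3⟩
      · rintro y ⟨h1, h2⟩
        have : (G.rotW y).1.2 = y.1.2 :=
          (G.rotW_cycle _ _).1 (Equiv.Perm.SameCycle.symm ⟨1, by simp⟩)
        have h3 := hy (G.rotW y)
        rw [this, h2, add_zero] at h3
        exact ⟨h3, by rw [this, h2]⟩
      · exact dif_neg fun h => h.1 rfl
      · exact dif_neg fun h => h.1 rfl
    apply hg0
    refine LinearMap.pi_ext' fun x => LinearMap.ext_ring ?_
    rcases x with ⟨b, hb⟩ | ⟨w, hw⟩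
    · obtain ⟨e, he⟩ := G.black_surjective b
      have := (hz e).1
      simp only [yB] at this he
      rw [he, dif_pos hb] at this
      simpa using this
    · obtain ⟨e, he⟩ := G.white_surjective w
      have := (hz e).2
      simp only [yW] at this he
      rw [he, dif_pos hw] at this
      simpa using this
  have hrange : LinearMap.range D = LinearMap.ker C := by
    refine Submodule.eq_of_le_of_finrank_le hDC ?_
    have d1 := LinearMap.finrank_range_add_finrank_ker D
    have d2 := LinearMap.finrank_range_add_finrank_ker C
    rw [hC, finrank_top, Module.finrank_fintype_fun_eq_card, Module.finrank_fintype_fun_eq_card] at d2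
    rw [Module.finrank_fintype_fun_eq_card] at d1
    have c1 : Fintype.card V + 4 = Fintype.card B + Fintype.card W := by
      have e1 : Fintype.card {b : B // b ≠ G.b0 ∧ b ≠ G.b1} + 2 = Fintype.card B := by
        rw [Fintype.card_subtype, ← Finset.card_pair G.b_ne, ← Finset.card_univ,
          ← Finset.card_sdiff_add_card_eq_card (Finset.subset_univ {G.b0, G.b1})]
        congr 2
        ext; simp
      have e2 : Fintype.card {w : W // w ≠ G.w0 ∧ w ≠ G.w1} + 2 = Fintype.card W := by
        rw [Fintype.card_subtype, ← Finset.card_pair G.w_ne, ← Finset.card_univ,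
          ← Finset.card_sdiff_add_card_eq_card (Finset.subset_univ {G.w0, G.w1})]
        congr 2
        ext; simp
      rw [Fintype.card_sum]
      omega
    have c2 : Fintype.card G.DualVertex = Nat.card G.Face + 3 := by
      have : Fintype.card {f : G.Face // f ≠ G.outer} + 1 = Fintype.card G.Face := by
        rw [Fintype.card_subtype_compl, Fintype.card_subtype_eq]
        exact Nat.sub_add_cancel (Fintype.card_pos_iff.2 ⟨G.outer⟩)
      rw [Fintype.card_sum, Fintype.card_fin, Nat.card_eq_fintype_card]
      omega
    have c3 := G.euler
    rw [Nat.card_eq_fintype_card, Nat.card_eq_fintype_card, Nat.card_eq_fintype_card (α := G.Edge)]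
      at c3
    have c4 : Nat.card G.Face
      = Nat.card (Quotient (Equiv.Perm.SameCycle.setoid (G.rotB⁻¹ * G.rotW⁻¹))) := rfl
    omega
  have hδ : δ ∈ LinearMap.ker C := by
    rw [LinearMap.mem_ker]
    ext (⟨b, h⟩ | ⟨w, h⟩)
    · exact hb b h.1 h.2
    · exact hw w h.1 h.2
  rw [← hrange] at hδ
  obtain ⟨F, hF⟩ := hδ
  refine ⟨fun x => F x - F (G.v 0), fun e => ?_, sub_self _⟩
  rw [← congrFun hF e]
  change _ = F (G.rightV e) - F (G.leftV e)
  ring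

end Potential

end QuadGraph

section Roots

variable (a : ℝ)

theorem norm_ofReal_add_ofReal_mul_I (x y : ℝ) (h : x ^ 2 + y ^ 2 = a ^ 2 + 1) :
    ‖(x + y * Complex.I : ℂ)‖ = √(a ^ 2 + 1) := by
  rw [← h, Complex.norm_add_mul_I]

theorem abs_lt_sqrt_sq_add_one : |a| < √(a ^ 2 + 1) := by
  rw [← Real.sqrt_sq_eq_abs]
  exact Real.sqrt_lt_sqrt (sq_nonneg _) (by linarith)

theorem sqrt_sq_add_one_pos : 0 < √(a ^ 2 + 1) := (abs_nonneg a).trans_lt (abs_lt_sqrt_sq_add_one a)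

theorem sqrt_neg_add_I : Complex.sqrt (-a + Complex.I) =
    √((√(a ^ 2 + 1) - a) / 2) + √((√(a ^ 2 + 1) + a) / 2) * Complex.I := by
  have h := norm_ofReal_add_ofReal_mul_I a (-a) 1 (by ring)
  have e : (-a + Complex.I : ℂ) = ((-a : ℝ) : ℂ) + ((1 : ℝ) : ℂ) * Complex.I := by push_cast; ring
  rw [e, Complex.sqrt_eq_real_add_ite, h]
  simp [sub_eq_add_neg]

theorem sqrt_sub_I : Complex.sqrt (a - Complex.I) =
    √((√(a ^ 2 + 1) + a) / 2) - √((√(a ^ 2 + 1) - a) / 2) * Complex.I := by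
  have h := norm_ofReal_add_ofReal_mul_I a a (-1) (by ring)
  have e : (a - Complex.I : ℂ) = ((a : ℝ) : ℂ) + ((-1 : ℝ) : ℂ) * Complex.I := by push_cast; ring
  rw [e, Complex.sqrt_eq_real_add_ite, h]
  norm_num
  ring

theorem sqrt_neg_sub_I : Complex.sqrt (-a - Complex.I) =
    √((√(a ^ 2 + 1) - a) / 2) - √((√(a ^ 2 + 1) + a) / 2) * Complex.I := by
  have h := norm_ofReal_add_ofReal_mul_I a (-a) (-1) (by ring)
  have e : (-a - Complex.I : ℂ) = ((-a : ℝ) : ℂ) + ((-1 : ℝ) : ℂ) * Complex.I := by push_cast; ring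
  rw [e, Complex.sqrt_eq_real_add_ite, h]
  norm_num [← sub_eq_add_neg]

theorem sqrt_add_I : Complex.sqrt (a + Complex.I) =
    √((√(a ^ 2 + 1) + a) / 2) + √((√(a ^ 2 + 1) - a) / 2) * Complex.I := by
  have h := norm_ofReal_add_ofReal_mul_I a a 1 (by ring)
  have e : (a + Complex.I : ℂ) = ((a : ℝ) : ℂ) + ((1 : ℝ) : ℂ) * Complex.I := by push_cast; ring
  rw [e, Complex.sqrt_eq_real_add_ite, h]
  norm_num

theorem sqrt_sub_I_eq : Complex.sqrt (a - Complex.I)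
    = -Complex.I * Complex.sqrt (-a + Complex.I) := by
  rw [sqrt_sub_I, sqrt_neg_add_I]
  linear_combination (√((√(a ^ 2 + 1) + a) / 2) : ℂ) * Complex.I_sq

theorem sqrt_neg_sub_I_eq : Complex.sqrt (-a - Complex.I) = conj (Complex.sqrt (-a + Complex.I)) := by
  rw [sqrt_neg_sub_I, sqrt_neg_add_I]
  simp only [map_add, map_mul, Complex.conj_ofReal, Complex.conj_I]
  ring

theorem sqrt_add_I_eq : Complex.sqrt (a + Complex.I)
    = Complex.I * conj (Complex.sqrt (-a + Complex.I)) := by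
  rw [sqrt_add_I, sqrt_neg_add_I]
  simp only [map_add, map_mul, Complex.conj_ofReal, Complex.conj_I]
  linear_combination (√((√(a ^ 2 + 1) + a) / 2) : ℂ) * Complex.I_sq

theorem sq_sqrt_neg_add_I : Complex.sqrt (-a + Complex.I) ^ 2 = -a + Complex.I := by
  rw [Complex.sqrt]
  exact Complex.cpow_nat_inv_pow _ two_ne_zero

theorem conj_sqrt_mul_sqrt :
    conj (Complex.sqrt (-a + Complex.I)) * Complex.sqrt (-a + Complex.I) = √(a ^ 2 + 1) := by
  have h1 := (abs_lt.1 (abs_lt_sqrt_sq_add_one a)).1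
  have h2 := (abs_lt.1 (abs_lt_sqrt_sq_add_one a)).2
  rw [mul_comm, Complex.mul_conj, sqrt_neg_add_I, Complex.normSq_add_mul_I,
    Real.sq_sqrt (by linarith), Real.sq_sqrt (by linarith)]
  congr 1
  ring

end Roots

namespace QuadGraph

section Values

set_option linter.unusedSectionVars false

open scoped Classical
open QMap

variable {B W : Type*} [Fintype B] [Fintype W] {G : QuadGraph B W}

variable (G) in
/-- The complex combination of the two boundary columns of the inverse matrix. -/
def cplxW (Kinv : Matrix W B ℝ) : W → ℂ := cplx (fun w => Kinv w G.b0) (fun w => Kinv w G.b1)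

variable (G) in
/-- The complex combination of the two boundary rows of the inverse matrix. -/
def cplxB (Kinv : Matrix W B ℝ) : B → ℂ := cplx (fun b => Kinv G.w0 b) (fun b => Kinv G.w1 b)

theorem FW_eq (a : ℝ) (Kinv : Matrix W B ℝ) (w : W) :
    G.FW a Kinv w = -Complex.sqrt (-a + Complex.I) * G.cplxW Kinv w := by
  rw [FW, sqrt_sub_I_eq, cplxW, cplx]; ring

theorem FB_eq (a : ℝ) (Kinv : Matrix W B ℝ) (b : B) :
    G.FB a Kinv b = -conj (Complex.sqrt (-a + Complex.I)) * G.cplxB Kinv b := by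
  rw [FB, sqrt_add_I_eq, sqrt_neg_sub_I_eq, cplxB, cplx]; ring

theorem form_eq (a : ℝ) (K : Matrix B W ℝ) (Kinv : Matrix W B ℝ) (e : G.Edge) :
    G.FB a Kinv e.1.1 * K e.1.1 e.1.2 * G.FW a Kinv e.1.2 =
      √(a ^ 2 + 1) * G.cplxB Kinv e.1.1 * (K e.1.1 e.1.2 * G.cplxW Kinv e.1.2) := by
  rw [FB_eq, FW_eq, ← conj_sqrt_mul_sqrt]; ring

theorem origamiForm_eq (a : ℝ) (K : Matrix B W ℝ) (Kinv : Matrix W B ℝ) (e : G.Edge) :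
    G.FB a Kinv e.1.1 * K e.1.1 e.1.2 * conj (G.FW a Kinv e.1.2) =
      (-a - Complex.I) * G.cplxB Kinv e.1.1 * (K e.1.1 e.1.2 * conj (G.cplxW Kinv e.1.2)) := by
  have h : (-a - Complex.I : ℂ) = conj (Complex.sqrt (-a + Complex.I)) ^ 2 := by
    rw [← map_pow, sq_sqrt_neg_add_I]; simp [sub_eq_add_neg]
  rw [FB_eq, FW_eq, h, map_mul, map_neg]; ring

variable [DecidableEq B] [DecidableEq W]

theorem IsInverse.sum_cplxW {K : Matrix B W ℝ} {Kinv : Matrix W B ℝ} (h : IsInverse K Kinv)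
    (b : B) : ∑ w, (K b w : ℂ) * G.cplxW Kinv w
      = (if b = G.b0 then 1 else 0) + (if b = G.b1 then 1 else 0) * Complex.I := by
  have h0 := congrArg (fun x : ℝ => (x : ℂ)) (h.sum_right b G.b0)
  have h1 := congrArg (fun x : ℝ => (x : ℂ)) (h.sum_right b G.b1)
  simp only [apply_ite Complex.ofReal, Complex.ofReal_one, Complex.ofReal_zero] at h0 h1
  rw [← h0, ← h1]
  push_cast
  rw [Finset.sum_mul, ← Finset.sum_add_distrib]
  exact Finset.sum_congr rfl fun w _ => by rw [cplxW, cplx]; ring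

theorem IsInverse.sum_cplxB {K : Matrix B W ℝ} {Kinv : Matrix W B ℝ} (h : IsInverse K Kinv)
    (w : W) : ∑ b, (K b w : ℂ) * G.cplxB Kinv b
      = (if w = G.w0 then 1 else 0) + (if w = G.w1 then 1 else 0) * Complex.I := by
  have h0 := congrArg (fun x : ℝ => (x : ℂ)) (h.sum_left w G.w0)
  have h1 := congrArg (fun x : ℝ => (x : ℂ)) (h.sum_left w G.w1)
  simp only [apply_ite Complex.ofReal, Complex.ofReal_one, Complex.ofReal_zero] at h0 h1
  rw [← h0, ← h1]
  push_cast
  rw [Finset.sum_mul, ← Finset.sum_add_distrib]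
  exact Finset.sum_congr rfl fun w _ => by rw [cplxB, cplx]; ring

/-- The setting after normalization. -/
structure Normalized (hG : G.Nondegenerate) (a : ℝ) (K : Matrix B W ℝ) (Kinv : Matrix W B ℝ) :
    Prop where
  a_pos : 0 < a
  inv : IsInverse K Kinv
  off : ∀ b w, ¬ G.graph.Adj (Sum.inl b) (Sum.inr w) → K b w = 0
  kast : (G.toQMap hG).Kast (G.onEdge K)
  norm : G.IsNormalized a Kinv

variable {hG : G.Nondegenerate} {a : ℝ} {K : Matrix B W ℝ} {Kinv : Matrix W B ℝ}

namespace Normalized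

theorem cplxW_w0 (h : Normalized hG a K Kinv) : G.cplxW Kinv G.w0 = a + Complex.I := by
  obtain ⟨h1, h2, h3, h4⟩ := h.norm
  rw [cplxW, cplx, h1, h3]; simp

theorem cplxW_w1 (h : Normalized hG a K Kinv) : G.cplxW Kinv G.w1 = -1 + a * Complex.I := by
  obtain ⟨h1, h2, h3, h4⟩ := h.norm
  rw [cplxW, cplx, h2, neg_eq_iff_eq_neg.1 h4]; simp

theorem cplxB_b0 (h : Normalized hG a K Kinv) : G.cplxB Kinv G.b0 = a - Complex.I := by
  obtain ⟨h1, h2, h3, h4⟩ := h.norm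
  rw [cplxB, cplx, h1, neg_eq_iff_eq_neg.1 h4]; simp [sub_eq_add_neg]

theorem cplxB_b1 (h : Normalized hG a K Kinv) : G.cplxB Kinv G.b1 = 1 + a * Complex.I := by
  obtain ⟨h1, h2, h3, h4⟩ := h.norm
  rw [cplxB, cplx, h2, h3]; simp

theorem cols (h : Normalized hG a K Kinv) : (G.toQMap hG).Cols (G.onEdge K) (fun w => Kinv w G.b0)
    (fun w => Kinv w G.b1) := h.inv.cols hG h.off

theorem k00_pos (h : Normalized hG a K Kinv) : 0 < G.onEdge K G.e00 := by
  have := h.cols.pos0 h.kast (e := G.e00) rfl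
  have h2 : Kinv G.w0 G.b0 = a := h.norm.1
  exact pos_of_mul_pos_left (this.trans_eq (congrArg _ h2)) h.a_pos.le

theorem k01_neg (h : Normalized hG a K Kinv) : G.onEdge K G.e01 < 0 := by
  have h1 : 0 < G.onEdge K G.e01 * Kinv G.w1 G.b0 := h.cols.pos0 h.kast (e := G.e01) rfl
  have h2 : Kinv G.w1 G.b0 = -1 := neg_eq_iff_eq_neg.1 h.norm.2.2.2
  rw [h2] at h1
  linarith

theorem k10_pos (h : Normalized hG a K Kinv) : 0 < G.onEdge K G.e10 := by
  have h1 : 0 < G.onEdge K G.e10 * Kinv G.w0 G.b1 := h.cols.pos1 h.kast (e := G.e10) rfl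
  rw [h.norm.2.2.1] at h1
  linarith

theorem k11_pos (h : Normalized hG a K Kinv) : 0 < G.onEdge K G.e11 := by
  have h1 : 0 < G.onEdge K G.e11 * Kinv G.w1 G.b1 := h.cols.pos1 h.kast (e := G.e11) rfl
  rw [h.norm.2.1] at h1
  exact pos_of_mul_pos_left h1 h.a_pos.le

theorem convB (h : Normalized hG a K Kinv) : (G.toQMap hG).Conv (G.onEdge K)
    (fun w => Kinv w G.b0) (fun w => Kinv w G.b1) :=
  h.cols.conv h.kast (mul_pos h.k00_pos h.k10_pos)

theorem convW (h : Normalized hG a K Kinv) : (G.toQMap hG).swap.Conv (G.onEdge K)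
    (fun b => Kinv G.w0 b) (fun b => Kinv G.w1 b) :=
  (h.inv.cols_swap hG h.off).conv_swap h.kast.swap (mul_neg_of_neg_of_pos h.k01_neg h.k00_pos)

theorem cplxW_ne_zero (h : Normalized hG a K Kinv) (w : W) : G.cplxW Kinv w ≠ 0 := by
  intro h0
  rcases h.convB.ne_zero w with h1 | h1
  · exact h1 (by simpa [cplxW, cplx] using congrArg Complex.im h0)
  · exact h1 (by simpa [cplxW, cplx] using congrArg Complex.re h0)

theorem cplxB_ne_zero (h : Normalized hG a K Kinv) (b : B) : G.cplxB Kinv b ≠ 0 := by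
  intro h0
  rcases h.convW.ne_zero b with h1 | h1
  · exact h1 (by simpa [cplxB, cplx] using congrArg Complex.im h0)
  · exact h1 (by simpa [cplxB, cplx] using congrArg Complex.re h0)

theorem exists_isTRealisation (h : Normalized hG a K Kinv) :
    ∃ T, G.IsTRealisation K (G.FB a Kinv) (G.FW a Kinv) T ∧ T (G.v 0) = 0 := by
  have hc := isCoulombGauge (G := G) h.inv a
  refine exists_potential hG _ (fun b h0 h1 => ?_) (fun w h0 h1 => ?_)
  · rw [sum_black (fun b w => G.FB a Kinv b * K b w * G.FW a Kinv w)
      (fun b w hbw => by rw [h.off b w hbw]; simp)]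
    simp only [mul_assoc]
    rw [← Finset.mul_sum, hc.2 b h0 h1, mul_zero]
  · rw [sum_white (fun b w => G.FB a Kinv b * K b w * G.FW a Kinv w)
      (fun b w hbw => by rw [h.off b w hbw]; simp), ← Finset.sum_mul]
    simp only [mul_comm (G.FB a Kinv _)]
    rw [hc.1 w h0 h1, zero_mul]

theorem exists_isOrigami (h : Normalized hG a K Kinv) :
    ∃ O, G.IsOrigami K (G.FB a Kinv) (G.FW a Kinv) O ∧ O (G.v 0) = 0 := by
  have hc := isCoulombGauge (G := G) h.inv a
  refine exists_potential hG _ (fun b h0 h1 => ?_) (fun w h0 h1 => ?_)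
  · rw [sum_black (fun b w => G.FB a Kinv b * K b w * conj (G.FW a Kinv w))
      (fun b w hbw => by rw [h.off b w hbw]; simp)]
    simp only [mul_assoc]
    have := congrArg conj (hc.2 b h0 h1)
    rw [map_sum] at this
    simp only [map_mul, Complex.conj_ofReal, map_zero] at this
    rw [← Finset.mul_sum, this, mul_zero]
  · rw [sum_white (fun b w => G.FB a Kinv b * K b w * conj (G.FW a Kinv w))
      (fun b w hbw => by rw [h.off b w hbw]; simp), ← Finset.sum_mul]
    simp only [mul_comm (G.FB a Kinv _)]
    rw [hc.1 w h0 h1, zero_mul]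

theorem boundary_values (h : Normalized hG a K Kinv) {T : G.DualVertex → ℂ}
    (hT : G.IsTRealisation K (G.FB a Kinv) (G.FW a Kinv) T) (hT0 : T (G.v 0) = 0) :
    T (G.v 1) = (a - Complex.I) * √(a ^ 2 + 1) ∧ T (G.v 2) = 2 * a * √(a ^ 2 + 1) ∧
      T (G.v 3) = (a + Complex.I) * √(a ^ 2 + 1) := by
  have hb : T (G.v 1) - T (G.v 0) = √(a ^ 2 + 1) * G.cplxB Kinv G.b0 := by
    have h1 := sum_black_diff hG T G.b0
    rw [if_pos rfl, if_neg G.b_ne, add_zero] at h1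
    rw [← h1, Finset.sum_congr rfl fun e _ => (hT e).trans (form_eq a K Kinv e)]
    rw [sum_black (fun b w => √(a ^ 2 + 1) * G.cplxB Kinv b * (K b w * G.cplxW Kinv w))
      (fun b w hbw => by rw [h.off b w hbw]; simp), ← Finset.mul_sum, h.inv.sum_cplxW,
      if_pos rfl, if_neg G.b_ne]
    ring
  have hw : ∀ w, ∑ e : G.Edge with e.1.2 = w, (T (G.rightV e) - T (G.leftV e)) =
      √(a ^ 2 + 1) * G.cplxW Kinv w * ((if w = G.w0 then 1 else 0) +
        (if w = G.w1 then 1 else 0) * Complex.I) := by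
    intro w
    rw [Finset.sum_congr rfl fun e _ => (hT e).trans (form_eq a K Kinv e)]
    rw [sum_white (fun b w => √(a ^ 2 + 1) * G.cplxB Kinv b * (K b w * G.cplxW Kinv w))
      (fun b w hbw => by rw [h.off b w hbw]; simp), ← h.inv.sum_cplxB, Finset.mul_sum]
    exact Finset.sum_congr rfl fun b _ => by ring
  have hw0 := (sum_white_diff hG T G.w0).symm.trans (hw G.w0)
  have hw1 := (sum_white_diff hG T G.w1).symm.trans (hw G.w1)
  rw [if_pos rfl, if_neg G.w_ne, if_pos rfl, if_neg G.w_ne, h.cplxW_w0, hT0] at hw0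
  rw [if_neg G.w_ne.symm, if_pos rfl, if_neg G.w_ne.symm, if_pos rfl, h.cplxW_w1] at hw1
  rw [h.cplxB_b0, hT0] at hb
  refine ⟨?_, ?_, ?_⟩
  · linear_combination hb
  · linear_combination hb - hw1 - √(a ^ 2 + 1) * a * Complex.I_sq
  · linear_combination hw0

theorem origami_values (h : Normalized hG a K Kinv) {O : G.DualVertex → ℂ}
    (hO : G.IsOrigami K (G.FB a Kinv) (G.FW a Kinv) O) (hO0 : O (G.v 0) = 0) :
    O (G.v 1) = -(a ^ 2 + 1) ∧ O (G.v 2) = 0 ∧ O (G.v 3) = -(a ^ 2 + 1) := by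
  have hb : O (G.v 1) - O (G.v 0) = (-a - Complex.I) * G.cplxB Kinv G.b0 := by
    have h1 := sum_black_diff hG O G.b0
    rw [if_pos rfl, if_neg G.b_ne, add_zero] at h1
    rw [← h1, Finset.sum_congr rfl fun e _ => (hO e).trans (origamiForm_eq a K Kinv e)]
    have h2 := congrArg conj (h.inv.sum_cplxW (G := G) G.b0)
    rw [if_pos rfl, if_neg G.b_ne, map_sum] at h2
    simp only [map_mul, Complex.conj_ofReal, map_one, zero_mul, add_zero] at h2
    rw [sum_black (fun b w => (-a - Complex.I) * G.cplxB Kinv b * (K b w * conj (G.cplxW Kinv w)))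
      (fun b w hbw => by rw [h.off b w hbw]; simp), ← Finset.mul_sum, h2, mul_one]
  have hw : ∀ w, ∑ e : G.Edge with e.1.2 = w, (O (G.rightV e) - O (G.leftV e)) =
      (-a - Complex.I) * conj (G.cplxW Kinv w) * ((if w = G.w0 then 1 else 0) +
        (if w = G.w1 then 1 else 0) * Complex.I) := by
    intro w
    rw [Finset.sum_congr rfl fun e _ => (hO e).trans (origamiForm_eq a K Kinv e)]
    rw [sum_white (fun b w => (-a - Complex.I) * G.cplxB Kinv b * (K b w * conj (G.cplxW Kinv w)))
      (fun b w hbw => by rw [h.off b w hbw]; simp), ← h.inv.sum_cplxB, Finset.mul_sum]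
    exact Finset.sum_congr rfl fun b _ => by ring
  have hw0 := (sum_white_diff hG O G.w0).symm.trans (hw G.w0)
  have hw1 := (sum_white_diff hG O G.w1).symm.trans (hw G.w1)
  rw [if_pos rfl, if_neg G.w_ne, if_pos rfl, if_neg G.w_ne, h.cplxW_w0, hO0] at hw0
  rw [if_neg G.w_ne.symm, if_pos rfl, if_neg G.w_ne.symm, if_pos rfl, h.cplxW_w1] at hw1
  rw [h.cplxB_b0, hO0] at hb
  simp only [map_add, map_neg, map_one, map_mul, Complex.conj_ofReal, Complex.conj_I] at hw0 hw1
  refine ⟨?_, ?_, ?_⟩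
  · linear_combination hb + Complex.I_sq
  · linear_combination hb - hw1 - (a * Complex.I + a ^ 2) * Complex.I_sq
  · linear_combination hw0 + Complex.I_sq

end Normalized

end Values

end QuadGraph

namespace QuadGraph

section Embedding

set_option linter.unusedSectionVars false

open scoped Classical
open QMap

variable {B W : Type*} [Fintype B] [Fintype W] [DecidableEq B] [DecidableEq W] {G : QuadGraph B W}

variable (G) in
/-- The initial vertex of a side of a black face. -/
noncomputable def labB : G.Edge ⊕ Bool → G.DualVertex
  | Sum.inl e => G.rightV e
  | Sum.inr false => G.v 0
  | Sum.inr true => G.v 2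

variable (G) in
/-- The initial vertex of a side of a white face. -/
noncomputable def labW : G.Edge ⊕ Bool → G.DualVertex
  | Sum.inl e => G.leftV e
  | Sum.inr false => G.v 1
  | Sum.inr true => G.v 3

variable (hG : G.Nondegenerate)

theorem labB_inl (e : G.Edge) : G.labB ((G.toQMap hG).ρ (Sum.inl e)) = G.leftV e := by
  by_cases he : (G.toQMap hG).Bdd e
  · rw [ρ_inl _ he]; exact rightV_rotB hG he.1 he.2
  · rcases (G.toQMap hG).not_bdd he with rfl | rfl
    · rw [ρ_e00]; exact (leftV_e00 hG).symm
    · rw [ρ_e11]; exact (leftV_e11 hG).symm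

theorem labB_false : G.labB ((G.toQMap hG).ρ (Sum.inr false)) = G.v 1 := by
  rw [ρ_false]; exact rightV_e01 hG

theorem labB_true : G.labB ((G.toQMap hG).ρ (Sum.inr true)) = G.v 3 := by
  rw [ρ_true]; exact rightV_e10 hG

theorem labW_inl (e : G.Edge) : G.labW ((G.toQMap hG).swap.ρ (Sum.inl e)) = G.rightV e := by
  by_cases he : (G.toQMap hG).swap.Bdd e
  · rw [ρ_inl _ he]; exact leftV_rotW hG he.1 he.2
  · rcases (G.toQMap hG).swap.not_bdd he with rfl | rfl
    · rw [ρ_e00]; exact (rightV_e01 hG).symm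
    · rw [ρ_e11]; exact (rightV_e10 hG).symm

theorem labW_false : G.labW ((G.toQMap hG).swap.ρ (Sum.inr false)) = G.v 2 := by
  rw [ρ_false]; exact leftV_e11 hG

theorem labW_true : G.labW ((G.toQMap hG).swap.ρ (Sum.inr true)) = G.v 0 := by
  rw [ρ_true]; exact leftV_e00 hG

/-- The rotation along the sides of all faces. -/
noncomputable def rot : Equiv.Perm ((G.Edge ⊕ Bool) ⊕ (G.Edge ⊕ Bool)) :=
  Equiv.sumCongr (G.toQMap hG).ρ (G.toQMap hG).swap.ρ

/-- The face to which a side belongs. -/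
noncomputable def col : (G.Edge ⊕ Bool) ⊕ (G.Edge ⊕ Bool) → B ⊕ W :=
  Sum.map (G.toQMap hG).blx (G.toQMap hG).swap.blx

variable (G) in
/-- The initial vertex of a side of a face. -/
noncomputable def lab : (G.Edge ⊕ Bool) ⊕ (G.Edge ⊕ Bool) → G.DualVertex := Sum.elim G.labB G.labW

variable {hG} {a : ℝ} {K : Matrix B W ℝ} {Kinv : Matrix W B ℝ}

namespace Normalized

variable {T : G.DualVertex → ℂ}

theorem form (hT : G.IsTRealisation K (G.FB a Kinv) (G.FW a Kinv) T) (e : G.Edge) :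
    T (G.rightV e) - T (G.leftV e)
      = √(a ^ 2 + 1) * G.cplxB Kinv e.1.1 * (G.onEdge K e * G.cplxW Kinv e.1.2) :=
  (hT e).trans (form_eq a K Kinv e)

theorem eq_rhombus (h : Normalized hG a K Kinv)
    (hT : G.IsTRealisation K (G.FB a Kinv) (G.FW a Kinv) T) (hT0 : T (G.v 0) = 0) (k : Fin 4) :
    T (G.v k) = rhombus a √(a ^ 2 + 1) k := by
  obtain ⟨h1, h2, h3⟩ := h.boundary_values hT hT0
  fin_cases k
  · exact hT0
  · exact h1
  · exact h2
  · exact h3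

theorem exists_inner (h : Normalized hG a K Kinv)
    (hT : G.IsTRealisation K (G.FB a Kinv) (G.FW a Kinv) T) :
    (∃ t : ℝ, 0 < t ∧ T (G.rightV G.e00) = T (G.v 0) + t) ∧
    (∃ t : ℝ, 0 < t ∧ T (G.leftV G.e01) = T (G.v 1) + t * Complex.I) ∧
    (∃ t : ℝ, 0 < t ∧ T (G.rightV G.e11) = T (G.v 2) - t) ∧
    (∃ t : ℝ, 0 < t ∧ T (G.leftV G.e10) = T (G.v 3) - t * Complex.I) := by
  have hs : 0 < √(a ^ 2 + 1) * (a ^ 2 + 1) := mul_pos (sqrt_sq_add_one_pos a) (by positivity)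
  refine ⟨⟨√(a ^ 2 + 1) * (a ^ 2 + 1) * G.onEdge K G.e00, mul_pos hs h.k00_pos, ?_⟩,
    ⟨√(a ^ 2 + 1) * (a ^ 2 + 1) * -G.onEdge K G.e01, mul_pos hs (neg_pos.2 h.k01_neg), ?_⟩,
    ⟨√(a ^ 2 + 1) * (a ^ 2 + 1) * G.onEdge K G.e11, mul_pos hs h.k11_pos, ?_⟩,
    ⟨√(a ^ 2 + 1) * (a ^ 2 + 1) * G.onEdge K G.e10, mul_pos hs h.k10_pos, ?_⟩⟩
  · have h1 := form hT G.e00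
    rw [leftV_e00 hG] at h1
    change _ = _ * G.cplxB Kinv G.b0 * (_ * G.cplxW Kinv G.w0) at h1
    rw [h.cplxB_b0, h.cplxW_w0] at h1
    push_cast
    linear_combination h1 - √(a ^ 2 + 1) * G.onEdge K G.e00 * Complex.I_sq
  · have h1 := form hT G.e01
    rw [rightV_e01 hG] at h1
    change _ = _ * G.cplxB Kinv G.b0 * (_ * G.cplxW Kinv G.w1) at h1
    rw [h.cplxB_b0, h.cplxW_w1] at h1
    push_cast
    linear_combination -h1 + √(a ^ 2 + 1) * G.onEdge K G.e01 * a * Complex.I_sq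
  · have h1 := form hT G.e11
    rw [leftV_e11 hG] at h1
    change _ = _ * G.cplxB Kinv G.b1 * (_ * G.cplxW Kinv G.w1) at h1
    rw [h.cplxB_b1, h.cplxW_w1] at h1
    push_cast
    linear_combination h1 + √(a ^ 2 + 1) * G.onEdge K G.e11 * a ^ 2 * Complex.I_sq
  · have h1 := form hT G.e10
    rw [rightV_e10 hG] at h1
    change _ = _ * G.cplxB Kinv G.b1 * (_ * G.cplxW Kinv G.w0) at h1
    rw [h.cplxB_b1, h.cplxW_w0] at h1
    push_cast
    linear_combination -h1 - √(a ^ 2 + 1) * G.onEdge K G.e10 * a * Complex.I_sq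

theorem black_const_ne (h : Normalized hG a K Kinv) (b : B) :
    -(√(a ^ 2 + 1) * G.cplxB Kinv b : ℂ) ≠ 0 :=
  neg_ne_zero.2 (mul_ne_zero (Complex.ofReal_ne_zero.2 (sqrt_sq_add_one_pos a).ne')
    (h.cplxB_ne_zero b))

theorem white_const_ne (h : Normalized hG a K Kinv) (w : W) :
    (√(a ^ 2 + 1) * G.cplxW Kinv w : ℂ) ≠ 0 :=
  mul_ne_zero (Complex.ofReal_ne_zero.2 (sqrt_sq_add_one_pos a).ne') (h.cplxW_ne_zero w)

theorem polyB (h : Normalized hG a K Kinv)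
    (hT : G.IsTRealisation K (G.FB a Kinv) (G.FW a Kinv) T) (hT0 : T (G.v 0) = 0) :
    (G.toQMap hG).Poly (G.onEdge K) (fun w => Kinv w G.b0) (fun w => Kinv w G.b1)
      (fun b => -(√(a ^ 2 + 1) * G.cplxB Kinv b)) (T ∘ G.labB) := by
  have hs := sqrt_sq_add_one_pos a
  have ha := h.a_pos
  obtain ⟨v1, v2, v3⟩ := h.boundary_values hT hT0
  obtain ⟨⟨t0, ht0, e0⟩, ⟨t1, ht1, e1⟩, ⟨t2, ht2, e2⟩, ⟨t3, ht3, e3⟩⟩ := h.exists_inner hT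
  have hst0 := mul_pos hs ht0
  have hst1 := mul_pos hs ht1
  have hst2 := mul_pos hs ht2
  have hst3 := mul_pos hs ht3
  refine Poly.of_corners h.convB h.black_const_ne ?_ ?_ ?_ ?_ ?_
  · intro e
    simp only [Function.comp_apply]
    rw [labB_inl, labB]
    have := form hT e
    change _ = -(√(a ^ 2 + 1) * G.cplxB Kinv e.1.1) * (G.onEdge K e * G.cplxW Kinv e.1.2)
    linear_combination -this
  · change 0 < crs (T (G.v 0) - T (G.rightV G.e00)) (T (G.rightV G.e01) - T (G.v 0))
    rw [rightV_e01 hG, e0, v1, hT0]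
    simp [crs_eq]; linarith
  · rw [Function.comp_apply, Function.comp_apply, Function.comp_apply, labB_inl]
    change 0 < crs (T (G.rightV G.e01) - T (G.v 0)) (T (G.leftV G.e01) - T (G.rightV G.e01))
    rw [rightV_e01 hG, e1, v1, hT0]
    simp [crs_eq]; positivity
  · change 0 < crs (T (G.v 2) - T (G.rightV G.e11)) (T (G.rightV G.e10) - T (G.v 2))
    rw [rightV_e10 hG, e2, v3, v2]
    simp [crs_eq]; linarith
  · rw [Function.comp_apply, Function.comp_apply, Function.comp_apply, labB_inl]
    change 0 < crs (T (G.rightV G.e10) - T (G.v 2)) (T (G.leftV G.e10) - T (G.rightV G.e10))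
    rw [rightV_e10 hG, e3, v3, v2]
    simp [crs_eq]; nlinarith [mul_pos ha hst3]

theorem polyW (h : Normalized hG a K Kinv)
    (hT : G.IsTRealisation K (G.FB a Kinv) (G.FW a Kinv) T) (hT0 : T (G.v 0) = 0) :
    (G.toQMap hG).swap.Poly (G.onEdge K) (fun b => Kinv G.w0 b) (fun b => Kinv G.w1 b)
      (fun w => √(a ^ 2 + 1) * G.cplxW Kinv w) (T ∘ G.labW) := by
  have hs := sqrt_sq_add_one_pos a
  have ha := h.a_pos
  obtain ⟨v1, v2, v3⟩ := h.boundary_values hT hT0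
  obtain ⟨⟨t0, ht0, e0⟩, ⟨t1, ht1, e1⟩, ⟨t2, ht2, e2⟩, ⟨t3, ht3, e3⟩⟩ := h.exists_inner hT
  have hst0 := mul_pos hs ht0
  have hst1 := mul_pos ha (mul_pos hs ht1)
  have hst2 := mul_pos hs ht2
  have hst3 := mul_pos ha (mul_pos hs ht3)
  refine Poly.of_corners h.convW h.white_const_ne ?_ ?_ ?_ ?_ ?_
  · intro e
    simp only [Function.comp_apply]
    rw [labW_inl, labW]
    have := form hT e
    change _ = (√(a ^ 2 + 1) * G.cplxW Kinv e.1.2) * (G.onEdge K e * G.cplxB Kinv e.1.1)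
    linear_combination this
  · change 0 < crs (T (G.v 1) - T (G.leftV G.e01)) (T (G.leftV G.e11) - T (G.v 1))
    rw [leftV_e11 hG, e1, v1, v2]
    simp [crs_eq]; nlinarith
  · rw [Function.comp_apply, Function.comp_apply, Function.comp_apply]
    change 0 < crs (T (G.leftV G.e11) - T (G.v 1))
      (T (G.labW ((G.toQMap hG).swap.ρ (Sum.inl G.e11))) - T (G.leftV G.e11))
    rw [labW_inl, leftV_e11 hG, e2, v1, v2]
    simp [crs_eq]; linarith
  · change 0 < crs (T (G.v 3) - T (G.leftV G.e10)) (T (G.leftV G.e00) - T (G.v 3))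
    rw [leftV_e00 hG, e3, v3, hT0]
    simp [crs_eq]; nlinarith
  · rw [Function.comp_apply, Function.comp_apply, Function.comp_apply]
    change 0 < crs (T (G.leftV G.e00) - T (G.v 3))
      (T (G.labW ((G.toQMap hG).swap.ρ (Sum.inl G.e00))) - T (G.leftV G.e00))
    rw [labW_inl, leftV_e00 hG, e0, v3, hT0]
    simp [crs_eq]; linarith

theorem tiling (h : Normalized hG a K Kinv)
    (hT : G.IsTRealisation K (G.FB a Kinv) (G.FW a Kinv) T) (hT0 : T (G.v 0) = 0) :
    Tiling (rot hG) (col hG) (T ∘ G.lab) a √(a ^ 2 + 1) where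
  a_pos := h.a_pos
  s_pos := sqrt_sq_add_one_pos a
  c_ρ := by
    rintro (y | y)
    · exact congrArg Sum.inl ((G.toQMap hG).blx_ρ y)
    · exact congrArg Sum.inr ((G.toQMap hG).swap.blx_ρ y)
  induct := by
    rintro P hP (y | y) (y' | y') hc hy
    · exact (G.toQMap hG).ρ_induct (fun y => P (Sum.inl y)) (fun y => hP (Sum.inl y))
        (Sum.inl_injective hc) hy
    · cases hc
    · cases hc
    · exact (G.toQMap hG).swap.ρ_induct (fun y => P (Sum.inr y)) (fun y => hP (Sum.inr y))
        (Sum.inr_injective hc) hy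
  convex := by
    rintro (y | y) (y' | y') hc h1 h2
    · exact (h.polyB hT hT0).strict_convex h.convB h.kast h.black_const_ne (Sum.inl_injective hc)
        (fun h => h1 (congrArg Sum.inl h)) (fun h => h2 (congrArg Sum.inl h))
    · cases hc
    · cases hc
    · exact (h.polyW hT hT0).strict_convex h.convW h.kast.swap h.white_const_ne
        (Sum.inr_injective hc) (fun h => h1 (congrArg Sum.inr h)) (fun h => h2 (congrArg Sum.inr h))
  corner := by
    rintro (y | y)
    · exact (h.polyB hT hT0).corner y
    · exact (h.polyW hT hT0).corner y
  bdry := by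
    intro g hg
    have e1 : ∀ e : G.Edge, g (T (G.labB (Sum.inl e)))
        (T (G.labB ((G.toQMap hG).ρ (Sum.inl e)))) = g (T (G.rightV e)) (T (G.leftV e)) := fun e => by
      rw [labB_inl]; rfl
    have e2 : ∀ e : G.Edge, g (T (G.labW (Sum.inl e)))
        (T (G.labW ((G.toQMap hG).swap.ρ (Sum.inl e)))) = -g (T (G.rightV e)) (T (G.leftV e)) :=
      fun e => by rw [labW_inl, ← hg]; rfl
    rw [Fintype.sum_sum_type, Fintype.sum_sum_type, Fintype.sum_sum_type, Fin.sum_univ_four]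
    simp only [Function.comp_apply, rot, lab, Equiv.sumCongr_apply, Sum.map_inl, Sum.map_inr,
      Sum.elim_inl, Sum.elim_inr, e1, e2, Fintype.sum_bool, labB_false, labB_true, labW_false,
      labW_true, Finset.sum_neg_distrib]
    simp only [labB, labW, h.eq_rhombus hT hT0]
    change _ = g (rhombus a √(a ^ 2 + 1) 0) (rhombus a √(a ^ 2 + 1) 1) +
      g (rhombus a √(a ^ 2 + 1) 1) (rhombus a √(a ^ 2 + 1) 2) +
      g (rhombus a √(a ^ 2 + 1) 2) (rhombus a √(a ^ 2 + 1) 3) +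
      g (rhombus a √(a ^ 2 + 1) 3) (rhombus a √(a ^ 2 + 1) 0)
    ring

end Normalized

end Embedding

end QuadGraph

namespace QuadGraph

section Embedding

set_option linter.unusedSectionVars false

open scoped Classical
open QMap

variable {B W : Type*} [Fintype B] [Fintype W] [DecidableEq B] [DecidableEq W] {G : QuadGraph B W}

theorem exists_side (hG : G.Nondegenerate) (i : B ⊕ W) : ∃ y, col hG y = i := by
  rcases i with b | w
  · obtain ⟨e, rfl⟩ := G.black_surjective b
    exact ⟨Sum.inl (Sum.inl e), rfl⟩
  · obtain ⟨e, rfl⟩ := G.white_surjective w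
    exact ⟨Sum.inr (Sum.inl e), rfl⟩

theorem lab_surjective (hG : G.Nondegenerate) : Function.Surjective G.lab := by
  intro x
  rcases exists_eq_leftV_or_rightV hG x with ⟨e, rfl⟩ | ⟨e, rfl⟩
  · exact ⟨Sum.inr (Sum.inl e), rfl⟩
  · exact ⟨Sum.inl (Sum.inl e), rfl⟩

variable (G) in
/-- The permutation that takes each corner at an inner vertex of the dual to the next one. -/
noncomputable def nextCorner : Equiv.Perm ((G.Edge ⊕ Bool) ⊕ (G.Edge ⊕ Bool)) :=
  (Equiv.sumCongr (Equiv.sumCongr G.rotW⁻¹ (Equiv.refl Bool))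
    (Equiv.sumCongr G.rotB⁻¹ (Equiv.refl Bool))).trans (Equiv.sumComm _ _)

theorem rightV_rotW_inv (e : G.Edge) {f : {f : G.Face // f ≠ G.outer}} :
    G.rightV (G.rotW⁻¹ e) = Sum.inl f ↔ G.leftV e = Sum.inl f := by
  rw [rightV_eq_inl_iff, leftV_eq_inl_iff, ← leftFace_rotW]; simp

theorem leftV_rotB_inv (e : G.Edge) {f : {f : G.Face // f ≠ G.outer}} :
    G.leftV (G.rotB⁻¹ e) = Sum.inl f ↔ G.rightV e = Sum.inl f := by
  rw [rightV_eq_inl_iff, leftV_eq_inl_iff, ← rightFace_rotB]; simp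

theorem lab_rot_inl_inr (hG : G.Nondegenerate) (o : Bool) (f : {f : G.Face // f ≠ G.outer}) :
    G.lab (rot hG (Sum.inl (Sum.inr o))) ≠ Sum.inl f := by
  cases o
  · exact fun h => by cases (labB_false hG).symm.trans h
  · exact fun h => by cases (labB_true hG).symm.trans h

theorem lab_rot_inr_inr (hG : G.Nondegenerate) (o : Bool) (f : {f : G.Face // f ≠ G.outer}) :
    G.lab (rot hG (Sum.inr (Sum.inr o))) ≠ Sum.inl f := by
  cases o
  · exact fun h => by cases (labW_false hG).symm.trans h
  · exact fun h => by cases (labW_true hG).symm.trans h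

variable (G) in
/-- The side of a face along an outer edge. -/
noncomputable def outerSide : Fin 4 → (G.Edge ⊕ Bool) ⊕ (G.Edge ⊕ Bool) :=
  ![Sum.inl (Sum.inr false), Sum.inr (Sum.inr false), Sum.inl (Sum.inr true),
    Sum.inr (Sum.inr true)]

theorem outerSide_injective : Function.Injective G.outerSide := by
  intro k l h
  fin_cases k <;> fin_cases l <;> first | rfl | (simp [outerSide] at h)

theorem lab_outerSide (k : Fin 4) : G.lab (G.outerSide k) = G.v k := by
  fin_cases k <;> rfl

theorem lab_rot_outerSide (hG : G.Nondegenerate) (k : Fin 4) :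
    G.lab (rot hG (G.outerSide k)) = G.v (k + 1) := by
  fin_cases k
  · exact labB_false hG
  · exact labW_false hG
  · exact labB_true hG
  · exact labW_true hG

theorem outerSide_ne (k : Fin 4) (e : G.Edge) : G.outerSide k ≠ Sum.inl (Sum.inl e) ∧
    G.outerSide k ≠ Sum.inr (Sum.inl e) := by
  fin_cases k <;> simp [outerSide]

variable {hG : G.Nondegenerate} {a : ℝ} {K : Matrix B W ℝ} {Kinv : Matrix W B ℝ}

namespace Normalized

variable {T : G.DualVertex → ℂ}

theorem lab_eq_of_eq (h : Normalized hG a K Kinv)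
    (hT : G.IsTRealisation K (G.FB a Kinv) (G.FW a Kinv) T) (hT0 : T (G.v 0) = 0)
    {f : {f : G.Face // f ≠ G.outer}} {y : (G.Edge ⊕ Bool) ⊕ (G.Edge ⊕ Bool)}
    (hy : T (G.lab y) = T (Sum.inl f)) : G.lab y = Sum.inl f := by
  have hti := h.tiling hT hT0
  obtain ⟨y', hy', hc⟩ := hti.exists_of_mem_vertex (exists_side hG) (z := T (Sum.inl f))
    (C := Finset.univ.filter fun y => G.lab (rot hG y) = Sum.inl f) (i := col hG y) (by
      obtain ⟨e, he⟩ := Quotient.exists_rep f.1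
      refine ⟨Sum.inl (Sum.inl e), Finset.mem_filter.2 ⟨Finset.mem_univ _, ?_⟩⟩
      exact (labB_inl hG e).trans (leftV_eq_inl_iff.2 he)) G.nextCorner (by
      rintro ((e | o) | (e | o)) <;>
        rw [Finset.mem_filter, Finset.mem_filter, and_iff_right (Finset.mem_univ _),
          and_iff_right (Finset.mem_univ _)]
      · change G.labW ((G.toQMap hG).swap.ρ (Sum.inl (G.rotW⁻¹ e))) = _ ↔
          G.labB ((G.toQMap hG).ρ (Sum.inl e)) = _
        rw [labB_inl, labW_inl, rightV_rotW_inv]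
      · exact iff_of_false (lab_rot_inr_inr hG o f) (lab_rot_inl_inr hG o f)
      · change G.labB ((G.toQMap hG).ρ (Sum.inl (G.rotB⁻¹ e))) = _ ↔
          G.labW ((G.toQMap hG).swap.ρ (Sum.inl e)) = _
        rw [labB_inl, labW_inl, leftV_rotB_inv]
      · exact iff_of_false (lab_rot_inl_inr hG o f) (lab_rot_inr_inr hG o f)) (by
      intro y hy
      exact congrArg T (Finset.mem_filter.1 hy).2) (by
      rintro ((e | o) | (e | o)) hy
      · have hl : G.leftV e = Sum.inl f := (labB_inl hG e).symm.trans (Finset.mem_filter.1 hy).2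
        change T (G.labW ((G.toQMap hG).swap.ρ ((G.toQMap hG).swap.ρ (Sum.inl (G.rotW⁻¹ e)))))
          = T (G.rightV e)
        have hbd : (G.toQMap hG).swap.Bdd (G.rotW⁻¹ e) := by
          constructor
          · intro h'
            have h1 := (rightV_rotW_inv e).2 hl
            rw [h'] at h1
            cases (rightV_e01 hG).symm.trans h1
          · intro h'
            have h1 := (rightV_rotW_inv e).2 hl
            rw [h'] at h1
            cases (rightV_e10 hG).symm.trans h1
        rw [ρ_inl _ hbd]
        change T (G.labW ((G.toQMap hG).swap.ρ (Sum.inl (G.rotW (G.rotW⁻¹ e))))) = _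
        rw [labW_inl]; simp
      · exact absurd (Finset.mem_filter.1 hy).2 (lab_rot_inl_inr hG o f)
      · have hl : G.rightV e = Sum.inl f := (labW_inl hG e).symm.trans (Finset.mem_filter.1 hy).2
        change T (G.labB ((G.toQMap hG).ρ ((G.toQMap hG).ρ (Sum.inl (G.rotB⁻¹ e)))))
          = T (G.leftV e)
        have hbd : (G.toQMap hG).Bdd (G.rotB⁻¹ e) := by
          constructor
          · intro h'
            have h1 := (leftV_rotB_inv e).2 hl
            rw [h'] at h1
            cases (leftV_e00 hG).symm.trans h1
          · intro h'
            have h1 := (leftV_rotB_inv e).2 hl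
            rw [h'] at h1
            cases (leftV_e11 hG).symm.trans h1
        rw [ρ_inl _ hbd]
        change T (G.labB ((G.toQMap hG).ρ (Sum.inl (G.rotB (G.rotB⁻¹ e))))) = _
        rw [labB_inl]; simp
      · exact absurd (Finset.mem_filter.1 hy).2 (lab_rot_inr_inr hG o f))
    (by rw [← hy]; exact Tiling.mem_hull (p := T ∘ G.lab) y)
  have hlab := (Finset.mem_filter.1 hy').2
  have h2 : y = rot hG y' := hti.p_injOn ((hti.c_ρ y').trans hc).symm (by
    rw [Function.comp_apply, Function.comp_apply, hlab, hy])
  rw [h2, hlab]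

theorem injective (h : Normalized hG a K Kinv)
    (hT : G.IsTRealisation K (G.FB a Kinv) (G.FW a Kinv) T) (hT0 : T (G.v 0) = 0) :
    Function.Injective T := by
  intro x x' hxx
  rcases x with f | k
  · obtain ⟨y, rfl⟩ := lab_surjective hG x'
    exact (h.lab_eq_of_eq hT hT0 hxx.symm).symm
  rcases x' with f | l
  · obtain ⟨y, hy⟩ := lab_surjective hG (Sum.inr k)
    rw [← hy] at hxx ⊢
    exact h.lab_eq_of_eq hT hT0 hxx
  have hs := (sqrt_sq_add_one_pos a).ne'
  have ha := h.a_pos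
  have hre := congrArg Complex.re ((h.eq_rhombus hT hT0 k).symm.trans (hxx.trans
    (h.eq_rhombus hT hT0 l)))
  have him := congrArg Complex.im ((h.eq_rhombus hT hT0 k).symm.trans (hxx.trans
    (h.eq_rhombus hT hT0 l)))
  congr 1
  set s := √(a ^ 2 + 1)
  have hs' : 0 < s := sqrt_sq_add_one_pos a
  have has := mul_pos ha hs'
  fin_cases k <;> fin_cases l <;> first | rfl | (exfalso; simp [rhombus] at hre him; nlinarith) |
    (exfalso; simp [rhombus, ha.ne', hs] at hre him)

theorem segment_subset_black (e : G.Edge) :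
    segment ℝ (T (G.leftV e)) (T (G.rightV e))
      ⊆ Tiling.hull (col hG) (T ∘ G.lab) (Sum.inl e.1.1) := by
  refine (Tiling.convex_hull _).segment_subset ?_ ?_
  · rw [← labB_inl hG e]
    exact Tiling.mem_hull' (c := col hG) (p := T ∘ G.lab)
      (y := Sum.inl ((G.toQMap hG).ρ (Sum.inl e))) (congrArg Sum.inl ((G.toQMap hG).blx_ρ _))
  · exact Tiling.mem_hull' (c := col hG) (p := T ∘ G.lab) (y := Sum.inl (Sum.inl e)) rfl

theorem segment_subset_white (e : G.Edge) :
    segment ℝ (T (G.leftV e)) (T (G.rightV e))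
      ⊆ Tiling.hull (col hG) (T ∘ G.lab) (Sum.inr e.1.2) := by
  refine (Tiling.convex_hull _).segment_subset ?_ ?_
  · exact Tiling.mem_hull' (c := col hG) (p := T ∘ G.lab) (y := Sum.inr (Sum.inl e)) rfl
  · rw [← labW_inl hG e]
    exact Tiling.mem_hull' (c := col hG) (p := T ∘ G.lab)
      (y := Sum.inr ((G.toQMap hG).swap.ρ (Sum.inl e)))
      (congrArg Sum.inr ((G.toQMap hG).swap.blx_ρ _))

theorem segment_subset_outer (h : Normalized hG a K Kinv)
    (hT : G.IsTRealisation K (G.FB a Kinv) (G.FW a Kinv) T) (hT0 : T (G.v 0) = 0) (k : Fin 4) :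
    segment ℝ (T (G.v k)) (T (G.v (k + 1)))
      ⊆ Tiling.hull (col hG) (T ∘ G.lab) (col hG (G.outerSide k)) := by
  rw [← lab_outerSide, ← lab_rot_outerSide hG]
  exact (Tiling.convex_hull _).segment_subset (Tiling.mem_hull _)
    (Tiling.mem_hull' ((h.tiling hT hT0).c_ρ _))

/-- The interior of an edge of the dual meets no other edge. -/
theorem eq_of_mem_openSegment (h : Normalized hG a K Kinv)
    (hT : G.IsTRealisation K (G.FB a Kinv) (G.FW a Kinv) T) (hT0 : T (G.v 0) = 0)
    {ε ε' : G.DualEdge} {z : ℂ} (hz : z ∈ openSegment ℝ (T (G.fst ε)) (T (G.snd ε)))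
    (hz' : z ∈ segment ℝ (T (G.fst ε')) (T (G.snd ε'))) : ε = ε' := by
  have hti := h.tiling hT hT0
  rcases ε with e | k
  · have hB : z ∈ openSegment ℝ ((T ∘ G.lab) (Sum.inl (Sum.inl e)))
        ((T ∘ G.lab) (rot hG (Sum.inl (Sum.inl e)))) := by
      have : G.lab (rot hG (Sum.inl (Sum.inl e))) = G.leftV e := labB_inl hG e
      rw [Function.comp_apply, Function.comp_apply, this, openSegment_symm]
      exact hz
    have hW : z ∈ openSegment ℝ ((T ∘ G.lab) (Sum.inr (Sum.inl e)))
        ((T ∘ G.lab) (rot hG (Sum.inr (Sum.inl e)))) := by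
      have : G.lab (rot hG (Sum.inr (Sum.inl e))) = G.rightV e := labW_inl hG e
      rw [Function.comp_apply, Function.comp_apply, this]
      exact hz
    have key : ∀ i, z ∈ Tiling.hull (col hG) (T ∘ G.lab) i → i = Sum.inl e.1.1 ∨ i = Sum.inr e.1.2 :=
      fun i hi => hti.eq_of_mem_inner_side (exists_side hG) (y := Sum.inl (Sum.inl e))
        (y' := Sum.inr (Sum.inl e)) (congrArg T (labB_inl hG e).symm)
        (congrArg T (labW_inl hG e)) hB hi
    rcases ε' with e' | k
    · have h1 := key _ (segment_subset_black e' hz')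
      have h2 := key _ (segment_subset_white e' hz')
      simp only [Sum.inl.injEq, Sum.inr.injEq, reduceCtorEq, or_false, false_or] at h1 h2
      exact congrArg Sum.inl (Subtype.ext (Prod.ext h1.symm h2.symm))
    · exfalso
      have hz'' : z ∈ segment ℝ ((T ∘ G.lab) (G.outerSide k))
          ((T ∘ G.lab) (rot hG (G.outerSide k))) := by
        rw [Function.comp_apply, Function.comp_apply, lab_outerSide, lab_rot_outerSide]
        exact hz'
      rcases key _ (h.segment_subset_outer hT hT0 k hz') with hc | hc
      · exact (outerSide_ne k e).1 (hti.side_unique hc hB hz'')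
      · exact (outerSide_ne k e).2 (hti.side_unique hc hW hz'')
  · have hO : z ∈ openSegment ℝ ((T ∘ G.lab) (G.outerSide k))
        ((T ∘ G.lab) (rot hG (G.outerSide k))) := by
      rw [Function.comp_apply, Function.comp_apply, lab_outerSide, lab_rot_outerSide]
      exact hz
    have key : ∀ i, z ∈ Tiling.hull (col hG) (T ∘ G.lab) i → i = col hG (G.outerSide k) :=
      fun i hi => hti.eq_of_mem_outer_side (exists_side hG) (k := k)
        (by rw [Function.comp_apply, lab_outerSide]; exact h.eq_rhombus hT hT0 k)
        (by rw [Function.comp_apply, lab_rot_outerSide]; exact h.eq_rhombus hT hT0 (k + 1)) hO hi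
    rcases ε' with e' | l
    · exfalso
      have h1 := key _ (segment_subset_black e' hz')
      have h2 := key _ (segment_subset_white e' hz')
      cases h1.trans h2.symm
    · have hz'' : z ∈ segment ℝ ((T ∘ G.lab) (G.outerSide l))
          ((T ∘ G.lab) (rot hG (G.outerSide l))) := by
        rw [Function.comp_apply, Function.comp_apply, lab_outerSide, lab_rot_outerSide]
        exact hz'
      have hc := key _ (h.segment_subset_outer hT hT0 l hz')
      exact congrArg Sum.inr (outerSide_injective (hti.side_unique hc hO hz'')).symm

theorem isStraightEmbedding (h : Normalized hG a K Kinv)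
    (hT : G.IsTRealisation K (G.FB a Kinv) (G.FW a Kinv) T) (hT0 : T (G.v 0) = 0) :
    G.IsStraightEmbedding T := by
  have hti := h.tiling hT hT0
  refine ⟨h.injective hT hT0, ?_, ?_⟩
  · rintro (e | k) heq
    · refine hti.side_ne (Sum.inr (Sum.inl e)) ?_
      have : G.lab (rot hG (Sum.inr (Sum.inl e))) = G.rightV e := labW_inl hG e
      rw [Function.comp_apply, Function.comp_apply, this, sub_eq_zero]
      exact congrArg T heq.symm
    · have : k = k + 1 := Sum.inr_injective heq
      fin_cases k <;> simp at this
  · rintro ε ε' hne z ⟨hz, hz'⟩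
    have h1 : z ∉ openSegment ℝ (T (G.fst ε)) (T (G.snd ε)) := fun h1 =>
      hne (h.eq_of_mem_openSegment hT hT0 h1 hz')
    have h2 : z ∉ openSegment ℝ (T (G.fst ε')) (T (G.snd ε')) := fun h2 =>
      hne (h.eq_of_mem_openSegment hT hT0 h2 hz).symm
    rw [← insert_endpoints_openSegment, Set.mem_insert_iff, Set.mem_insert_iff, ← or_assoc,
      or_iff_left h1] at hz
    rw [← insert_endpoints_openSegment, Set.mem_insert_iff, Set.mem_insert_iff, ← or_assoc,
      or_iff_left h2] at hz'
    have hx : ∃ x, (x = G.fst ε ∨ x = G.snd ε) ∧ z = T x := by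
      rcases hz with hz | hz
      · exact ⟨_, Or.inl rfl, hz⟩
      · exact ⟨_, Or.inr rfl, hz⟩
    have hx' : ∃ x, (x = G.fst ε' ∨ x = G.snd ε') ∧ z = T x := by
      rcases hz' with hz | hz
      · exact ⟨_, Or.inl rfl, hz⟩
      · exact ⟨_, Or.inr rfl, hz⟩
    obtain ⟨x, hx, e1⟩ := hx
    obtain ⟨x', hx', e2⟩ := hx'
    obtain rfl := h.injective hT hT0 (e1.symm.trans e2)
    exact ⟨x, hx, hx', e1⟩

end Normalized

end Embedding

end QuadGraph

/-! ### The rhombus -/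

section Rhombus

variable {a s : ℝ}

theorem exists_mem_segment {P Q : ℂ} (l : ℝ) (h0 : 0 ≤ l) (h1 : l ≤ 1) :
    P + l * (Q - P) ∈ segment ℝ P Q :=
  ⟨1 - l, l, by linarith, h0, by ring, by
    rw [Complex.real_smul, Complex.real_smul]; push_cast; ring⟩

/-- The open rhombus. -/
def openRhombus (a s : ℝ) : Set ℂ :=
  {z | 0 < a * z.im + z.re ∧ 0 < a * z.im + 2 * a * s - z.re ∧ 0 < -(a * z.im) + 2 * a * s - z.re ∧
      0 < -(a * z.im) + z.re}

theorem isOpen_openRhombus : IsOpen (openRhombus a s) := by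
  have h : ∀ f : ℂ → ℝ, Continuous f → IsOpen {z | 0 < f z} := fun f hf =>
    isOpen_lt continuous_const hf
  exact (h (fun z => a * z.im + z.re) (by fun_prop)).inter
    ((h (fun z => a * z.im + 2 * a * s - z.re) (by fun_prop)).inter
    ((h (fun z => -(a * z.im) + 2 * a * s - z.re) (by fun_prop)).inter
    (h (fun z => -(a * z.im) + z.re) (by fun_prop))))

theorem mem_polygonLine_of_mem_closedRhombus (ha : 0 < a) (hs : 0 < s) {z : ℂ}
    (hz : z ∈ Tiling.closedRhombus a s) (hz' : z ∉ openRhombus a s) :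
    z ∈ QuadGraph.polygonLine (rhombus a s) := by
  rw [Tiling.mem_closedRhombus hs] at hz
  obtain ⟨h0, h1, h2, h3⟩ := hz
  have hmem : ∀ k, ∀ l : ℝ, 0 ≤ l → l ≤ 1 →
      z = rhombus a s k + l * (rhombus a s (k + 1) - rhombus a s k) →
      z ∈ QuadGraph.polygonLine (rhombus a s) := fun k l hl hl' hz =>
    Set.mem_iUnion.2 ⟨k, hz ▸ exists_mem_segment l hl hl'⟩
  have hy1 : z.im ≤ s := by
    have : 0 ≤ a * (s - z.im) := by linarith
    linarith [(mul_nonneg_iff_of_pos_left ha).1 this]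
  have hy2 : -s ≤ z.im := by
    have : 0 ≤ a * (s + z.im) := by linarith
    linarith [(mul_nonneg_iff_of_pos_left ha).1 this]
  have hy1' : z.im / s ≤ 1 := (div_le_one hs).2 hy1
  have hy2' : -1 ≤ z.im / s := by rw [le_div_iff₀ hs]; linarith
  have hys : z.im / s * s = z.im := div_mul_cancel₀ _ hs.ne'
  have r1 : rhombus a s 1 = (a - Complex.I) * s := rfl
  have r2 : rhombus a s 2 = 2 * a * s := rfl
  have r3 : rhombus a s 3 = (a + Complex.I) * s := rfl
  have r0 : rhombus a s 0 = 0 := rfl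
  by_cases c0 : a * z.im + z.re = 0
  · have hy : z.im / s ≤ 0 := by
      refine div_nonpos_of_nonpos_of_nonneg ?_ hs.le
      have : 0 ≤ a * -z.im := by linarith
      linarith [(mul_nonneg_iff_of_pos_left ha).1 this]
    refine hmem 0 (-(z.im / s)) (by linarith) (by linarith) ?_
    change z = rhombus a s 0 + _ * (rhombus a s 1 - rhombus a s 0)
    rw [r0, r1]
    apply Complex.ext <;> simp
    · linear_combination c0 + a * hys
    · linear_combination -hys
  by_cases c1 : a * z.im + 2 * a * s - z.re = 0
  · have hy : z.im / s ≤ 0 := by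
      refine div_nonpos_of_nonpos_of_nonneg ?_ hs.le
      have : 0 ≤ a * -z.im := by linarith
      linarith [(mul_nonneg_iff_of_pos_left ha).1 this]
    refine hmem 1 (1 + z.im / s) (by linarith) (by linarith) ?_
    change z = rhombus a s 1 + _ * (rhombus a s 2 - rhombus a s 1)
    rw [r1, r2]
    apply Complex.ext <;> simp
    · linear_combination -c1 - a * hys
    · linear_combination -hys
  by_cases c2 : -(a * z.im) + 2 * a * s - z.re = 0
  · have hy : 0 ≤ z.im / s := by
      refine div_nonneg ?_ hs.le
      have : 0 ≤ a * z.im := by linarith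
      exact (mul_nonneg_iff_of_pos_left ha).1 this
    refine hmem 2 (z.im / s) (by linarith) (by linarith) ?_
    change z = rhombus a s 2 + _ * (rhombus a s 3 - rhombus a s 2)
    rw [r2, r3]
    apply Complex.ext <;> simp
    · linear_combination -c2 + a * hys
    · linear_combination -hys
  by_cases c3 : -(a * z.im) + z.re = 0
  · have hy : 0 ≤ z.im / s := by
      refine div_nonneg ?_ hs.le
      have : 0 ≤ a * z.im := by linarith
      exact (mul_nonneg_iff_of_pos_left ha).1 this
    refine hmem 3 (1 - z.im / s) (by linarith) (by linarith) ?_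
    change z = rhombus a s 3 + _ * (rhombus a s 0 - rhombus a s 3)
    rw [r3, r0]
    apply Complex.ext <;> simp
    · linear_combination c3 - a * hys
    · linear_combination -hys
  exact absurd ⟨lt_of_le_of_ne h0 (Ne.symm c0), lt_of_le_of_ne h1 (Ne.symm c1),
    lt_of_le_of_ne h2 (Ne.symm c2), lt_of_le_of_ne h3 (Ne.symm c3)⟩ hz'

theorem notMem_polygonLine_of_mem_openRhombus {z : ℂ} (hz : z ∈ openRhombus a s) :
    z ∉ QuadGraph.polygonLine (rhombus a s) := by
  intro h
  obtain ⟨k, l₁, l₂, -, -, hl, rfl⟩ := Set.mem_iUnion.1 h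
  obtain ⟨h0, h1, h2, h3⟩ := hz
  obtain rfl : l₁ = 1 - l₂ := by linarith
  fin_cases k <;> simp [rhombus] at h0 h1 h2 h3 <;> nlinarith

theorem openRhombus_subset_closedRhombus (hs : 0 < s) :
    openRhombus a s ⊆ Tiling.closedRhombus a s := fun _ h =>
  (Tiling.mem_closedRhombus hs).2 ⟨h.1.le, h.2.1.le, h.2.2.1.le, h.2.2.2.le⟩

theorem isBounded_closedRhombus (ha : 0 < a) (hs : 0 < s) :
    Bornology.IsBounded (Tiling.closedRhombus a s) := by
  refine (Metric.isBounded_closedBall (x := (0 : ℂ)) (r := 2 * a * s + s)).subset fun z hz => ?_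
  obtain ⟨h0, h1, h2, h3⟩ := (Tiling.mem_closedRhombus hs).1 hz
  rw [mem_closedBall_zero_iff]
  refine (Complex.norm_le_abs_re_add_abs_im z).trans ?_
  have hx : |z.re| ≤ 2 * a * s := abs_le.2 ⟨by linarith, by linarith⟩
  have hy : |z.im| ≤ s := by
    refine abs_le.2 ⟨?_, ?_⟩
    · have : 0 ≤ a * (s + z.im) := by linarith
      linarith [(mul_nonneg_iff_of_pos_left ha).1 this]
    · have : 0 ≤ a * (s - z.im) := by linarith
      linarith [(mul_nonneg_iff_of_pos_left ha).1 this]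
  linarith

theorem openRhombus_subset_polygonInterior (ha : 0 < a) (hs : 0 < s) :
    openRhombus a s ⊆ QuadGraph.polygonInterior (rhombus a s) := by
  intro z hz
  have hz' := notMem_polygonLine_of_mem_openRhombus hz
  refine ⟨hz', (isBounded_closedRhombus ha hs).subset ?_⟩
  refine Set.Subset.trans ?_ (openRhombus_subset_closedRhombus hs)
  refine isPreconnected_connectedComponentIn.subset_left_of_subset_union isOpen_openRhombus
    (Tiling.isClosed_closedRhombus (a := a) (s := s)).isOpen_compl ?_ ?_
    ⟨z, mem_connectedComponentIn hz', hz⟩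
  · exact Set.disjoint_left.2 fun w hw hw' => hw' (openRhombus_subset_closedRhombus hs hw)
  · intro w hw
    have hw' := connectedComponentIn_subset _ _ hw
    by_cases h : w ∈ openRhombus a s
    · exact Or.inl h
    · exact Or.inr fun hc => hw' (mem_polygonLine_of_mem_closedRhombus ha hs hc h)

/-- The directions of the bisectors of the rhombus. -/
noncomputable def bisectorDir : Fin 4 → ℂ := ![1, Complex.I, -1, -Complex.I]

theorem rhombus_inward (ha : 0 < a) (hs : 0 < s) (k : Fin 4) {t : ℝ} (ht : 0 < t) :
    (openSegment ℝ (rhombus a s k) (rhombus a s k + t * bisectorDir k) ∩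
      QuadGraph.polygonInterior (rhombus a s)).Nonempty := by
  have has := mul_pos ha hs
  obtain ⟨ε, h0, h1⟩ := exists_between (lt_min ht (lt_min hs has))
  obtain ⟨h1, h2⟩ := lt_min_iff.1 h1
  obtain ⟨h2, h3⟩ := lt_min_iff.1 h2
  have haε := mul_pos ha h0
  have haε' := mul_lt_mul_of_pos_left h2 ha
  refine ⟨rhombus a s k + ε * bisectorDir k, ⟨1 - ε / t, ε / t, ?_, div_pos h0 ht, by ring, ?_⟩,
    openRhombus_subset_polygonInterior ha hs ?_⟩
  · rw [sub_pos, div_lt_one ht]; exact h1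
  · have : (t : ℂ) ≠ 0 := Complex.ofReal_ne_zero.2 ht.ne'
    rw [Complex.real_smul, Complex.real_smul]; push_cast; field_simp; ring
  · fin_cases k <;> refine ⟨?_, ?_, ?_, ?_⟩ <;> simp [rhombus, bisectorDir] <;> linarith

theorem angle_eq_angle {x y z : ℂ} (h : inner ℝ x y = inner ℝ y z) (hn : ‖x‖ = ‖z‖) :
    InnerProductGeometry.angle x y = InnerProductGeometry.angle y z := by
  rw [InnerProductGeometry.angle, InnerProductGeometry.angle, h, hn, mul_comm]

theorem rhombus_bisector (k : Fin 4) (t : ℝ) :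
    EuclideanGeometry.angle (rhombus a s (k + 1)) (rhombus a s k)
        (rhombus a s k + t * bisectorDir k) =
      EuclideanGeometry.angle (rhombus a s k + t * bisectorDir k) (rhombus a s k)
        (rhombus a s (k - 1)) := by
  unfold EuclideanGeometry.angle
  simp only [vsub_eq_sub, add_sub_cancel_left]
  have key : ∀ i j k : Fin 4, inner ℝ (rhombus a s i - rhombus a s j) (t * bisectorDir j) =
      inner ℝ (t * bisectorDir j) (rhombus a s k - rhombus a s j) →
      Complex.normSq (rhombus a s i - rhombus a s j)
        = Complex.normSq (rhombus a s k - rhombus a s j) →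
      InnerProductGeometry.angle (rhombus a s i - rhombus a s j) (t * bisectorDir j) =
      InnerProductGeometry.angle (t * bisectorDir j) (rhombus a s k - rhombus a s j) :=
    fun i j k h1 h2 => angle_eq_angle h1 (by rw [Complex.norm_def, Complex.norm_def, h2])
  fin_cases k
  · refine key 1 0 3 ?_ ?_
    · simp [rhombus, bisectorDir, Complex.inner]; ring
    · simp [rhombus, Complex.normSq_apply]
  · refine key 2 1 0 ?_ ?_ <;>
      simp [rhombus, bisectorDir, Complex.inner, Complex.normSq_apply] <;> ring
  · refine key 3 2 1 ?_ ?_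
    · simp [rhombus, bisectorDir, Complex.inner]; ring
    · simp [rhombus, Complex.normSq_apply]
  · refine key 0 3 2 ?_ ?_ <;>
      simp [rhombus, bisectorDir, Complex.inner, Complex.normSq_apply] <;> ring

theorem isTangential_rhombus (ha : 0 < a) :
    QuadGraph.IsTangential (rhombus a √(a ^ 2 + 1)) := by
  set s := √(a ^ 2 + 1) with hs
  have hn : ∀ x y : ℝ, x ^ 2 + y ^ 2 = a ^ 2 + 1 → ‖((x + y * Complex.I) * s : ℂ)‖ = s * s := by
    intro x y h
    rw [norm_mul, norm_ofReal_add_ofReal_mul_I a x y h, Complex.norm_real, Real.norm_eq_abs,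
      abs_of_pos (sqrt_sq_add_one_pos a)]
  have key : ∀ i j : Fin 4, ∀ x y : ℝ, x ^ 2 + y ^ 2 = a ^ 2 + 1 →
      rhombus a s j - rhombus a s i = (x + y * Complex.I) * s →
      (conj (rhombus a s j - rhombus a s i) * (a * s - rhombus a s i)).im = a * (s * s) →
      (conj (rhombus a s j - rhombus a s i) * (a * s - rhombus a s i)).im
        = a * ‖rhombus a s j - rhombus a s i‖ := by
    intro i j x y h h1 h2
    rw [h2, h1, hn x y h]
  refine ⟨a * s, a, ha, fun k => ?_⟩
  fin_cases k
  · refine key 0 1 a (-1) (by ring) ?_ ?_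
    · change ((a - Complex.I) * s - 0 : ℂ) = _
      push_cast; ring
    · simp [rhombus]; ring
  · refine key 1 2 a 1 (by ring) ?_ ?_
    · change (2 * a * s - (a - Complex.I) * s : ℂ) = _
      push_cast; ring
    · simp [rhombus]; ring
  · refine key 2 3 (-a) 1 (by ring) ?_ ?_
    · change ((a + Complex.I) * s - 2 * a * s : ℂ) = _
      push_cast; ring
    · simp [rhombus]; ring
  · refine key 3 0 (-a) (-1) (by ring) ?_ ?_
    · change (0 - (a + Complex.I) * s : ℂ) = _
      push_cast; ring
    · simp [rhombus]; ring

end Rhombus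

theorem Complex.arg_pos_of_im_pos {z : ℂ} (hz : 0 < z.im) : 0 < Complex.arg z :=
  lt_of_le_of_ne (Complex.arg_nonneg_iff.2 hz.le) fun h =>
    hz.ne' (Complex.arg_eq_zero_iff.1 h.symm).2

namespace QuadGraph

section Perfect

set_option linter.unusedSectionVars false

open scoped Classical
open QMap

variable {B W : Type*} [Fintype B] [Fintype W] [DecidableEq B] [DecidableEq W] {G : QuadGraph B W}
variable {hG : G.Nondegenerate} {a : ℝ} {K : Matrix B W ℝ} {Kinv : Matrix W B ℝ}

namespace Normalized

variable {T : G.DualVertex → ℂ}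

theorem blackAngle_eq (h : Normalized hG a K Kinv)
    (hT : G.IsTRealisation K (G.FB a Kinv) (G.FW a Kinv) T) {e : G.Edge}
    (he : (G.toQMap hG).Bdd e) : G.blackAngle T e = Complex.arg
      (-(G.onEdge K e * G.cplxW Kinv e.1.2) /
        (G.onEdge K (G.rotB e) * G.cplxW Kinv (G.rotB e).1.2)) := by
  have hb : (G.rotB e).1.1 = e.1.1 := (G.toQMap hG).bl_rB e
  have h1 := form hT e
  have h2 := form hT (G.rotB e)
  rw [rightV_rotB hG he.1 he.2, hb] at h2
  rw [blackAngle, ← neg_sub (T (G.leftV e)) (T (G.leftV (G.rotB e))), h1, h2, div_neg,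
    mul_div_mul_left _ _ (neg_ne_zero.1 (h.black_const_ne _)), neg_div]

theorem whiteAngle_eq (h : Normalized hG a K Kinv)
    (hT : G.IsTRealisation K (G.FB a Kinv) (G.FW a Kinv) T) {e : G.Edge}
    (he : (G.toQMap hG).swap.Bdd e) : G.whiteAngle T e = Complex.arg
      (-(G.onEdge K e * G.cplxB Kinv e.1.1) /
        (G.onEdge K (G.rotW e) * G.cplxB Kinv (G.rotW e).1.1)) := by
  have hb : (G.rotW e).1.2 = e.1.2 := (G.toQMap hG).wh_rW e
  have hform : ∀ e, T (G.rightV e) - T (G.leftV e)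
      = (√(a ^ 2 + 1) * G.cplxW Kinv e.1.2) * (G.onEdge K e * G.cplxB Kinv e.1.1) := fun e => by
    rw [form hT e]; ring
  have h1 := hform e
  have h2 := hform (G.rotW e)
  rw [leftV_rotW hG he.1 he.2, hb] at h2
  rw [whiteAngle, ← neg_sub (T (G.rightV e)) (T (G.leftV e)), h1, h2, neg_div,
    mul_div_mul_left _ _ (h.white_const_ne _), neg_div]

theorem angleCondition (h : Normalized hG a K Kinv)
    (hT : G.IsTRealisation K (G.FB a Kinv) (G.FW a Kinv) T) : G.AngleCondition T := by
  intro f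
  obtain ⟨e₀, he₀⟩ := Quotient.exists_rep f.1
  have hf : G.leftFace e₀ = f.1 := he₀
  have hbB : ∀ e, G.leftV e = Sum.inl f → (G.toQMap hG).Bdd e := fun e he =>
    (leftFace_ne_outer_iff hG).1 (by rw [leftV_eq_inl_iff.1 he]; exact f.2)
  have hbW : ∀ e, G.rightV e = Sum.inl f → (G.toQMap hG).swap.Bdd e := by
    intro e he
    constructor
    · rintro rfl
      cases (rightV_e01 hG).symm.trans he
    · rintro rfl
      cases (rightV_e10 hG).symm.trans he
  refine ⟨fun e he => ?_, fun e he => ?_, ?_, ?_⟩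
  · rw [h.blackAngle_eq hT (hbB e he)]
    exact Complex.arg_pos_of_im_pos (h.convB.im_pos (hbB e he))
  · rw [h.whiteAngle_eq hT (hbW e he)]
    exact Complex.arg_pos_of_im_pos (h.convW.im_pos (hbW e he))
  · have hs := h.convB.sum_arg h.kast (e := e₀) (hbB e₀ (leftV_eq_inl_iff.2 hf))
    rw [← hs]
    symm
    refine Finset.sum_congr (Finset.filter_eq_filter _ fun e => ?_) fun e he =>
      (h.blackAngle_eq hT (hbB e (Finset.mem_filter.1 he).2)).symm
    rw [leftV_eq_inl_iff, ← hf, eq_comm (b := G.leftFace e₀), leftFace_eq_iff hG]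
  · have hs := h.convW.sum_arg h.kast.swap (e := G.rotB e₀)
      (hbW _ (rightV_eq_inl_iff.2 ((rightFace_rotB e₀).trans hf)))
    have hiff : ∀ e, (G.toQMap hG).swap.φ.SameCycle (G.rotB e₀) e ↔ G.rightV e = Sum.inl f := by
      intro e
      have hφ : (G.toQMap hG).swap.φ = G.rotB * (G.toQMap hG).φ * G.rotB⁻¹ := by
        change G.rotW⁻¹ * G.rotB⁻¹ = G.rotB * (G.rotB⁻¹ * G.rotW⁻¹) * G.rotB⁻¹
        group
      rw [hφ, Equiv.Perm.sameCycle_conj, Equiv.Perm.inv_def, Equiv.symm_apply_apply, ← leftFace_eq_iff hG,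
        rightV_eq_inl_iff, hf, eq_comm]
      rfl
    rw [← hs]
    symm
    exact Finset.sum_congr (Finset.filter_eq_filter _ hiff) fun e he =>
      (h.whiteAngle_eq hT (hbW e (Finset.mem_filter.1 he).2)).symm

theorem lengthsGaugeEquiv (h : Normalized hG a K Kinv)
    (hT : G.IsTRealisation K (G.FB a Kinv) (G.FW a Kinv) T) {χ : G.Edge → ℝ}
    {g : B → ℝ} {t : W → ℝ} (hg : ∀ b, g b ≠ 0) (ht : ∀ w, t w ≠ 0)
    (hK : ∀ e : G.Edge, |K e.1.1 e.1.2| = |g e.1.1| * χ e * |t e.1.2|) :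
    G.LengthsGaugeEquiv χ T := by
  refine ⟨fun b => √(a ^ 2 + 1) * ‖G.cplxB Kinv b‖ * |g b|, fun w => |t w| * ‖G.cplxW Kinv w‖,
    fun b => mul_pos (mul_pos (sqrt_sq_add_one_pos a) (norm_pos_iff.2 (h.cplxB_ne_zero b)))
      (abs_pos.2 (hg b)),
    fun w => mul_pos (abs_pos.2 (ht w)) (norm_pos_iff.2 (h.cplxW_ne_zero w)), fun e => ?_⟩
  have hs : ‖(√(a ^ 2 + 1) : ℂ)‖ = √(a ^ 2 + 1) := by
    rw [Complex.norm_real, Real.norm_eq_abs, abs_of_pos (sqrt_sq_add_one_pos a)]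
  rw [form hT e, norm_mul, norm_mul, norm_mul, hs, Complex.norm_real, Real.norm_eq_abs, onEdge, hK]
  ring

theorem exists_innerNbr (h : Normalized hG a K Kinv)
    (hT : G.IsTRealisation K (G.FB a Kinv) (G.FW a Kinv) T) (k : Fin 4) :
    ∃ t : ℝ, 0 < t ∧ T (G.innerNbr k) = T (G.v k) + t * bisectorDir k := by
  obtain ⟨⟨t0, ht0, e0⟩, ⟨t1, ht1, e1⟩, ⟨t2, ht2, e2⟩, ⟨t3, ht3, e3⟩⟩ := h.exists_inner hT
  fin_cases k
  · exact ⟨t0, ht0, by simpa [innerNbr, bisectorDir] using e0⟩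
  · exact ⟨t1, ht1, by simpa [innerNbr, bisectorDir] using e1⟩
  · exact ⟨t2, ht2, by simpa [innerNbr, bisectorDir, sub_eq_add_neg] using e2⟩
  · exact ⟨t3, ht3, by simpa [innerNbr, bisectorDir, sub_eq_add_neg] using e3⟩

theorem isPerfectTEmbedding (h : Normalized hG a K Kinv)
    (hT : G.IsTRealisation K (G.FB a Kinv) (G.FW a Kinv) T) (hT0 : T (G.v 0) = 0) {χ : G.Edge → ℝ}
    (hl : G.LengthsGaugeEquiv χ T) : G.IsPerfectTEmbedding χ T := by
  have hP : (fun k => T (G.v k)) = rhombus a √(a ^ 2 + 1) := funext (h.eq_rhombus hT hT0)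
  have hP' : ∀ k, T (G.v k) = rhombus a √(a ^ 2 + 1) k := h.eq_rhombus hT hT0
  refine ⟨h.isStraightEmbedding hT hT0, hl, h.angleCondition hT, ?_, fun k => ?_, fun k => ?_⟩
  · rw [hP]; exact isTangential_rhombus h.a_pos
  · obtain ⟨t, -, e⟩ := h.exists_innerNbr hT k
    rw [e, hP', hP', hP']
    exact rhombus_bisector k t
  · obtain ⟨t, ht, e⟩ := h.exists_innerNbr hT k
    rw [e, hP, hP']
    exact rhombus_inward h.a_pos (sqrt_sq_add_one_pos a) k ht

end Normalized

end Perfect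

end QuadGraph

theorem mainTheorem6 {B W : Type*} [Fintype B] [DecidableEq B] [Fintype W] [DecidableEq W]
    (G : QuadGraph B W) (hG : G.Nondegenerate)
    (χ : G.Edge → ℝ) (hχ : ∀ e, 0 < χ e)
    (K : Matrix B W ℝ) (hK : G.IsKasteleyn χ K) :
    ∃ (Kinv : Matrix W B ℝ) (a : ℝ),
      QuadGraph.IsInverse K Kinv ∧ a = G.aParam Kinv ∧ 0 < a ∧
      -- the normalization can be achieved by a gauge transformation at the boundary
      (∃ (K' : Matrix B W ℝ) (Kinv' : Matrix W B ℝ),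
        G.BoundaryGaugeEquiv K K' ∧ QuadGraph.IsInverse K' Kinv' ∧ G.IsNormalized a Kinv') ∧
      -- and for every normalized matrix in the gauge class:
      ∀ (K' : Matrix B W ℝ) (Kinv' : Matrix W B ℝ),
        QuadGraph.GaugeEquiv K K' → QuadGraph.IsInverse K' Kinv' → G.IsNormalized a Kinv' →
        G.IsCoulombGauge K' (G.FB a Kinv') (G.FW a Kinv') ∧
        (∃ T, G.IsTRealisation K' (G.FB a Kinv') (G.FW a Kinv') T ∧ T (G.v 0) = 0) ∧
        (∃ O, G.IsOrigami K' (G.FB a Kinv') (G.FW a Kinv') O ∧ O (G.v 0) = 0) ∧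
        (∀ T, G.IsTRealisation K' (G.FB a Kinv') (G.FW a Kinv') T → T (G.v 0) = 0 →
          G.IsPerfectTEmbedding χ T ∧
          T (G.v 1) = (a - Complex.I) * √(a ^ 2 + 1) ∧
          T (G.v 2) = 2 * a * √(a ^ 2 + 1) ∧
          T (G.v 3) = (a + Complex.I) * √(a ^ 2 + 1)) ∧
        (∀ O, G.IsOrigami K' (G.FB a Kinv') (G.FW a Kinv') O → O (G.v 0) = 0 →
          O (G.v 1) = -(a ^ 2 + 1) ∧ O (G.v 2) = 0 ∧ O (G.v 3) = -(a ^ 2 + 1)) := by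
  have hk := hK.kast hG hχ
  obtain ⟨Kinv, hinv⟩ := QuadGraph.exists_isInverse hG hk hK.off_edge
  have hr := QuadGraph.inverse_ratio_pos hG hk (hinv.cols hG hK.off_edge)
  refine ⟨Kinv, G.aParam Kinv, hinv, rfl, QuadGraph.aParam_pos hr,
    QuadGraph.exists_normalized hinv hr, ?_⟩
  rintro K' Kinv' ⟨g, t, hg, ht, hK'⟩ hinv' hnorm
  have hN : QuadGraph.Normalized hG (G.aParam Kinv) K' Kinv' :=
    { a_pos := QuadGraph.aParam_pos hr
      inv := hinv'
      off := fun b w hbw => by rw [hK', hK.off_edge b w hbw, mul_zero, zero_mul]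
      kast := hk.gauge hg ht fun e => hK' e.1.1 e.1.2
      norm := hnorm }
  refine ⟨QuadGraph.isCoulombGauge hinv' _, hN.exists_isTRealisation, hN.exists_isOrigami,
    fun T hT hT0 => ⟨hN.isPerfectTEmbedding hT hT0 (hN.lengthsGaugeEquiv hT hg ht fun e => ?_),
      hN.boundary_values hT hT0⟩, fun O hO hO0 => hN.origami_values hO hO0⟩
  have hχe : |K e.1.1 e.1.2| = χ e := by
    rcases hK.on_edge e with h | h <;> rw [h]
    · exact abs_of_pos (hχ e)
    · rw [abs_neg, abs_of_pos (hχ e)]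
  rw [hK', abs_mul, abs_mul, hχe]
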